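/- Let $\mathbb F$ be a field of characteristic $0$ and $\ell\ge 0$. Let $\mathcal V$ be an algebra of differential functions in $u_1,\dots,u_\ell$: a commutative $\mathbb F$-algebra containing the polynomial algebra $\mathbb F[u_i^{(n)}\mid 1\le i\le\ell,\ n\ge 0]$ (with $u_i=u_i^{(0)}$), with an $\mathbb F$-linear derivation $\partial$ satisfying $\partial u_i^{(n)}=u_i^{(n+1)}$ and commuting $\mathbb F$-linear derivations $\partial/\partial u_i^{(n)}$ of $\mathcal V$ extending the partial derivatives, such that for each $f\in\mathcal V$ only finitely many $\partial f/\partial u_i^{(n)}$ are nonzero, and $[\partial/\partial u_i^{(n)},\partial]=\partial/\partial u_i^{(n-1)}$ (which is $0$ for $n=0$). Assume that $\mathcal V$ is a domain, with field of fractions $\mathcal K$, to which $\partial$ extends. Pseudodifferential operators over $\mathcal V$ are the series $A(\partial)=\sum_{n\le N}a_n\partial^n$, $a_n\in\mathcal V$; they form the algebra $\mathcal V((\partial^{-1}))$ with $\partial^n\circ a=\sum_{j\ge0}\binom nj(\partial^ja)\partial^{n-j}$, and $A^*=\sum_n(-\partial)^n\circ a_n$. The symbol of $A(\partial)$ is $A(\lambda)=\sum_n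 a_n\lambda^n\in\mathcal V((\lambda^{-1}))$. For $n\in\mathbb Z$, $(\lambda+\partial)^n$ always means $\sum_{j\ge0}\binom nj\lambda^{n-j}\partial^j$. Let $\mathcal K(\partial)$ be the smallest subskewfield of $\mathcal K((\partial^{-1}))$ containing the differential operators $\mathcal V[\partial]$, and $\mathcal V(\partial)=\mathcal K(\partial)\cap\mathcal V((\partial^{-1}))$ the rational pseudodifferential operators with coefficients in $\mathcal V$. A matrix $H=(H_{ij})$ over $\mathcal V((\partial^{-1}))$ is skewadjoint if $(H_{ji})^*=-H_{ij}$ for all $i,j$. A non-local $\lambda$-bracket on $\mathcal V$ is an $\mathbb F$-bilinear map $\{\cdot_\lambda\cdot\}:\mathcal V\times\mathcal V\to\mathcal V((\lambda^{-1}))$ such that, for all $a,b,c\in\mathcal V$, $\{\partial a_\lambda b\}=-\lambda\{a_\lambda b\}$, $\{a_\lambda\partial b\}=(\lambda+\partial)\{a_\lambda b\}$, $\{a_\lambda bc\}=b\{a_\lambda c\}+c\{a_\lambda b\}$ and $\{ab_\lambda c\}=\{a_{\lambda+\partial}c\}_\to b+\{b_{\lambda+\partial}c\}_\to a$; here $\{a_{\lambda+\partial}c\}_\to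 b=\sum_n c_n(\lambda+\partial)^n b$ if $\{a_\lambda c\}=\sum_nc_n\lambda^n$. It is skewsymmetric if $\{b_\lambda a\}=-\{a_{-\lambda-\partial}b\}$ for all $a,b$, where $\{a_{-\lambda-\partial}b\}=\sum_n(-\lambda-\partial)^nc_n$ if $\{a_\lambda b\}=\sum_nc_n\lambda^n$. Let $\mathcal V_{\lambda,\mu}=\mathcal V[[\lambda^{-1},\mu^{-1},(\lambda+\mu)^{-1}]][\lambda,\mu]$ be the quotient of $\mathcal V[[\lambda^{-1},\mu^{-1},\nu^{-1}]][\lambda,\mu,\nu]$ by its submodule of multiples of $\nu-\lambda-\mu$. It is regarded as a subspace of $\mathcal V((\lambda^{-1}))((\mu^{-1}))$, of $\mathcal V((\mu^{-1}))((\lambda^{-1}))$, and of $\mathcal V(((\lambda+\mu)^{-1}))((\lambda^{-1}))$, by expanding respectively the powers of $\lambda+\mu$ in non-negative powers of $\lambda$, those of $\lambda+\mu$ in non-negative powers of $\mu$, and those of $\mu=(\lambda+\mu)-\lambda$ in non-negative powers of $\lambda+\mu$; these three spaces contain respectively $\{a_\lambda\{b_\mu c\}\}$, $\{b_\mu\{a_\lambda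 c\}\}$ and $\{\{a_\lambda b\}_{\lambda+\mu}c\}$. The bracket is admissible if $\{a_\lambda\{b_\mu c\}\}\in\mathcal V_{\lambda,\mu}$ for all $a,b,c$. The Jacobi identity holds for $a,b,c$ if all three of these elements lie in $\mathcal V_{\lambda,\mu}$ and, in $\mathcal V_{\lambda,\mu}$, $\{a_\lambda\{b_\mu c\}\}-\{b_\mu\{a_\lambda c\}\}=\{\{a_\lambda b\}_{\lambda+\mu}c\}$. A Poisson non-local $\lambda$-bracket is a skewsymmetric admissible non-local $\lambda$-bracket satisfying the Jacobi identity for all $a,b,c\in\mathcal V$. Let $H=(H_{ij})_{i,j=1}^\ell\in\mathrm{Mat}_{\ell\times\ell}\,\mathcal V((\partial^{-1}))$ and consider the Master Formula $$\{f_\lambda g\}_H=\sum_{i,j=1}^{\ell}\ \sum_{m,n\ge0}\frac{\partial g}{\partial u_j^{(n)}}(\lambda+\partial)^nH_{ji}(\lambda+\partial)(-\lambda-\partial)^m\frac{\partial f}{\partial u_i^{(m)}}\qquad(f,g\in\mathcal V).$$ **Theorem.** (a) For all $f,g\in\mathcal V$ only finitely many terms of the sum are nonzero, and the Master Formula defines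 a non-local $\lambda$-bracket on $\mathcal V$. (b) This bracket is skewsymmetric if and only if $H$ is skewadjoint. (c) If all entries of $H$ lie in $\mathcal V(\partial)$, then the bracket $\{\cdot_\lambda\cdot\}_H$ is admissible. (d) If $H$ is skewadjoint and all its entries lie in $\mathcal V(\partial)$, then $\{\cdot_\lambda\cdot\}_H$ is a Poisson non-local $\lambda$-bracket if and only if it satisfies the Jacobi identity for all $a,b,c\in\mathcal V$, and this holds if and only if the Jacobi identity holds for all triples of generators $u_i,u_j,u_k$, $1\le i,j,k\le\ell$. -/

import Mathlib

namespace NonlocalPVA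

/-! ### Laurent series in the inverse of an indeterminate

The space `V((λ⁻¹))` is Mathlib's `LaurentSeries V`, whose variable is read as `λ⁻¹`. -/

section LaurentSeries

variable {V : Type*}

/-- The coefficient of `λ ^ n` in a Laurent series in `λ⁻¹`. -/
def lcoeff [Zero V] (A : LaurentSeries V) (n : ℤ) : V := HahnSeries.coeff A (-n)

/-- The Laurent series `∑ f n λ ^ n` in `λ⁻¹`, for `f` vanishing at all large `n`. -/
noncomputable def ofCoeff [Zero V] (f : ℤ → V) (hf : ∃ N : ℤ, ∀ n, N < n → f n = 0) :
    LaurentSeries V :=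
  HahnSeries.ofSuppBddBelow (fun n => f (-n)) (by
    obtain ⟨N, hN⟩ := hf
    refine ⟨-N, fun n hn => ?_⟩
    by_contra h
    exact hn (hN (-n) (by omega)))

@[simp] theorem lcoeff_ofCoeff [Zero V] (f : ℤ → V) (hf : ∃ N : ℤ, ∀ n, N < n → f n = 0)
    (n : ℤ) : lcoeff (ofCoeff f hf) n = f n := by
  simp [lcoeff, ofCoeff]

theorem ext_lcoeff [Zero V] {A B : LaurentSeries V} (h : ∀ n, lcoeff A n = lcoeff B n) :
    A = B := by
  ext n
  simpa [lcoeff] using h (-n)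

theorem exists_lcoeff_eq_zero [Zero V] (A : LaurentSeries V) :
    ∃ N : ℤ, ∀ n, N < n → lcoeff A n = 0 :=
  ⟨-HahnSeries.order A, fun n hn => HahnSeries.coeff_eq_zero_of_lt_order (by omega)⟩

/-- The monomial `a λ ^ n`. -/
noncomputable def monom [Zero V] (n : ℤ) (a : V) : LaurentSeries V := HahnSeries.single (-n) a

end LaurentSeries

/-! ### Pseudodifferential operators, through their symbols

A pseudodifferential operator `∑ aₙ ∂ ^ n` over a differential ring `(V, ∂)` is identified with its
symbol `∑ aₙ λ ^ n` in `V((λ⁻¹))`. -/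

section Symbols

variable {F V : Type*} [CommRing F] [CommRing V] [Algebra F V] (δ : Derivation F V V)

/-- The term `(m, j)` of the coefficient of `λ ^ k` in `A(λ + ∂) B(λ)`. -/
noncomputable def shiftTerm (A B : LaurentSeries V) (k : ℤ) (q : ℤ × ℕ) : V :=
  (Ring.choose q.1 q.2 : ℤ) • (lcoeff A q.1 * (δ : V → V)^[q.2] (lcoeff B (k - q.1 + q.2)))

/-- The sums defining `A(λ + ∂) B(λ)` are finite. -/
theorem shiftTerm_support_finite (A B : LaurentSeries V) (k : ℤ) :
    (Function.support (shiftTerm δ A B k)).Finite := by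
  obtain ⟨M, hM⟩ := exists_lcoeff_eq_zero A
  obtain ⟨N, hN⟩ := exists_lcoeff_eq_zero B
  refine Set.Finite.subset
    (((Finset.Icc (k - N) M) ×ˢ (Finset.range (N - k + M + 1).toNat) : Finset (ℤ × ℕ)).finite_toSet)
    ?_
  rintro ⟨m, j⟩ h
  have h1 : m ≤ M := by
    by_contra hc
    exact h (by simp [shiftTerm, hM m (by omega)])
  have h2 : k - m + j ≤ N := by
    by_contra hc
    exact h (by simp [shiftTerm, hN (k - m + j) (by omega)])
  simp only [Finset.coe_product, Set.mem_prod, Finset.mem_coe, Finset.mem_Icc, Finset.mem_range]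
  omega

/-- `A(λ + ∂) B(λ)`: for `A = ∑ aₘ λ ^ m` this is `∑ aₘ (λ + ∂) ^ m B(λ)`, where
`(λ + ∂) ^ m = ∑ⱼ binom(m, j) λ ^ (m - j) ∂ ^ j` and `∂` acts on the coefficients of `B`.
It is the symbol of the product `A ∘ B` of pseudodifferential operators. -/
noncomputable def shiftApply (A B : LaurentSeries V) : LaurentSeries V :=
  ofCoeff (fun k => ∑ᶠ q : ℤ × ℕ, shiftTerm δ A B k q) (by
    obtain ⟨M, hM⟩ := exists_lcoeff_eq_zero A
    obtain ⟨N, hN⟩ := exists_lcoeff_eq_zero B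
    refine ⟨M + N, fun k hk => finsum_eq_zero_of_forall_eq_zero fun q => ?_⟩
    by_cases h : M < q.1
    · simp [shiftTerm, hM _ h]
    · simp [shiftTerm, hN (k - q.1 + q.2) (by omega)])

/-- `A(-λ - ∂)` with `-λ - ∂` moved to the left, that is `∑ (-λ - ∂) ^ n aₙ` for `A = ∑ aₙ λ ^ n`.
The coefficient of `λ ^ m` is `∑ₖ binom(m + k, k) (-1) ^ (m + k) ∂ ^ k (a₍ₘ₊ₖ₎)`.
As an operation on symbols this is the adjoint `A* = ∑ (-∂) ^ n ∘ aₙ` of `A = ∑ aₙ ∂ ^ n`. -/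
noncomputable def adjoint (A : LaurentSeries V) : LaurentSeries V :=
  ofCoeff (fun m => ∑ᶠ k : ℕ, ((Ring.choose (m + k) k : ℤ) * ((m + k).negOnePow : ℤ)) •
      (δ : V → V)^[k] (lcoeff A (m + k))) (by
    obtain ⟨N, hN⟩ := exists_lcoeff_eq_zero A
    refine ⟨N, fun m hm => finsum_eq_zero_of_forall_eq_zero fun k => ?_⟩
    simp [hN (m + k) (by omega)])

/-- `∂` acting on the coefficients of a Laurent series. -/
noncomputable def coeffDer (A : LaurentSeries V) : LaurentSeries V := HahnSeries.map A δ

/-- A matrix pseudodifferential operator is skewadjoint if `H* = -H`, where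
`(H*)ᵢⱼ = (Hⱼᵢ)*`. -/
def IsSkewadjoint {ι : Type*} (H : Matrix ι ι (LaurentSeries V)) : Prop :=
  ∀ i j, adjoint δ (H j i) = -H i j

end Symbols

/-! ### The space `V_{λ,μ}` -/

section TwoVariables

variable (F V : Type*) [CommRing F] [AddCommGroup V] [Module F V]

/-- `V[[λ⁻¹, μ⁻¹, ν⁻¹]][λ, μ, ν]`: families of coefficients of `λ ^ m μ ^ n ν ^ p` which vanish
as soon as one of `m`, `n`, `p` is large. -/
def Series3 : Submodule F (ℤ → ℤ → ℤ → V) where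
  carrier := {a | ∃ N : ℤ, ∀ m n p, (N < m ∨ N < n ∨ N < p) → a m n p = 0}
  zero_mem' := ⟨0, fun _ _ _ _ => rfl⟩
  add_mem' := by
    rintro a b ⟨M, hM⟩ ⟨N, hN⟩
    refine ⟨max M N, fun m n p h => ?_⟩
    simp only [Pi.add_apply]
    rw [hM m n p (by omega), hN m n p (by omega), add_zero]
  smul_mem' := by
    rintro c a ⟨N, hN⟩
    refine ⟨N, fun m n p h => ?_⟩
    simp only [Pi.smul_apply]
    rw [hN m n p h, smul_zero]

/-- Multiplication by `ν - λ - μ`. -/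
def mulRel : Series3 F V →ₗ[F] Series3 F V where
  toFun a := ⟨fun m n p => a.1 m n (p - 1) - a.1 (m - 1) n p - a.1 m (n - 1) p, by
    obtain ⟨N, hN⟩ := a.2
    refine ⟨N + 1, fun m n p h => ?_⟩
    beta_reduce
    rw [hN m n (p - 1) (by omega), hN (m - 1) n p (by omega), hN m (n - 1) p (by omega)]
    simp⟩
  map_add' a b := by
    ext m n p
    simp only [Submodule.coe_add, Pi.add_apply]
    abel
  map_smul' c a := by
    ext m n p
    simp [smul_sub]

/-- `V_{λ,μ} = V[[λ⁻¹, μ⁻¹, (λ + μ)⁻¹]][λ, μ]`, the quotient of `V[[λ⁻¹, μ⁻¹, ν⁻¹]][λ, μ, ν]` by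
the multiples of `ν - λ - μ`. -/
abbrev Vlm : Type _ := Series3 F V ⧸ LinearMap.range (mulRel F V)

variable {F V}

theorem support_finite_of_bound {G : ℤ → ℕ → V} {N c : ℤ}
    (hG : ∀ (p : ℤ) (k : ℕ), (N < p ∨ N < c - p + k) → G p k = 0) (b : ℤ → ℕ → ℤ) :
    Function.support (fun q : ℤ × ℕ => b q.1 q.2 • G q.1 q.2) ⊆
      ((Finset.Icc (c - N) N) ×ˢ (Finset.range (2 * N - c + 1).toNat) : Finset (ℤ × ℕ)) := by
  rintro ⟨p, k⟩ h
  have h1 : ¬ (N < p ∨ N < c - p + k) := fun hc => h (by simp [hG p k hc])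
  simp only [Finset.coe_product, Set.mem_prod, Finset.mem_coe, Finset.mem_Icc, Finset.mem_range]
  omega

theorem support_finite {G : ℤ → ℕ → V} {N c : ℤ}
    (hG : ∀ (p : ℤ) (k : ℕ), (N < p ∨ N < c - p + k) → G p k = 0) (b : ℤ → ℕ → ℤ) :
    (Function.support (fun q : ℤ × ℕ => b q.1 q.2 • G q.1 q.2)).Finite :=
  (Finset.finite_toSet _).subset (support_finite_of_bound hG b)

theorem finsum_shift (f : ℤ → ℕ → V) :
    ∑ᶠ q : ℤ × ℕ, f q.1 q.2 = ∑ᶠ q : ℤ × ℕ, f (q.1 + 1) q.2 :=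
  (finsum_comp_equiv ((Equiv.addRight (1 : ℤ)).prodCongr (Equiv.refl ℕ))
    (f := fun q : ℤ × ℕ => f q.1 q.2)).symm

theorem finsum_pascal {G : ℤ → ℕ → V} {N c : ℤ}
    (hG : ∀ (p : ℤ) (k : ℕ), (N < p ∨ N < c - p + k) → G p k = 0) :
    ∑ᶠ q : ℤ × ℕ, (Ring.choose (q.1 + 1) q.2 : ℤ) • G q.1 q.2 =
      ∑ᶠ q : ℤ × ℕ, (Ring.choose q.1 q.2 : ℤ) • G q.1 (q.2 + 1) +
      ∑ᶠ q : ℤ × ℕ, (Ring.choose q.1 q.2 : ℤ) • G q.1 q.2 := by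
  set K := (2 * N - c + 1).toNat with hK
  have hG' : ∀ (p : ℤ) (k : ℕ), (N < p ∨ N < c - p + k) → (fun p k => G p (k + 1)) p k = 0 := fun p k h =>
    hG p (k + 1) (by push_cast; omega)
  have hz : ∀ p ∈ Finset.Icc (c - N) N, ∀ k, K ≤ k → G p k = 0 := fun p hp k hk => by
    rw [Finset.mem_Icc] at hp
    exact hG p k (by omega)
  rw [finsum_eq_sum_of_support_subset _ (support_finite_of_bound hG fun p k => Ring.choose (p + 1) k),
    finsum_eq_sum_of_support_subset _ (support_finite_of_bound hG fun p k => Ring.choose p k),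
    finsum_eq_sum_of_support_subset _ (support_finite_of_bound hG' fun p k => Ring.choose p k),
    Finset.sum_product, Finset.sum_product, Finset.sum_product, ← Finset.sum_add_distrib]
  refine Finset.sum_congr rfl fun p hp => ?_
  have e : ∀ b : ℕ → ℤ, ∑ k ∈ Finset.range K, b k • G p k
      = ∑ k ∈ Finset.range (K + 1), b k • G p k := fun b => by
    rw [Finset.sum_range_succ, hz p hp K le_rfl, smul_zero, add_zero]
  simp only [← hK]
  rw [e, e, Finset.sum_range_succ', Finset.sum_range_succ' (fun k => (Ring.choose p k : ℤ) • G p k),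
    ← add_assoc, ← Finset.sum_add_distrib]
  congr 1
  · refine Finset.sum_congr rfl fun k _ => ?_
    rw [Ring.choose_succ_succ, add_smul]
  · simp

/-- The expansion `V_{λ,μ} → V((λ⁻¹))((μ⁻¹))` in the region `|μ| > |λ|`, on representatives:
`ν ^ p = (λ + μ) ^ p` is replaced by `∑ₖ binom(p, k) λ ^ k μ ^ (p - k)`.
The value at `(i, j)` is the coefficient of `λ ^ i μ ^ j`. -/
noncomputable def expandMuLambdaAux : Series3 F V →ₗ[F] (ℤ → ℤ → V) where
  toFun a i j := ∑ᶠ q : ℤ × ℕ, (Ring.choose q.1 q.2 : ℤ) • a.1 (i - q.2) (j - q.1 + q.2) q.1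
  map_add' a b := by
    ext i j
    obtain ⟨M, hM⟩ := a.2
    obtain ⟨N, hN⟩ := b.2
    have h1 := support_finite (G := fun p k => a.1 (i - k) (j - p + k) p) (N := M) (c := j)
      (fun p k h => hM _ _ _ (by tauto)) fun p k => Ring.choose p k
    have h2 := support_finite (G := fun p k => b.1 (i - k) (j - p + k) p) (N := N) (c := j)
      (fun p k h => hN _ _ _ (by tauto)) fun p k => Ring.choose p k
    simp only [Submodule.coe_add, Pi.add_apply, smul_add]
    exact finsum_add_distrib h1 h2
  map_smul' c a := by
    ext i j
    obtain ⟨M, hM⟩ := a.2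
    have h1 := support_finite (G := fun p k => a.1 (i - k) (j - p + k) p) (N := M) (c := j)
      (fun p k h => hM _ _ _ (by tauto)) fun p k => Ring.choose p k
    simp only [Submodule.coe_smul, Pi.smul_apply, RingHom.id_apply]
    rw [smul_finsum' c h1]
    exact finsum_congr fun q => smul_comm _ _ _

/-- The expansion `V_{λ,μ} → V((μ⁻¹))((λ⁻¹))` in the region `|λ| > |μ|`, on representatives:
`ν ^ p = (λ + μ) ^ p` is replaced by `∑ₖ binom(p, k) μ ^ k λ ^ (p - k)`.
The value at `(i, j)` is the coefficient of `λ ^ i μ ^ j`. -/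
noncomputable def expandLambdaMuAux : Series3 F V →ₗ[F] (ℤ → ℤ → V) where
  toFun a i j := ∑ᶠ q : ℤ × ℕ, (Ring.choose q.1 q.2 : ℤ) • a.1 (i - q.1 + q.2) (j - q.2) q.1
  map_add' a b := by
    ext i j
    obtain ⟨M, hM⟩ := a.2
    obtain ⟨N, hN⟩ := b.2
    have h1 := support_finite (G := fun p k => a.1 (i - p + k) (j - k) p) (N := M) (c := i)
      (fun p k h => hM _ _ _ (by tauto)) fun p k => Ring.choose p k
    have h2 := support_finite (G := fun p k => b.1 (i - p + k) (j - k) p) (N := N) (c := i)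
      (fun p k h => hN _ _ _ (by tauto)) fun p k => Ring.choose p k
    simp only [Submodule.coe_add, Pi.add_apply, smul_add]
    exact finsum_add_distrib h1 h2
  map_smul' c a := by
    ext i j
    obtain ⟨M, hM⟩ := a.2
    have h1 := support_finite (G := fun p k => a.1 (i - p + k) (j - k) p) (N := M) (c := i)
      (fun p k h => hM _ _ _ (by tauto)) fun p k => Ring.choose p k
    simp only [Submodule.coe_smul, Pi.smul_apply, RingHom.id_apply]
    rw [smul_finsum' c h1]
    exact finsum_congr fun q => smul_comm _ _ _

/-- The expansion `V_{λ,μ} → V(((λ + μ)⁻¹))((λ⁻¹))` in the region `|λ| > |λ + μ|`, on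
representatives: with `ν = λ + μ`, the power `μ ^ n = (ν - λ) ^ n` is replaced by
`∑ₖ binom(n, k) (-1) ^ (n - k) ν ^ k λ ^ (n - k)`.
The value at `(i, j)` is the coefficient of `λ ^ i ν ^ j`. -/
noncomputable def expandLambdaNuAux : Series3 F V →ₗ[F] (ℤ → ℤ → V) where
  toFun a i j := ∑ᶠ q : ℤ × ℕ, ((Ring.choose q.1 q.2 : ℤ) * ((q.1 - q.2).negOnePow : ℤ)) •
    a.1 (i - q.1 + q.2) q.1 (j - q.2)
  map_add' a b := by
    ext i j
    obtain ⟨M, hM⟩ := a.2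
    obtain ⟨N, hN⟩ := b.2
    have h1 := support_finite (G := fun p k => a.1 (i - p + k) p (j - k)) (N := M) (c := i)
      (fun p k h => hM _ _ _ (by tauto)) fun p k => Ring.choose p k * ((p - k).negOnePow : ℤ)
    have h2 := support_finite (G := fun p k => b.1 (i - p + k) p (j - k)) (N := N) (c := i)
      (fun p k h => hN _ _ _ (by tauto)) fun p k => Ring.choose p k * ((p - k).negOnePow : ℤ)
    simp only [Submodule.coe_add, Pi.add_apply, smul_add]
    exact finsum_add_distrib h1 h2
  map_smul' c a := by
    ext i j
    obtain ⟨M, hM⟩ := a.2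
    have h1 := support_finite (G := fun p k => a.1 (i - p + k) p (j - k)) (N := M) (c := i)
      (fun p k h => hM _ _ _ (by tauto)) fun p k => Ring.choose p k * ((p - k).negOnePow : ℤ)
    simp only [Submodule.coe_smul, Pi.smul_apply, RingHom.id_apply]
    rw [smul_finsum' c h1]
    exact finsum_congr fun q => smul_comm _ _ _

theorem expandMuLambdaAux_mulRel (a : Series3 F V) : expandMuLambdaAux (mulRel F V a) = 0 := by
  ext i j
  obtain ⟨N, hN⟩ := a.2
  set G : ℤ → ℕ → V := fun p k => a.1 (i - k) (j - 1 - p + k) p with hGdef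
  have hG : ∀ (p : ℤ) (k : ℕ), (N < p ∨ N < j - 1 - p + k) → G p k = 0 := fun p k h => hN _ _ _ (by tauto)
  have hpas := finsum_pascal hG
  have hS := finsum_shift fun p k => (Ring.choose p k : ℤ) • G (p - 1) k
  simp only [add_sub_cancel_right] at hS
  have f1 := support_finite (G := fun p k => G (p - 1) k) (N := N + 1) (c := j)
    (fun p k h => hG _ _ (by omega)) fun p k => Ring.choose p k
  have f2 := support_finite (G := fun p k => G p (k + 1)) (N := N) (c := j)
    (fun p k h => hG _ _ (by push_cast; omega)) fun p k => Ring.choose p k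
  have f3 := support_finite hG fun p k => Ring.choose p k
  have key : ∀ q : ℤ × ℕ, (Ring.choose q.1 q.2 : ℤ) •
      (mulRel F V a).1 (i - q.2) (j - q.1 + q.2) q.1 =
      (Ring.choose q.1 q.2 : ℤ) • G (q.1 - 1) q.2 - ((Ring.choose q.1 q.2 : ℤ) • G q.1 (q.2 + 1) +
        (Ring.choose q.1 q.2 : ℤ) • G q.1 q.2) := by
    rintro ⟨p, k⟩
    have i1 : j - 1 - (p - 1) + (k : ℤ) = j - p + k := by ring
    have i2 : i - ((k : ℤ) + 1) = i - k - 1 := by ring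
    have i3 : j - 1 - p + ((k : ℤ) + 1) = j - p + k := by ring
    have i4 : j - 1 - p + (k : ℤ) = j - p + k - 1 := by ring
    simp only [mulRel, LinearMap.coe_mk, AddHom.coe_mk, hGdef, ← smul_add, ← smul_sub,
      Nat.cast_add, Nat.cast_one, i1, i2, i3, i4]
    congr 1
    abel
  change ∑ᶠ q : ℤ × ℕ, _ = (0 : V)
  rw [finsum_congr key, finsum_sub_distrib f1 ((f2.union f3).subset (Function.support_add _ _)),
    finsum_add_distrib f2 f3, hS, hpas, sub_self]

theorem expandLambdaMuAux_mulRel (a : Series3 F V) : expandLambdaMuAux (mulRel F V a) = 0 := by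
  ext i j
  obtain ⟨N, hN⟩ := a.2
  set G : ℤ → ℕ → V := fun p k => a.1 (i - 1 - p + k) (j - k) p with hGdef
  have hG : ∀ (p : ℤ) (k : ℕ), (N < p ∨ N < i - 1 - p + k) → G p k = 0 := fun p k h => hN _ _ _ (by tauto)
  have hpas := finsum_pascal hG
  have hS := finsum_shift fun p k => (Ring.choose p k : ℤ) • G (p - 1) k
  simp only [add_sub_cancel_right] at hS
  have f1 := support_finite (G := fun p k => G (p - 1) k) (N := N + 1) (c := i)
    (fun p k h => hG _ _ (by omega)) fun p k => Ring.choose p k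
  have f2 := support_finite (G := fun p k => G p (k + 1)) (N := N) (c := i)
    (fun p k h => hG _ _ (by push_cast; omega)) fun p k => Ring.choose p k
  have f3 := support_finite hG fun p k => Ring.choose p k
  have key : ∀ q : ℤ × ℕ, (Ring.choose q.1 q.2 : ℤ) •
      (mulRel F V a).1 (i - q.1 + q.2) (j - q.2) q.1 =
      (Ring.choose q.1 q.2 : ℤ) • G (q.1 - 1) q.2 - ((Ring.choose q.1 q.2 : ℤ) • G q.1 (q.2 + 1) +
        (Ring.choose q.1 q.2 : ℤ) • G q.1 q.2) := by
    rintro ⟨p, k⟩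
    have i1 : i - 1 - (p - 1) + (k : ℤ) = i - p + k := by ring
    have i2 : i - 1 - p + ((k : ℤ) + 1) = i - p + k := by ring
    have i3 : j - ((k : ℤ) + 1) = j - k - 1 := by ring
    have i4 : i - 1 - p + (k : ℤ) = i - p + k - 1 := by ring
    simp only [mulRel, LinearMap.coe_mk, AddHom.coe_mk, hGdef, ← smul_add, ← smul_sub,
      Nat.cast_add, Nat.cast_one, i1, i2, i3, i4]
    congr 1
    abel
  change ∑ᶠ q : ℤ × ℕ, _ = (0 : V)
  rw [finsum_congr key, finsum_sub_distrib f1 ((f2.union f3).subset (Function.support_add _ _)),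
    finsum_add_distrib f2 f3, hS, hpas, sub_self]

theorem expandLambdaNuAux_mulRel (a : Series3 F V) : expandLambdaNuAux (mulRel F V a) = 0 := by
  ext i j
  obtain ⟨N, hN⟩ := a.2
  set G : ℤ → ℕ → V := fun n k => ((n - k).negOnePow : ℤ) • a.1 (i - 1 - n + k) n (j - k)
    with hGdef
  have hG : ∀ (p : ℤ) (k : ℕ), (N < p ∨ N < i - 1 - p + k) → G p k = 0 := fun p k h => by
    simp only [hGdef]
    rw [hN _ _ _ (by tauto), smul_zero]
  have hpas := finsum_pascal hG
  have hS := finsum_shift fun p k => (Ring.choose p k : ℤ) • G (p - 1) k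
  simp only [add_sub_cancel_right] at hS
  have f1 := support_finite (G := fun p k => G (p - 1) k) (N := N + 1) (c := i)
    (fun p k h => hG _ _ (by omega)) fun p k => Ring.choose p k
  have f2 := support_finite (G := fun p k => G p (k + 1)) (N := N) (c := i)
    (fun p k h => hG _ _ (by push_cast; omega)) fun p k => Ring.choose p k
  have f3 := support_finite hG fun p k => Ring.choose p k
  have key : ∀ q : ℤ × ℕ, ((Ring.choose q.1 q.2 : ℤ) * ((q.1 - q.2).negOnePow : ℤ)) •
      (mulRel F V a).1 (i - q.1 + q.2) q.1 (j - q.2) =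
      (Ring.choose q.1 q.2 : ℤ) • G (q.1 - 1) q.2 - ((Ring.choose q.1 q.2 : ℤ) • G q.1 (q.2 + 1) +
        (Ring.choose q.1 q.2 : ℤ) • G q.1 q.2) := by
    rintro ⟨p, k⟩
    have e1 : ((p - 1 - (k : ℤ)).negOnePow : ℤ) = -((p - k).negOnePow : ℤ) := by
      rw [show p - 1 - (k : ℤ) = (p - k) - 1 by ring, Int.negOnePow_sub]
      simp
    have e2 : ((p - ((k : ℤ) + 1)).negOnePow : ℤ) = -((p - k).negOnePow : ℤ) := by
      rw [show p - ((k : ℤ) + 1) = (p - k) - 1 by ring, Int.negOnePow_sub]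
      simp
    have i1 : i - 1 - (p - 1) + (k : ℤ) = i - p + k := by ring
    have i2 : i - 1 - p + ((k : ℤ) + 1) = i - p + k := by ring
    have i3 : j - ((k : ℤ) + 1) = j - k - 1 := by ring
    have i4 : i - 1 - p + (k : ℤ) = i - p + k - 1 := by ring
    simp only [mulRel, LinearMap.coe_mk, AddHom.coe_mk, hGdef, Nat.cast_add, Nat.cast_one, e1, e2,
      i1, i2, i3, i4, mul_smul, ← smul_add, ← smul_sub, neg_smul]
    congr 1
    rw [smul_sub, smul_sub]
    abel
  change ∑ᶠ q : ℤ × ℕ, _ = (0 : V)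
  rw [finsum_congr key, finsum_sub_distrib f1 ((f2.union f3).subset (Function.support_add _ _)),
    finsum_add_distrib f2 f3, hS, hpas, sub_self]

variable (F V)

/-- The embedding `V_{λ,μ} → V((λ⁻¹))((μ⁻¹))`; the value at `(i, j)` is the coefficient of
`λ ^ i μ ^ j`. -/
noncomputable def expandMuLambda : Vlm F V →ₗ[F] (ℤ → ℤ → V) :=
  (LinearMap.range (mulRel F V)).liftQ expandMuLambdaAux (by
    rintro _ ⟨a, rfl⟩
    exact expandMuLambdaAux_mulRel a)

/-- The embedding `V_{λ,μ} → V((μ⁻¹))((λ⁻¹))`; the value at `(i, j)` is the coefficient of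
`λ ^ i μ ^ j`. -/
noncomputable def expandLambdaMu : Vlm F V →ₗ[F] (ℤ → ℤ → V) :=
  (LinearMap.range (mulRel F V)).liftQ expandLambdaMuAux (by
    rintro _ ⟨a, rfl⟩
    exact expandLambdaMuAux_mulRel a)

/-- The embedding `V_{λ,μ} → V(((λ + μ)⁻¹))((λ⁻¹))`; the value at `(i, j)` is the coefficient of
`λ ^ i (λ + μ) ^ j`. -/
noncomputable def expandLambdaNu : Vlm F V →ₗ[F] (ℤ → ℤ → V) :=
  (LinearMap.range (mulRel F V)).liftQ expandLambdaNuAux (by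
    rintro _ ⟨a, rfl⟩
    exact expandLambdaNuAux_mulRel a)

end TwoVariables

/-! ### Non-local `λ`-brackets -/

section Brackets

variable {F V : Type*} [Field F] [CommRing V] [Algebra F V] (δ : Derivation F V V)
  (B : V → V → LaurentSeries V)

/-- A non-local `λ`-bracket `B a b = {a_λ b}` on the differential algebra `(V, δ)`: bilinear,
sesquilinear, and satisfying the left and right Leibniz rules. -/
structure IsNonlocalBracket : Prop where
  linear_left : ∀ b, IsLinearMap F fun a => B a b
  linear_right : ∀ a, IsLinearMap F fun b => B a b
  /-- `{∂a_λ b} = -λ {a_λ b}` -/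
  sesq_left : ∀ a b, B (δ a) b = -(monom 1 1 * B a b)
  /-- `{a_λ ∂b} = (λ + ∂) {a_λ b}` -/
  sesq_right : ∀ a b, B a (δ b) = monom 1 1 * B a b + coeffDer δ (B a b)
  /-- `{a_λ bc} = b {a_λ c} + c {a_λ b}` -/
  leibniz_left : ∀ a b c, B a (b * c) = b • B a c + c • B a b
  /-- `{ab_λ c} = {a_{λ+∂} c}_→ b + {b_{λ+∂} c}_→ a` -/
  leibniz_right : ∀ a b c, B (a * b) c =
    shiftApply δ (B a c) (monom 0 b) + shiftApply δ (B b c) (monom 0 a)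

/-- `{b_λ a} = -{a_{-λ-∂} b}`. -/
def IsSkewsymmetric : Prop := ∀ a b, B b a = -adjoint δ (B a b)

/-- `{a_λ {b_μ c}}` as an element of `V((λ⁻¹))((μ⁻¹))`: the coefficient of `λ ^ m μ ^ n`. -/
def nestedRight (a b c : V) (m n : ℤ) : V := lcoeff (B a (lcoeff (B b c) n)) m

/-- `{{a_λ b}_{λ+μ} c}` as an element of `V(((λ + μ)⁻¹))((λ⁻¹))`: the coefficient of
`λ ^ m (λ + μ) ^ n`. -/
def nestedLeft (a b c : V) (m n : ℤ) : V := lcoeff (B (lcoeff (B a b) m) c) n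

variable (F) in
/-- `{a_λ {b_μ c}}` lies in `V_{λ,μ}` for all `a`, `b`, `c`. -/
def IsAdmissible : Prop :=
  ∀ a b c, ∃ X : Vlm F V, expandMuLambda F V X = nestedRight B a b c

variable (F) in
/-- The Jacobi identity `{a_λ {b_μ c}} - {b_μ {a_λ c}} = {{a_λ b}_{λ+μ} c}` for the triple
`a, b, c`: the three terms are the respective expansions of elements `X`, `Y`, `Z` of `V_{λ,μ}`,
and `X - Y = Z` in `V_{λ,μ}`. -/
def JacobiAt (a b c : V) : Prop :=
  ∃ X Y Z : Vlm F V,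
    expandMuLambda F V X = nestedRight B a b c ∧
    expandLambdaMu F V Y = (fun m n => nestedRight B b a c n m) ∧
    expandLambdaNu F V Z = nestedLeft B a b c ∧
    X - Y = Z

/-- A non-local Poisson `λ`-bracket on the differential algebra `(V, δ)`. -/
structure IsNonlocalPoisson : Prop where
  bracket : IsNonlocalBracket δ B
  skew : IsSkewsymmetric δ B
  admissible : IsAdmissible F B
  jacobi : ∀ a b c, JacobiAt F B a b c

end Brackets

/-! ### Rational pseudodifferential operators -/

section Rational

variable {F V : Type*} [Field F] [CommRing V] [IsDomain V] [Algebra F V] (δ : Derivation F V V)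

/-- The ring homomorphism `a ↦ a + ε δ(a)` from `V` to the dual numbers over its field of
fractions. -/
noncomputable def dualHom : V →+* TrivSqZeroExt (FractionRing V) (FractionRing V) where
  toFun a := TrivSqZeroExt.inl (algebraMap V (FractionRing V) a) +
    TrivSqZeroExt.inr (algebraMap V (FractionRing V) (δ a))
  map_one' := by rw [Derivation.map_one_eq_zero]; simp
  map_zero' := by rw [map_zero δ]; simp
  map_add' a b := by
    rw [map_add δ, map_add, map_add, TrivSqZeroExt.inl_add, TrivSqZeroExt.inr_add]
    abel
  map_mul' a b := by
    rw [Derivation.leibniz, map_add, smul_eq_mul, smul_eq_mul, map_mul, map_mul, map_mul]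
    refine TrivSqZeroExt.ext ?_ ?_
    · simp only [TrivSqZeroExt.fst_add, TrivSqZeroExt.fst_mul, TrivSqZeroExt.fst_inl,
        TrivSqZeroExt.fst_inr, add_zero]
    · simp only [TrivSqZeroExt.fst_add, TrivSqZeroExt.snd_add, TrivSqZeroExt.snd_mul,
        TrivSqZeroExt.fst_inl, TrivSqZeroExt.fst_inr, TrivSqZeroExt.snd_inl,
        TrivSqZeroExt.snd_inr, add_zero, zero_add, smul_eq_mul, MulOpposite.smul_eq_mul_unop,
        MulOpposite.unop_op]
      ring

theorem dualHom_fst (a : V) : (dualHom δ a).fst = algebraMap V (FractionRing V) a := by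
  change (TrivSqZeroExt.inl _ + TrivSqZeroExt.inr _ :
    TrivSqZeroExt (FractionRing V) (FractionRing V)).fst = _
  rw [TrivSqZeroExt.fst_add, TrivSqZeroExt.fst_inl, TrivSqZeroExt.fst_inr, add_zero]

theorem dualHom_snd (a : V) : (dualHom δ a).snd = algebraMap V (FractionRing V) (δ a) := by
  change (TrivSqZeroExt.inl _ + TrivSqZeroExt.inr _ :
    TrivSqZeroExt (FractionRing V) (FractionRing V)).snd = _
  rw [TrivSqZeroExt.snd_add, TrivSqZeroExt.snd_inl, TrivSqZeroExt.snd_inr, zero_add]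

theorem isUnit_dualHom (y : nonZeroDivisors V) : IsUnit (dualHom δ (y : V)) := by
  rw [TrivSqZeroExt.isUnit_iff_isUnit_fst, dualHom_fst]
  exact IsLocalization.map_units (FractionRing V) y

/-- The extension of `dualHom` to the field of fractions. -/
noncomputable def dualHomFrac :
    FractionRing V →+* TrivSqZeroExt (FractionRing V) (FractionRing V) :=
  IsLocalization.lift (M := nonZeroDivisors V) (isUnit_dualHom δ)

theorem dualHomFrac_algebraMap (a : V) :
    dualHomFrac δ (algebraMap V (FractionRing V) a) = dualHom δ a :=
  IsLocalization.lift_eq _ a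

theorem dualHomFrac_fst (x : FractionRing V) : (dualHomFrac δ x).fst = x := by
  have h : (TrivSqZeroExt.fstHom (FractionRing V) (FractionRing V)
      (FractionRing V)).toRingHom.comp (dualHomFrac δ) = RingHom.id _ := by
    refine IsLocalization.ringHom_ext (nonZeroDivisors V) ?_
    ext a
    simp [dualHomFrac_algebraMap, dualHom_fst]
  simpa using RingHom.congr_fun h x

/-- The unique extension of the derivation of `V` to its field of fractions. -/
noncomputable def fracDer : Derivation F (FractionRing V) (FractionRing V) where
  toFun x := (dualHomFrac δ x).snd
  map_add' x y := by simp
  map_smul' c x := by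
    have hc : algebraMap F (FractionRing V) c =
        algebraMap V (FractionRing V) (algebraMap F V c) :=
      IsScalarTower.algebraMap_apply F V (FractionRing V) c
    change (dualHomFrac δ (c • x)).snd = c • (dualHomFrac δ x).snd
    rw [Algebra.smul_def, Algebra.smul_def, map_mul, TrivSqZeroExt.snd_mul, dualHomFrac_fst,
      dualHomFrac_fst, hc, dualHomFrac_algebraMap, dualHom_snd, Derivation.map_algebraMap, map_zero,
      smul_eq_mul, smul_zero, add_zero]
  map_one_eq_zero' := by simp
  leibniz' x y := by
    change (dualHomFrac δ (x * y)).snd = x * (dualHomFrac δ y).snd + y * (dualHomFrac δ x).snd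
    rw [map_mul, TrivSqZeroExt.snd_mul, dualHomFrac_fst, dualHomFrac_fst, smul_eq_mul,
      op_smul_eq_mul, mul_comm y]

theorem fracDer_algebraMap (a : V) :
    fracDer δ (algebraMap V (FractionRing V) a) = algebraMap V (FractionRing V) (δ a) := by
  change (dualHomFrac δ _).snd = _
  rw [dualHomFrac_algebraMap, dualHom_snd]

/-- The view of a pseudodifferential operator over `V` as one over the field of fractions. -/
noncomputable def toFrac (A : LaurentSeries V) : LaurentSeries (FractionRing V) :=
  HahnSeries.map A (algebraMap V (FractionRing V))

/-- The skewfield of rational pseudodifferential operators: the smallest subset of the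
pseudodifferential operators over the field of fractions of `V` which contains the differential
operators with coefficients in `V` and is closed under sums, negatives, products and inverses. -/
inductive IsRationalOverFrac : LaurentSeries (FractionRing V) → Prop
  | diffOp (A : LaurentSeries V) (hA : ∀ n : ℤ, n < 0 → lcoeff A n = 0) :
      IsRationalOverFrac (toFrac A)
  | add {A B} : IsRationalOverFrac A → IsRationalOverFrac B → IsRationalOverFrac (A + B)
  | neg {A} : IsRationalOverFrac A → IsRationalOverFrac (-A)
  | mul {A B} : IsRationalOverFrac A → IsRationalOverFrac B →
      IsRationalOverFrac (shiftApply (fracDer δ) A B)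
  | inv {A B} : IsRationalOverFrac A → shiftApply (fracDer δ) A B = 1 →
      shiftApply (fracDer δ) B A = 1 → IsRationalOverFrac B

/-- A matrix pseudodifferential operator over `V` is rational with coefficients in `V` if all its
entries are rational pseudodifferential operators. -/
def IsRationalMatrix {ι : Type*} (H : Matrix ι ι (LaurentSeries V)) : Prop :=
  ∀ i j, IsRationalOverFrac δ (toFrac (H i j))

end Rational

/-! ### Algebras of differential functions and the Master Formula -/

/-- The structure of an algebra of differential functions in `u₁, …, u_ℓ` on a commutative
`F`-algebra `V`: a differential algebra extension of `F[uᵢ⁽ⁿ⁾]` with commuting derivations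
`∂/∂uᵢ⁽ⁿ⁾` extending the partial derivatives. -/
structure DiffFunAlgebra (F V : Type*) [Field F] [CommRing V] [Algebra F V] (ℓ : ℕ) where
  /-- The derivation `∂`. -/
  der : Derivation F V V
  /-- The elements `uᵢ⁽ⁿ⁾`. -/
  u : Fin ℓ → ℕ → V
  algebraicIndependent_u : AlgebraicIndependent F fun q : Fin ℓ × ℕ => u q.1 q.2
  der_u : ∀ i n, der (u i n) = u i (n + 1)
  /-- The derivations `∂/∂uᵢ⁽ⁿ⁾`. -/
  pd : Fin ℓ → ℕ → Derivation F V V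
  pd_u : ∀ i n j m, pd i n (u j m) = if i = j ∧ n = m then 1 else 0
  pd_comm : ∀ i m j n f, pd i m (pd j n f) = pd j n (pd i m f)
  pd_finite : ∀ f, {q : Fin ℓ × ℕ | pd q.1 q.2 f ≠ 0}.Finite
  pd_zero_der : ∀ i f, pd i 0 (der f) = der (pd i 0 f)
  pd_succ_der : ∀ i n f, pd i (n + 1) (der f) = der (pd i (n + 1) f) + pd i n f

section Master

variable {F V : Type*} [Field F] [CommRing V] [Algebra F V] {ℓ : ℕ} (S : DiffFunAlgebra F V ℓ)
  (H : Matrix (Fin ℓ) (Fin ℓ) (LaurentSeries V))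

/-- The summand `∂g/∂uⱼ⁽ⁿ⁾ (λ + ∂)ⁿ Hⱼᵢ(λ + ∂) (-λ - ∂)ᵐ ∂f/∂uᵢ⁽ᵐ⁾`, at the index
`((i, m), (j, n))`. -/
noncomputable def masterTerm (f g : V) (q : (Fin ℓ × ℕ) × (Fin ℓ × ℕ)) : LaurentSeries V :=
  S.pd q.2.1 q.2.2 g • shiftApply S.der (monom q.2.2 1)
    (shiftApply S.der (H q.2.1 q.1.1)
      (shiftApply S.der (monom q.1.2 ((-1) ^ q.1.2)) (monom 0 (S.pd q.1.1 q.1.2 f))))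

/-- The bracket `{f_λ g}_H` given by the Master Formula. -/
noncomputable def masterBracket (f g : V) : LaurentSeries V :=
  ∑ᶠ q : (Fin ℓ × ℕ) × (Fin ℓ × ℕ), masterTerm S H f g q

end Master

end NonlocalPVA

/-! Since `shiftApply` is the composition of symbols, everything takes place in the associative
algebra of pseudodifferential operators with its anti-involution *. The symbol of (w∂ᵐ)* is (-λ-∂)ᵐ
w, so the Master Formula says that {f_λ g} is the symbol of ∑ D_{g,j} ∘ H_{ji} ∘ (D_{f,i})*, where
D_{f,i} = ∑ₘ ∂f/∂uᵢ⁽ᵐ⁾ ∂ᵐ is the Fréchet derivative. The rules D_{∂f} = ∂ ∘ D_f and D_{fg} = f D_g +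
g D_f give (a). The rule (A ∘ B)* = B* ∘ A* (`adjHom_shiftApply`) shows that the adjoint of {f_λ g}
is {g_λ f} for the adjoint matrix; with {u_i λ u_j} = H_{ji} this gives (b).

The operator calculus is developed for an arbitrary additive endomorphism θ of an abelian group,
because it is used with θ = ∂, with θ = λ + ∂ and with θ = -ν. Two principles reduce it to Pascal's
rule: an additive map of bounded degree is determined by its values on monomials
(`hom_ext_of_monom`), and λ + θ is injective, so that families indexed by ℤ and transported by λ + θ
agree once they agree at 0 (`eq_of_shiftStep`).

For (c), let Xₙ(v) be the coefficient of λⁿ in {a_λ v}. The Xₙ are derivations with [Xₙ, ∂] = Xₙ₋₁,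
hence v ↦ v + ε ∑ Xₙ(v) λⁿ is a homomorphism of differential rings, from the fraction field to dual
numbers on whose infinitesimal part the derivation is λ + ∂. Applied to coefficients it respects
products of operators. Consider the operators A sent to A + ε x with x the expansion of a series in
λ, μ, ν. They contain the differential operators and are closed under products and inverses, since
on infinitesimal operators μ + (λ + ∂) acts as ν + ∂, whose negative powers exist in the third
variable (`shiftApply_epsSeries`). Hence they contain all rational operators, in particular {b_μ c}.

For (d), fix a and b. Both {a_λ {b_μ h}} and {b_μ {a_λ h}} split into products of first brackets,
which cancel in the difference by symmetry of second derivatives, and terms ∂h/∂u_k⁽ᵖ⁾ (ν + ∂)ᵖ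
applied to the same bracket with h = u_k. So the third argument of the Jacobi identity can be
reduced to generators (`jacobiAt_of_generators`). Skewsymmetry makes the identity invariant under
permutations of its arguments: exchanging a and b is the exchange of λ and μ, and exchanging b and c
is the substitution μ ↦ -ν-∂, ν ↦ -μ-∂ (`reflect`), which preserves ν - λ - μ. Each argument can
thus be moved to the third place. -/

namespace NonlocalPVA

/-! ### Operators on Laurent series with coefficients in an abelian group -/

section Series

variable {G G' : Type*} [AddCommGroup G] [AddCommGroup G']

@[simp] theorem lcoeff_zero (n : ℤ) : lcoeff (0 : LaurentSeries G) n = 0 := rfl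

@[simp] theorem lcoeff_add (A B : LaurentSeries G) (n : ℤ) :
    lcoeff (A + B) n = lcoeff A n + lcoeff B n := rfl

@[simp] theorem lcoeff_neg (A : LaurentSeries G) (n : ℤ) : lcoeff (-A) n = -lcoeff A n := rfl

@[simp] theorem lcoeff_sub (A B : LaurentSeries G) (n : ℤ) :
    lcoeff (A - B) n = lcoeff A n - lcoeff B n := by
  simp [lcoeff]

@[simp] theorem lcoeff_smul {R : Type*} [Monoid R] [DistribMulAction R G] (r : R)
    (A : LaurentSeries G) (n : ℤ) : lcoeff (r • A) n = r • lcoeff A n := rfl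

theorem lcoeff_monom (n : ℤ) (a : G) (k : ℤ) :
    lcoeff (monom n a) k = if k = n then a else 0 := by
  simp [lcoeff, monom, HahnSeries.coeff_single]

/-- The coefficient of `λ ^ n` as an additive map. -/
def lcoeffHom (n : ℤ) : LaurentSeries G →+ G where
  toFun A := lcoeff A n
  map_zero' := rfl
  map_add' _ _ := rfl

theorem lcoeff_sum {ι : Type*} (s : Finset ι) (A : ι → LaurentSeries G) (n : ℤ) :
    lcoeff (∑ i ∈ s, A i) n = ∑ i ∈ s, lcoeff (A i) n :=
  map_sum (lcoeffHom n) A s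

/-- The monomials `a λ ^ n` as an additive map in `a`. -/
noncomputable def monomHom (n : ℤ) : G →+ LaurentSeries G where
  toFun a := monom n a
  map_zero' := HahnSeries.single_eq_zero
  map_add' a b := HahnSeries.single_add _ a b

@[simp] theorem monomHom_apply (n : ℤ) (a : G) : monomHom n a = monom n a := rfl

/-- The powers of the indeterminate occurring in `A` are at most `N`. -/
def VanishAbove (N : ℤ) (A : LaurentSeries G) : Prop := ∀ n, N < n → lcoeff A n = 0

theorem exists_vanishAbove (A : LaurentSeries G) : ∃ N, VanishAbove N A :=
  exists_lcoeff_eq_zero A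

theorem VanishAbove.mono {N M : ℤ} {A : LaurentSeries G} (h : VanishAbove N A) (hNM : N ≤ M) :
    VanishAbove M A := fun n hn => h n (by omega)

theorem vanishAbove_monom (n : ℤ) (a : G) : VanishAbove n (monom n a) := fun k hk => by
  rw [lcoeff_monom, if_neg (by omega)]

/-- An additive map on Laurent series raising the degree by at most a fixed amount. -/
def BoundedDegree (Φ : LaurentSeries G →+ LaurentSeries G') : Prop :=
  ∃ c, ∀ A N, VanishAbove N A → VanishAbove (N + c) (Φ A)

theorem BoundedDegree.comp {G'' : Type*} [AddCommGroup G'']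
    {Ψ : LaurentSeries G' →+ LaurentSeries G''} {Φ : LaurentSeries G →+ LaurentSeries G'}
    (hΨ : BoundedDegree Ψ) (hΦ : BoundedDegree Φ) : BoundedDegree (Ψ.comp Φ) := by
  obtain ⟨c, hc⟩ := hΨ
  obtain ⟨d, hd⟩ := hΦ
  exact ⟨d + c, fun A N h => (hc _ _ (hd A N h)).mono (by omega)⟩

theorem BoundedDegree.id : BoundedDegree (AddMonoidHom.id (LaurentSeries G)) :=
  ⟨0, fun A N h => by simpa using h⟩

theorem exists_vanishAbove_sub_sum_monom (A : LaurentSeries G) (d : ℤ) :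
    ∃ s : Finset ℤ, VanishAbove d (A - ∑ n ∈ s, monom n (lcoeff A n)) := by
  obtain ⟨N, hN⟩ := exists_vanishAbove A
  refine ⟨Finset.Icc d N, fun k hk => ?_⟩
  rw [lcoeff_sub, lcoeff_sum]
  simp only [lcoeff_monom, Finset.sum_ite_eq, Finset.mem_Icc]
  split_ifs with h
  · exact sub_self _
  · rw [hN k (by omega), sub_zero]

/-- Additive maps of bounded degree which agree on monomials are equal. -/
theorem hom_ext_of_monom {Φ Ψ : LaurentSeries G →+ LaurentSeries G'} (hΦ : BoundedDegree Φ)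
    (hΨ : BoundedDegree Ψ) (h : ∀ n a, Φ (monom n a) = Ψ (monom n a)) : Φ = Ψ := by
  obtain ⟨c, hc⟩ := hΦ
  obtain ⟨d, hd⟩ := hΨ
  ext1 A
  refine ext_lcoeff fun k => ?_
  -- The degree of the remainder is so low that both maps send it strictly below degree `k`, so the
  -- coefficient at `k` only sees finitely many monomials.
  obtain ⟨s, hs⟩ := exists_vanishAbove_sub_sum_monom A (k - max c d - 1)
  have h1 := hc _ _ hs k (by omega)
  have h2 := hd _ _ hs k (by omega)
  rw [map_sub, map_sum, lcoeff_sub] at h1 h2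
  rw [sub_eq_zero.1 h1, sub_eq_zero.1 h2]
  simp only [h]

/-- Multiplication by `λ ^ n`. -/
noncomputable def lamMul (n : ℤ) : LaurentSeries G →+ LaurentSeries G where
  toFun A := ofCoeff (fun k => lcoeff A (k - n)) (by
    obtain ⟨N, hN⟩ := exists_vanishAbove A
    exact ⟨N + n, fun k hk => hN _ (by omega)⟩)
  map_zero' := ext_lcoeff fun k => by simp
  map_add' A B := ext_lcoeff fun k => by simp

@[simp] theorem lcoeff_lamMul (n : ℤ) (A : LaurentSeries G) (k : ℤ) :
    lcoeff (lamMul n A) k = lcoeff A (k - n) := by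
  simp only [lamMul, AddMonoidHom.coe_mk, ZeroHom.coe_mk, lcoeff_ofCoeff]

theorem lamMul_lamMul (m n : ℤ) (A : LaurentSeries G) :
    lamMul m (lamMul n A) = lamMul (m + n) A :=
  ext_lcoeff fun k => by
    simp only [lcoeff_lamMul]
    congr 1
    ring

@[simp] theorem lamMul_zero (A : LaurentSeries G) : lamMul 0 A = A :=
  ext_lcoeff fun k => by simp

theorem lamMul_monom (m n : ℤ) (a : G) : lamMul m (monom n a) = monom (m + n) a :=
  ext_lcoeff fun k => by
    rw [lcoeff_lamMul, lcoeff_monom, lcoeff_monom]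
    exact if_congr (by omega) rfl rfl

theorem boundedDegree_lamMul (n : ℤ) : BoundedDegree (lamMul (G := G) n) :=
  ⟨n, fun A N h k hk => by rw [lcoeff_lamMul, h _ (by omega)]⟩

/-- An additive map applied to the coefficients. -/
noncomputable def mapCoeff (φ : G →+ G') : LaurentSeries G →+ LaurentSeries G' where
  toFun A := HahnSeries.map A φ
  map_zero' := ext_lcoeff fun _ => map_zero φ
  map_add' _ _ := ext_lcoeff fun _ => map_add φ _ _

@[simp] theorem lcoeff_mapCoeff (φ : G →+ G') (A : LaurentSeries G) (k : ℤ) :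
    lcoeff (mapCoeff φ A) k = φ (lcoeff A k) := rfl

theorem mapCoeff_monom (φ : G →+ G') (n : ℤ) (a : G) :
    mapCoeff φ (monom n a) = monom n (φ a) :=
  ext_lcoeff fun k => by
    rw [lcoeff_mapCoeff, lcoeff_monom, lcoeff_monom]
    split_ifs <;> simp

theorem mapCoeff_lamMul (φ : G →+ G') (n : ℤ) (A : LaurentSeries G) :
    mapCoeff φ (lamMul n A) = lamMul n (mapCoeff φ A) :=
  ext_lcoeff fun k => by simp

theorem boundedDegree_mapCoeff (φ : G →+ G') : BoundedDegree (mapCoeff φ) :=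
  ⟨0, fun A N h k hk => by rw [lcoeff_mapCoeff, h _ (by omega), map_zero]⟩

/-- The operator `λ + θ`. -/
noncomputable def shiftStep (θ : G →+ G) : LaurentSeries G →+ LaurentSeries G :=
  lamMul 1 + mapCoeff θ

theorem shiftStep_apply (θ : G →+ G) (A : LaurentSeries G) :
    shiftStep θ A = lamMul 1 A + mapCoeff θ A := rfl

@[simp] theorem lcoeff_shiftStep (θ : G →+ G) (A : LaurentSeries G) (k : ℤ) :
    lcoeff (shiftStep θ A) k = lcoeff A (k - 1) + θ (lcoeff A k) := by
  simp [shiftStep]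

/-- If (λ + θ)A = 0 then each coefficient is -θ of the next higher one, and the coefficients vanish
for large exponents. This injectivity is what allows inductions to descend to negative powers of λ +
θ. -/
theorem shiftStep_injective (θ : G →+ G) : Function.Injective (shiftStep θ) := by
  rw [injective_iff_map_eq_zero]
  intro A hA
  obtain ⟨N, hN⟩ := exists_vanishAbove A
  have h : ∀ n : ℕ, ∀ k, N - n < k → lcoeff A k = 0 := by
    intro n
    induction n with
    | zero => exact fun k hk => hN k (by simpa using hk)
    | succ n ih =>
      intro k hk
      have h1 := congrArg (fun B => lcoeff B (k + 1)) hA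
      simpa [ih (k + 1) (by push_cast at hk; omega)] using h1
  exact ext_lcoeff fun k => h (N - k + 1).toNat k (by omega)

theorem shiftStep_lamMul (θ : G →+ G) (n : ℤ) (A : LaurentSeries G) :
    shiftStep θ (lamMul n A) = lamMul n (shiftStep θ A) := by
  simp only [shiftStep_apply, map_add, mapCoeff_lamMul, lamMul_lamMul, add_comm]

theorem boundedDegree_shiftStep (θ : G →+ G) : BoundedDegree (shiftStep θ) :=
  ⟨1, fun A N h k hk => by
    rw [lcoeff_shiftStep, h _ (by omega), h _ (by omega), map_zero, add_zero]⟩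

/-- The finite sums occurring in `(λ + θ) ^ q A(λ)`. -/
theorem finsum_shiftPow_eq (θ : G →+ G) {A : LaurentSeries G} {N : ℤ} (hA : VanishAbove N A)
    (b : ℕ → ℤ) (c : ℤ) {K : ℕ} (hK : N < c + K) :
    ∑ᶠ j : ℕ, b j • (θ : G → G)^[j] (lcoeff A (c + j)) =
      ∑ j ∈ Finset.range K, b j • (θ : G → G)^[j] (lcoeff A (c + j)) := by
  refine finsum_eq_sum_of_support_subset _ fun j hj => ?_
  by_contra h
  simp only [Finset.coe_range, Set.mem_Iio, not_lt] at h
  exact hj (by simp [hA (c + j) (by omega), iterate_map_zero])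

/-- The operator `(λ + θ) ^ q = ∑ⱼ binom(q, j) λ ^ (q - j) θ ^ j`. -/
noncomputable def shiftPow (θ : G →+ G) (q : ℤ) : LaurentSeries G →+ LaurentSeries G :=
  AddMonoidHom.mk' (fun A => ofCoeff
    (fun k => ∑ᶠ j : ℕ, (Ring.choose q j : ℤ) • (θ : G → G)^[j] (lcoeff A (k - q + j))) (by
      obtain ⟨N, hN⟩ := exists_vanishAbove A
      refine ⟨N + q, fun k hk => finsum_eq_zero_of_forall_eq_zero fun j => ?_⟩
      rw [hN _ (by omega), iterate_map_zero, smul_zero])) (by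
    intro A B
    obtain ⟨M, hM⟩ := exists_vanishAbove A
    obtain ⟨N, hN⟩ := exists_vanishAbove B
    have hAB : VanishAbove (max M N) (A + B) := fun k hk => by
      simp [hM k (by omega), hN k (by omega)]
    refine ext_lcoeff fun k => ?_
    have hK : max M N < (k - q) + (max M N - (k - q) + 1).toNat := by omega
    simp only [lcoeff_add, lcoeff_ofCoeff]
    rw [finsum_shiftPow_eq θ (hM.mono (le_max_left _ _)) _ _ hK,
      finsum_shiftPow_eq θ (hN.mono (le_max_right _ _)) _ _ hK, ← Finset.sum_add_distrib]
    refine (finsum_shiftPow_eq θ hAB _ _ hK).trans (Finset.sum_congr rfl fun j _ => ?_)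
    rw [lcoeff_add, iterate_map_add, smul_add])

theorem lcoeff_shiftPow (θ : G →+ G) (q : ℤ) (A : LaurentSeries G) (k : ℤ) :
    lcoeff (shiftPow θ q A) k =
      ∑ᶠ j : ℕ, (Ring.choose q j : ℤ) • (θ : G → G)^[j] (lcoeff A (k - q + j)) := by
  simp only [shiftPow, AddMonoidHom.mk'_apply, lcoeff_ofCoeff]

theorem lcoeff_shiftPow_eq_sum (θ : G →+ G) (q : ℤ) {A : LaurentSeries G} {N : ℤ}
    (hA : VanishAbove N A) (k : ℤ) {K : ℕ} (hK : N < k - q + K) :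
    lcoeff (shiftPow θ q A) k = ∑ j ∈ Finset.range K,
      (Ring.choose q j : ℤ) • (θ : G → G)^[j] (lcoeff A (k - q + j)) := by
  rw [lcoeff_shiftPow, finsum_shiftPow_eq θ hA _ _ hK]

theorem vanishAbove_shiftPow (θ : G →+ G) (q : ℤ) {A : LaurentSeries G} {N : ℤ}
    (hA : VanishAbove N A) : VanishAbove (N + q) (shiftPow θ q A) := fun k hk => by
  rw [lcoeff_shiftPow_eq_sum θ q hA k (K := 0) (by push_cast; omega), Finset.sum_range_zero]

theorem boundedDegree_shiftPow (θ : G →+ G) (q : ℤ) : BoundedDegree (shiftPow θ q) :=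
  ⟨q, fun _ _ h => vanishAbove_shiftPow θ q h⟩

@[simp] theorem shiftPow_zero (θ : G →+ G) (A : LaurentSeries G) : shiftPow θ 0 A = A :=
  ext_lcoeff fun k => by
    rw [lcoeff_shiftPow, finsum_eq_single _ 0 fun j hj => by
      rw [Ring.choose_zero_pos ℤ (Nat.pos_of_ne_zero hj), zero_smul]]
    simp

/-- This is Pascal's rule. Together with the value at exponent 0 it characterizes all powers, so the
explicit binomial sum is not needed afterwards. -/
theorem shiftPow_add_one (θ : G →+ G) (q : ℤ) (A : LaurentSeries G) :
    shiftPow θ (q + 1) A = shiftStep θ (shiftPow θ q A) := by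
  obtain ⟨N, hN⟩ := exists_vanishAbove A
  refine ext_lcoeff fun k => ?_
  obtain ⟨K, hK⟩ : ∃ K : ℕ, N < k - 1 - q + K := ⟨(N - (k - 1 - q) + 1).toNat, by omega⟩
  rw [lcoeff_shiftStep, lcoeff_shiftPow_eq_sum θ (q + 1) hN k (K := K + 1) (by push_cast; omega),
    lcoeff_shiftPow_eq_sum θ q hN (k - 1) (K := K + 1) (by push_cast; omega),
    lcoeff_shiftPow_eq_sum θ q hN k (K := K) (by omega), map_sum,
    Finset.sum_range_succ', Finset.sum_range_succ' _ K, add_right_comm, ← Finset.sum_add_distrib]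
  congr 1
  · refine Finset.sum_congr rfl fun j _ => ?_
    have e1 : k - (q + 1) + ((j + 1 : ℕ) : ℤ) = k - q + j := by push_cast; ring
    have e2 : k - 1 - q + ((j + 1 : ℕ) : ℤ) = k - q + j := by push_cast; ring
    rw [e1, e2, Ring.choose_succ_succ, add_smul, map_zsmul, Function.iterate_succ_apply', add_comm]
  · simp only [Ring.choose_zero_right, Nat.cast_zero]
    congr 3
    ring

/-- Two families of series which are transported by `λ + θ` agree if they agree once. -/
theorem eq_of_shiftStep (θ : G →+ G) {f g : ℤ → LaurentSeries G}
    (hf : ∀ q, f (q + 1) = shiftStep θ (f q)) (hg : ∀ q, g (q + 1) = shiftStep θ (g q))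
    (h0 : f 0 = g 0) (q : ℤ) : f q = g q := by
  induction q using Int.induction_on with
  | zero => exact h0
  | succ n ih => rw [hf, hg, ih]
  | pred n ih =>
    -- No inverse of λ + θ is at hand as an operator; the downward step cancels it instead.
    apply shiftStep_injective θ
    rw [← hf, ← hg, sub_add_cancel, ih]

theorem shiftPow_lamMul (θ : G →+ G) (q n : ℤ) (A : LaurentSeries G) :
    shiftPow θ q (lamMul n A) = lamMul n (shiftPow θ q A) :=
  eq_of_shiftStep θ (f := fun q => shiftPow θ q (lamMul n A))
    (g := fun q => lamMul n (shiftPow θ q A))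
    (fun q => shiftPow_add_one θ q _)
    (fun q => by rw [shiftPow_add_one, shiftStep_lamMul]) (by simp) q

theorem mapCoeff_shiftStep {θ : G →+ G} {θ' : G' →+ G'} {φ : G →+ G'}
    (h : ∀ x, φ (θ x) = θ' (φ x)) (A : LaurentSeries G) :
    mapCoeff φ (shiftStep θ A) = shiftStep θ' (mapCoeff φ A) :=
  ext_lcoeff fun k => by simp [h]

theorem mapCoeff_shiftPow {θ : G →+ G} {θ' : G' →+ G'} {φ : G →+ G'}
    (h : ∀ x, φ (θ x) = θ' (φ x)) (q : ℤ) (A : LaurentSeries G) :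
    mapCoeff φ (shiftPow θ q A) = shiftPow θ' q (mapCoeff φ A) :=
  eq_of_shiftStep θ' (f := fun q => mapCoeff φ (shiftPow θ q A))
    (g := fun q => shiftPow θ' q (mapCoeff φ A))
    (fun q => by rw [shiftPow_add_one, mapCoeff_shiftStep h])
    (fun q => shiftPow_add_one θ' q _) (by simp) q

/-- The operator `∑ aₙ λ ^ n ↦ ∑ (-λ - θ) ^ n aₙ`. -/
noncomputable def adjHom (θ : G →+ G) : LaurentSeries G →+ LaurentSeries G :=
  AddMonoidHom.mk' (fun A => ofCoeff
    (fun m => ∑ᶠ k : ℕ, ((Ring.choose (m + k) k : ℤ) * ((m + k).negOnePow : ℤ)) •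
      (θ : G → G)^[k] (lcoeff A (m + k))) (by
      obtain ⟨N, hN⟩ := exists_vanishAbove A
      refine ⟨N, fun m hm => finsum_eq_zero_of_forall_eq_zero fun k => ?_⟩
      rw [hN _ (by omega), iterate_map_zero, smul_zero])) (by
    intro A B
    obtain ⟨M, hM⟩ := exists_vanishAbove A
    obtain ⟨N, hN⟩ := exists_vanishAbove B
    have hAB : VanishAbove (max M N) (A + B) := fun k hk => by
      simp [hM k (by omega), hN k (by omega)]
    refine ext_lcoeff fun m => ?_
    have hK : max M N < m + (max M N - m + 1).toNat := by omega
    simp only [lcoeff_add, lcoeff_ofCoeff]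
    rw [finsum_shiftPow_eq θ (hM.mono (le_max_left _ _)) _ _ hK,
      finsum_shiftPow_eq θ (hN.mono (le_max_right _ _)) _ _ hK, ← Finset.sum_add_distrib]
    refine (finsum_shiftPow_eq θ hAB _ _ hK).trans (Finset.sum_congr rfl fun j _ => ?_)
    rw [lcoeff_add, iterate_map_add, smul_add])

theorem lcoeff_adjHom (θ : G →+ G) (A : LaurentSeries G) (m : ℤ) :
    lcoeff (adjHom θ A) m = ∑ᶠ k : ℕ, ((Ring.choose (m + k) k : ℤ) * ((m + k).negOnePow : ℤ)) •
      (θ : G → G)^[k] (lcoeff A (m + k)) := by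
  simp only [adjHom, AddMonoidHom.mk'_apply, lcoeff_ofCoeff]

theorem lcoeff_adjHom_eq_sum (θ : G →+ G) {A : LaurentSeries G} {N : ℤ}
    (hA : VanishAbove N A) (m : ℤ) {K : ℕ} (hK : N < m + K) :
    lcoeff (adjHom θ A) m = ∑ k ∈ Finset.range K,
      ((Ring.choose (m + k) k : ℤ) * ((m + k).negOnePow : ℤ)) •
        (θ : G → G)^[k] (lcoeff A (m + k)) := by
  rw [lcoeff_adjHom, finsum_shiftPow_eq θ hA _ _ hK]

theorem vanishAbove_adjHom (θ : G →+ G) {A : LaurentSeries G} {N : ℤ}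
    (hA : VanishAbove N A) : VanishAbove N (adjHom θ A) := fun k hk => by
  rw [lcoeff_adjHom_eq_sum θ hA k (K := 0) (by push_cast; omega), Finset.sum_range_zero]

theorem boundedDegree_adjHom (θ : G →+ G) : BoundedDegree (adjHom θ) :=
  ⟨0, fun _ _ h => (vanishAbove_adjHom θ h).mono (by omega)⟩

/-- A factor λ in the argument becomes a factor -λ - θ on the left of each (-λ - θ)ⁿ; on
coefficients this is again Pascal's rule, now with signs. -/
theorem adjHom_lamMul_one (θ : G →+ G) (A : LaurentSeries G) :
    adjHom θ (lamMul 1 A) = -shiftStep θ (adjHom θ A) := by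
  obtain ⟨N, hN⟩ := exists_vanishAbove A
  have hN' : VanishAbove (N + 1) (lamMul 1 A) := fun k hk => by
    simp [hN (k - 1) (by omega)]
  refine ext_lcoeff fun m => ?_
  obtain ⟨K, hK⟩ : ∃ K : ℕ, N < m - 1 + K := ⟨(N - (m - 1) + 1).toNat, by omega⟩
  rw [lcoeff_neg, lcoeff_shiftStep,
    lcoeff_adjHom_eq_sum θ hN' m (K := K + 1) (by push_cast; omega),
    lcoeff_adjHom_eq_sum θ hN (m - 1) (K := K + 1) (by push_cast; omega),
    lcoeff_adjHom_eq_sum θ hN m (K := K) (by omega), map_sum,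
    Finset.sum_range_succ', Finset.sum_range_succ' _ K, add_right_comm, ← Finset.sum_add_distrib,
    neg_add, ← Finset.sum_neg_distrib]
  congr 1
  · refine Finset.sum_congr rfl fun j _ => ?_
    have e1 : m + ((j + 1 : ℕ) : ℤ) = (m + j) + 1 := by push_cast; ring
    have e2 : m - 1 + ((j + 1 : ℕ) : ℤ) = m + j := by push_cast; ring
    rw [lcoeff_lamMul, e1, e2, add_sub_cancel_right, Ring.choose_succ_succ, Int.negOnePow_succ,
      map_zsmul, Function.iterate_succ_apply', Units.val_neg]
    module
  · have e1 : m + ((0 : ℕ) : ℤ) = (m - 1) + 1 := by push_cast; ring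
    have e2 : m - 1 + ((0 : ℕ) : ℤ) = m - 1 := by push_cast; ring
    rw [lcoeff_lamMul, e1, e2, add_sub_cancel_right, Int.negOnePow_succ, Units.val_neg]
    simp only [Ring.choose_zero_right, Function.iterate_zero_apply]
    module

/-- Naturality in the pair of group and endomorphism. Taking φ to be {a_λ ·} or {·_λ c}, which turn
∂ into λ + ∂ or into -λ, transports a skewsymmetry inside a nested bracket to a substitution of
variables in the result. -/
theorem mapCoeff_adjHom {θ : G →+ G} {θ' : G' →+ G'} {φ : G →+ G'}
    (h : ∀ x, φ (θ x) = θ' (φ x)) (A : LaurentSeries G) :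
    mapCoeff φ (adjHom θ A) = adjHom θ' (mapCoeff φ A) := by
  have h' : ∀ (k : ℕ) x, φ ((θ : G → G)^[k] x) = (θ' : G' → G')^[k] (φ x) := fun k x =>
    (Function.Semiconj.iterate_right (f := φ) (ga := θ) (gb := θ') h k).eq x
  obtain ⟨N, hN⟩ := exists_vanishAbove A
  have hN' : VanishAbove N (mapCoeff φ A) := fun k hk => by simp [hN k hk]
  refine ext_lcoeff fun m => ?_
  have hK : N < m + (N - m + 1).toNat := by omega
  rw [lcoeff_mapCoeff, lcoeff_adjHom_eq_sum θ hN m hK, lcoeff_adjHom_eq_sum θ' hN' m hK, map_sum]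
  exact Finset.sum_congr rfl fun k _ => by rw [map_zsmul, h', lcoeff_mapCoeff]

theorem adjHom_monom_zero (θ : G →+ G) (a : G) : adjHom θ (monom 0 a) = monom 0 a := by
  refine ext_lcoeff fun m => ?_
  have hK : (0 : ℤ) < m + ((-m).toNat + 1 : ℕ) := by omega
  rw [lcoeff_adjHom_eq_sum θ (vanishAbove_monom 0 a) m hK]
  rcases le_or_gt m 0 with hm | hm
  -- Only `k = -m` meets the monomial, and there the binomial coefficient is binom(0, -m), which is
  -- zero unless `m = 0`.
  · rw [Finset.sum_eq_single (-m).toNat]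
    · have e : m + ((-m).toNat : ℤ) = 0 := by omega
      rw [e, lcoeff_monom, lcoeff_monom, if_pos rfl]
      rcases hm.lt_or_eq with hm' | rfl
      · rw [Ring.choose_zero_pos ℤ (by omega : 0 < (-m).toNat), if_neg (by omega)]
        simp
      · simp
    · intro k _ hk
      rw [lcoeff_monom, if_neg (by omega), iterate_map_zero, smul_zero]
    · simp
  · rw [lcoeff_monom, if_neg (by omega)]
    refine Finset.sum_eq_zero fun k _ => ?_
    rw [lcoeff_monom, if_neg (by omega), iterate_map_zero, smul_zero]

theorem adjHom_lamMul (θ : G →+ G) (n : ℤ) (A : LaurentSeries G) :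
    adjHom θ (lamMul n A) = (n.negOnePow : ℤ) • shiftPow θ n (adjHom θ A) := by
  -- The sign is moved to the left-hand side so that both families satisfy the same recursion under
  -- λ + θ.
  have h := eq_of_shiftStep θ (f := fun n : ℤ => (n.negOnePow : ℤ) • adjHom θ (lamMul n A))
    (g := fun n => shiftPow θ n (adjHom θ A))
    (fun n => by
      rw [add_comm n 1, ← lamMul_lamMul, adjHom_lamMul_one, add_comm 1 n, Int.negOnePow_succ,
        map_zsmul, Units.val_neg, neg_smul_neg])
    (fun n => shiftPow_add_one θ n _) (by simp) n
  rw [← h, smul_smul, ← Units.val_mul, Int.units_mul_self, Units.val_one, one_smul]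

theorem adjHom_monom (θ : G →+ G) (n : ℤ) (a : G) :
    adjHom θ (monom n a) = (n.negOnePow : ℤ) • shiftPow θ n (monom 0 a) := by
  rw [← adjHom_monom_zero θ a, ← adjHom_lamMul, lamMul_monom, add_zero]

theorem adjHom_shiftStep (θ : G →+ G) (A : LaurentSeries G) :
    adjHom θ (shiftStep θ A) = -lamMul 1 (adjHom θ A) := by
  rw [shiftStep_apply, map_add, adjHom_lamMul_one, ← mapCoeff_adjHom fun _ => rfl, shiftStep_apply]
  abel

theorem adjHom_shiftPow (θ : G →+ G) (q : ℤ) (A : LaurentSeries G) :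
    adjHom θ (shiftPow θ q A) = (q.negOnePow : ℤ) • lamMul q (adjHom θ A) := by
  -- After division by (-λ)^q the expression does not depend on `q`, so its value can be read off at
  -- `q = 0`, for positive and negative exponents alike.
  have key : ∀ q : ℤ, lamMul (-q) ((q.negOnePow : ℤ) • adjHom θ (shiftPow θ q A)) =
      lamMul (-(q + 1)) (((q + 1).negOnePow : ℤ) • adjHom θ (shiftPow θ (q + 1) A)) := fun q => by
    rw [shiftPow_add_one, adjHom_shiftStep, Int.negOnePow_succ, Units.val_neg, neg_smul_neg,
      ← map_zsmul (lamMul (G := G) 1), lamMul_lamMul, neg_add, neg_add_cancel_right]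
  have h : lamMul (-q) ((q.negOnePow : ℤ) • adjHom θ (shiftPow θ q A)) = adjHom θ A := by
    induction q using Int.induction_on with
    | zero => simp
    | succ n ih => rw [← key, ih]
    | pred n ih => rw [key, sub_add_cancel, ih]
  rw [← h, lamMul_lamMul, add_neg_cancel, lamMul_zero, smul_smul, ← Units.val_mul,
    Int.units_mul_self, Units.val_one, one_smul]

/-- On a monomial the first adjoint produces (-1)ⁿ (λ + θ)ⁿ a, and the second one turns the power of
λ + θ back into one of λ with the same sign. -/
theorem adjHom_adjHom (θ : G →+ G) (A : LaurentSeries G) : adjHom θ (adjHom θ A) = A := by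
  have h : (adjHom θ).comp (adjHom θ) = AddMonoidHom.id _ :=
    hom_ext_of_monom ((boundedDegree_adjHom θ).comp (boundedDegree_adjHom θ)) BoundedDegree.id
      fun n a => by
        rw [AddMonoidHom.comp_apply, adjHom_monom, map_zsmul, adjHom_shiftPow, adjHom_monom_zero,
          lamMul_monom, add_zero, smul_smul, ← Units.val_mul, Int.units_mul_self, Units.val_one,
          one_smul, AddMonoidHom.id_apply]
  exact DFunLike.congr_fun h A

end Series

/-! ### The algebra of pseudodifferential operators -/

section Operators

variable {F V : Type*} [CommRing F] [CommRing V] [Algebra F V] (δ : Derivation F V V)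

/-- A derivation as an additive map. -/
def derHom : V →+ V := δ.toLinearMap.toAddMonoidHom

@[simp] theorem derHom_apply (v : V) : derHom δ v = δ v := rfl

theorem adjoint_eq_adjHom (A : LaurentSeries V) : adjoint δ A = adjHom (derHom δ) A := rfl

theorem coeffDer_eq_mapCoeff (A : LaurentSeries V) : coeffDer δ A = mapCoeff (derHom δ) A := rfl

theorem monom_one_mul (n : ℤ) (A : LaurentSeries V) : monom n 1 * A = lamMul n A :=
  ext_lcoeff fun k => by
    have h := HahnSeries.coeff_single_mul_add (r := (1 : V)) (x := A) (a := -(k - n)) (b := -n)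
    rw [one_mul, show -(k - n) + -n = -k by ring] at h
    rw [lcoeff_lamMul]
    exact h

theorem shiftStep_smul (v : V) (A : LaurentSeries V) :
    shiftStep (derHom δ) (v • A) = δ v • A + v • shiftStep (derHom δ) A :=
  ext_lcoeff fun k => by
    simp only [lcoeff_shiftStep, lcoeff_smul, lcoeff_add, smul_eq_mul, derHom_apply,
      Derivation.leibniz]
    ring

/-- The double sum is regrouped as ∑ aₘ (λ + ∂)ᵐ B. The set of exponents may be enlarged freely, so
that several products can be compared over a common finite set. -/
theorem lcoeff_shiftApply {A B : LaurentSeries V} {M N : ℤ} (hA : VanishAbove M A)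
    (hB : VanishAbove N B) (k : ℤ) {s : Finset ℤ} (hs : Finset.Icc (k - N) M ⊆ s) :
    lcoeff (shiftApply δ A B) k =
      ∑ m ∈ s, lcoeff A m • lcoeff (shiftPow (derHom δ) m B) k := by
  have h1 : lcoeff (shiftApply δ A B) k = ∑ᶠ q : ℤ × ℕ, shiftTerm δ A B k q := by
    change lcoeff (ofCoeff _ _) k = _
    rw [lcoeff_ofCoeff]
  have h2 : ∀ m, ∑ᶠ j : ℕ, shiftTerm δ A B k (m, j) =
      lcoeff A m • lcoeff (shiftPow (derHom δ) m B) k := fun m => by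
    have hK : N < k - m + (N - (k - m) + 1).toNat := by omega
    rw [lcoeff_shiftPow_eq_sum _ m hB k hK, Finset.smul_sum]
    refine (finsum_eq_sum_of_support_subset _ fun j hj => ?_).trans
      (Finset.sum_congr rfl fun j _ => ?_)
    · by_contra h
      simp only [Finset.coe_range, Set.mem_Iio, not_lt] at h
      exact hj (by simp [shiftTerm, hB (k - m + j) (by omega)])
    · simp only [shiftTerm, smul_eq_mul, mul_smul_comm]
      rfl
  rw [h1, finsum_curry _ (shiftTerm_support_finite δ A B k), finsum_congr h2]
  refine finsum_eq_sum_of_support_subset _ fun m hm => hs ?_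
  rw [Finset.mem_Icc]
  by_contra h
  rcases not_and_or.1 h with h | h
  · exact hm (by simp only; rw [vanishAbove_shiftPow _ m hB k (by omega), smul_zero])
  · exact hm (by simp only; rw [hA m (by omega), zero_smul])

theorem vanishAbove_shiftApply {A B : LaurentSeries V} {M N : ℤ} (hA : VanishAbove M A)
    (hB : VanishAbove N B) : VanishAbove (M + N) (shiftApply δ A B) := fun k hk => by
  rw [lcoeff_shiftApply δ hA hB k (s := ∅), Finset.sum_empty]
  rw [Finset.Icc_eq_empty (by omega)]

/-- The product `A(λ + ∂) B(λ)` as an additive map in `A`. -/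
noncomputable def applyHom (B : LaurentSeries V) : LaurentSeries V →+ LaurentSeries V :=
  AddMonoidHom.mk' (fun A => shiftApply δ A B) (by
    intro A A'
    obtain ⟨M, hM⟩ := exists_vanishAbove A
    obtain ⟨M', hM'⟩ := exists_vanishAbove A'
    obtain ⟨N, hN⟩ := exists_vanishAbove B
    have h : VanishAbove (max M M') (A + A') := fun k hk => by
      simp [hM k (by omega), hM' k (by omega)]
    refine ext_lcoeff fun k => ?_
    have hs := subset_refl (Finset.Icc (k - N) (max M M'))
    rw [lcoeff_add, lcoeff_shiftApply δ h hN k hs,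
      lcoeff_shiftApply δ (hM.mono (le_max_left _ _)) hN k hs,
      lcoeff_shiftApply δ (hM'.mono (le_max_right _ _)) hN k hs, ← Finset.sum_add_distrib]
    exact Finset.sum_congr rfl fun m _ => by rw [lcoeff_add, add_smul])

/-- The product `A(λ + ∂) B(λ)` as an additive map in `B`. -/
noncomputable def applyHom' (A : LaurentSeries V) : LaurentSeries V →+ LaurentSeries V :=
  AddMonoidHom.mk' (fun B => shiftApply δ A B) (by
    intro B B'
    obtain ⟨M, hM⟩ := exists_vanishAbove A
    obtain ⟨N, hN⟩ := exists_vanishAbove B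
    obtain ⟨N', hN'⟩ := exists_vanishAbove B'
    have h : VanishAbove (max N N') (B + B') := fun k hk => by
      simp [hN k (by omega), hN' k (by omega)]
    refine ext_lcoeff fun k => ?_
    have hs := subset_refl (Finset.Icc (k - max N N') M)
    rw [lcoeff_add, lcoeff_shiftApply δ hM h k hs,
      lcoeff_shiftApply δ hM (hN.mono (le_max_left _ _)) k hs,
      lcoeff_shiftApply δ hM (hN'.mono (le_max_right _ _)) k hs, ← Finset.sum_add_distrib]
    exact Finset.sum_congr rfl fun m _ => by rw [map_add, lcoeff_add, smul_add])

@[simp] theorem applyHom_apply (A B : LaurentSeries V) : applyHom δ B A = shiftApply δ A B := rfl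

@[simp] theorem applyHom'_apply (A B : LaurentSeries V) :
    applyHom' δ A B = shiftApply δ A B := rfl

theorem boundedDegree_applyHom (B : LaurentSeries V) : BoundedDegree (applyHom δ B) := by
  obtain ⟨N, hN⟩ := exists_vanishAbove B
  exact ⟨N, fun A M hM => vanishAbove_shiftApply δ hM hN⟩

theorem boundedDegree_applyHom' (A : LaurentSeries V) : BoundedDegree (applyHom' δ A) := by
  obtain ⟨M, hM⟩ := exists_vanishAbove A
  exact ⟨M, fun B N hN => (vanishAbove_shiftApply δ hM hN).mono (by omega)⟩

theorem shiftApply_add_left (A A' B : LaurentSeries V) :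
    shiftApply δ (A + A') B = shiftApply δ A B + shiftApply δ A' B := map_add (applyHom δ B) A A'

theorem shiftApply_add_right (A B B' : LaurentSeries V) :
    shiftApply δ A (B + B') = shiftApply δ A B + shiftApply δ A B' := map_add (applyHom' δ A) B B'

theorem shiftApply_sum_left {ι : Type*} (s : Finset ι) (A : ι → LaurentSeries V)
    (B : LaurentSeries V) :
    shiftApply δ (∑ i ∈ s, A i) B = ∑ i ∈ s, shiftApply δ (A i) B := map_sum (applyHom δ B) A s

theorem shiftApply_neg_left (A B : LaurentSeries V) :
    shiftApply δ (-A) B = -shiftApply δ A B := map_neg (applyHom δ B) A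

theorem shiftApply_neg_right (A B : LaurentSeries V) :
    shiftApply δ A (-B) = -shiftApply δ A B := map_neg (applyHom' δ A) B

theorem shiftApply_zsmul_left (n : ℤ) (A B : LaurentSeries V) :
    shiftApply δ (n • A) B = n • shiftApply δ A B := map_zsmul (applyHom δ B) n A

theorem shiftApply_zsmul_right (n : ℤ) (A B : LaurentSeries V) :
    shiftApply δ A (n • B) = n • shiftApply δ A B := map_zsmul (applyHom' δ A) n B

theorem shiftApply_zero_left (B : LaurentSeries V) : shiftApply δ 0 B = 0 :=
  map_zero (applyHom δ B)

theorem shiftApply_zero_right (A : LaurentSeries V) : shiftApply δ A 0 = 0 :=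
  map_zero (applyHom' δ A)

theorem shiftApply_monom (n : ℤ) (v : V) (B : LaurentSeries V) :
    shiftApply δ (monom n v) B = v • shiftPow (derHom δ) n B := by
  obtain ⟨N, hN⟩ := exists_vanishAbove B
  refine ext_lcoeff fun k => ?_
  rw [lcoeff_shiftApply δ (vanishAbove_monom n v) hN k (s := insert n (Finset.Icc (k - N) n))
    (Finset.subset_insert _ _), Finset.sum_eq_single n]
  · rw [lcoeff_monom, if_pos rfl, lcoeff_smul]
  · intro m _ hm
    rw [lcoeff_monom, if_neg hm, zero_smul]
  · exact fun h => absurd (Finset.mem_insert_self _ _) h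

theorem shiftApply_smul_left (v : V) (A B : LaurentSeries V) :
    shiftApply δ (v • A) B = v • shiftApply δ A B := by
  obtain ⟨M, hM⟩ := exists_vanishAbove A
  obtain ⟨N, hN⟩ := exists_vanishAbove B
  have h : VanishAbove M (v • A) := fun k hk => by rw [lcoeff_smul, hM k hk, smul_zero]
  refine ext_lcoeff fun k => ?_
  rw [lcoeff_smul, lcoeff_shiftApply δ h hN k subset_rfl,
    lcoeff_shiftApply δ hM hN k subset_rfl, Finset.smul_sum]
  exact Finset.sum_congr rfl fun m _ => by rw [lcoeff_smul, smul_assoc]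

theorem smul_monom (v w : V) (n : ℤ) : v • monom n w = monom n (v * w) :=
  ext_lcoeff fun k => by
    rw [lcoeff_smul, lcoeff_monom, lcoeff_monom]
    split_ifs <;> simp

theorem shiftApply_lamMul (n : ℤ) (A B : LaurentSeries V) :
    shiftApply δ A (lamMul n B) = lamMul n (shiftApply δ A B) := by
  have h : applyHom δ (lamMul n B) = (lamMul n).comp (applyHom δ B) :=
    hom_ext_of_monom (boundedDegree_applyHom δ _)
      ((boundedDegree_lamMul n).comp (boundedDegree_applyHom δ B)) fun m v => by
      rw [AddMonoidHom.comp_apply, applyHom_apply, applyHom_apply, shiftApply_monom,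
        shiftApply_monom, shiftPow_lamMul]
      exact ext_lcoeff fun k => by simp
  exact DFunLike.congr_fun h A

theorem lamMul_smul (n : ℤ) (v : V) (A : LaurentSeries V) : lamMul n (v • A) = v • lamMul n A :=
  ext_lcoeff fun k => by simp

/-- The case of associativity with left factor ∂. For A = v λᵐ it is the Leibniz rule for λ + ∂. -/
theorem shiftStep_shiftApply (A B : LaurentSeries V) :
    shiftStep (derHom δ) (shiftApply δ A B) = shiftApply δ (shiftStep (derHom δ) A) B := by
  have h : (shiftStep (derHom δ)).comp (applyHom δ B) =
      (applyHom δ B).comp (shiftStep (derHom δ)) :=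
    hom_ext_of_monom ((boundedDegree_shiftStep _).comp (boundedDegree_applyHom δ B))
      ((boundedDegree_applyHom δ B).comp (boundedDegree_shiftStep _)) fun m v => by
      rw [AddMonoidHom.comp_apply, AddMonoidHom.comp_apply, applyHom_apply, applyHom_apply,
        shiftApply_monom, shiftStep_smul, shiftStep_apply _ (monom m v), lamMul_monom,
        mapCoeff_monom, shiftApply_add_left, shiftApply_monom, shiftApply_monom, add_comm 1 m,
        shiftPow_add_one, derHom_apply, add_comm]
  exact DFunLike.congr_fun h A

theorem shiftPow_shiftApply (q : ℤ) (A B : LaurentSeries V) :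
    shiftPow (derHom δ) q (shiftApply δ A B) = shiftApply δ (shiftPow (derHom δ) q A) B :=
  eq_of_shiftStep (derHom δ) (f := fun q => shiftPow (derHom δ) q (shiftApply δ A B))
    (g := fun q => shiftApply δ (shiftPow (derHom δ) q A) B)
    (fun q => shiftPow_add_one _ q _)
    (fun q => by rw [shiftPow_add_one, shiftStep_shiftApply]) (by simp) q

/-- Both sides are additive and of bounded degree in `A`; for a monomial `A` the claim is
`shiftPow_shiftApply`. -/
theorem shiftApply_assoc (A B C : LaurentSeries V) :
    shiftApply δ (shiftApply δ A B) C = shiftApply δ A (shiftApply δ B C) := by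
  have h : (applyHom δ C).comp (applyHom δ B) = applyHom δ (shiftApply δ B C) :=
    hom_ext_of_monom ((boundedDegree_applyHom δ _).comp (boundedDegree_applyHom δ _))
      (boundedDegree_applyHom δ _) fun n v => by
      rw [AddMonoidHom.comp_apply, applyHom_apply, applyHom_apply, applyHom_apply,
        shiftApply_monom, shiftApply_monom, shiftPow_shiftApply, shiftApply_smul_left]
  exact DFunLike.congr_fun h A

theorem one_eq_monom : (1 : LaurentSeries V) = monom 0 1 := by
  rw [monom, neg_zero]
  rfl

theorem one_shiftApply (A : LaurentSeries V) : shiftApply δ 1 A = A := by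
  rw [one_eq_monom, shiftApply_monom, shiftPow_zero, one_smul]

theorem shiftStep_monom_one (n : ℤ) : shiftStep (derHom δ) (monom n 1) = monom (n + 1) 1 := by
  rw [shiftStep_apply, lamMul_monom, mapCoeff_monom, derHom_apply, Derivation.map_one_eq_zero,
    add_comm n]
  exact (congrArg _ (map_zero (monomHom (G := V) n))).trans (add_zero _)

theorem shiftPow_monom_one (q : ℤ) : shiftPow (derHom δ) q (monom 0 1) = monom q 1 :=
  eq_of_shiftStep (derHom δ) (f := fun q => shiftPow (derHom δ) q (monom 0 1))
    (g := fun q => monom q 1) (fun q => shiftPow_add_one _ q _)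
    (fun q => (shiftStep_monom_one δ q).symm) (by simp) q

theorem shiftApply_one (A : LaurentSeries V) : shiftApply δ A 1 = A := by
  have h : applyHom δ 1 = AddMonoidHom.id (LaurentSeries V) :=
    hom_ext_of_monom (boundedDegree_applyHom δ _) BoundedDegree.id fun n v => by
      rw [applyHom_apply, shiftApply_monom, one_eq_monom, shiftPow_monom_one, smul_monom, mul_one,
        AddMonoidHom.id_apply]
  exact DFunLike.congr_fun h A

theorem shiftApply_monom_one_right (n : ℤ) (A : LaurentSeries V) :
    shiftApply δ A (monom n 1) = lamMul n A := by
  rw [← add_zero n, ← lamMul_monom, shiftApply_lamMul, ← one_eq_monom, shiftApply_one, add_zero]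

theorem shiftPow_smul_const {v : V} (hv : δ v = 0) (q : ℤ) (A : LaurentSeries V) :
    shiftPow (derHom δ) q (v • A) = v • shiftPow (derHom δ) q A :=
  (mapCoeff_shiftPow (θ := derHom δ) (θ' := derHom δ) (φ := AddMonoidHom.mulLeft v)
    (fun w => by simp [hv]) q A).symm

theorem shiftApply_monom_const {v : V} (hv : δ v = 0) (A : LaurentSeries V) :
    shiftApply δ A (monom 0 v) = v • A := by
  have hpow : ∀ n, shiftPow (derHom δ) n (monom 0 v) = monom n v := fun n => by
    rw [← mul_one v, ← smul_monom, shiftPow_smul_const δ hv, shiftPow_monom_one, smul_monom]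
  have h : applyHom δ (monom 0 v) = mapCoeff (AddMonoidHom.mulLeft v) :=
    hom_ext_of_monom (boundedDegree_applyHom δ _) (boundedDegree_mapCoeff _) fun n w => by
      rw [applyHom_apply, shiftApply_monom, hpow, smul_monom, mapCoeff_monom,
        AddMonoidHom.coe_mulLeft, mul_comm]
  exact DFunLike.congr_fun h A

theorem monom_mul_eq_shiftApply (v w : V) :
    monom 0 (v * w) = shiftApply δ (monom 0 v) (monom 0 w) := by
  rw [shiftApply_monom, shiftPow_zero, smul_monom]

theorem adjHom_smul (v : V) (A : LaurentSeries V) :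
    adjHom (derHom δ) (v • A) = shiftApply δ (adjHom (derHom δ) A) (monom 0 v) := by
  have h : (adjHom (derHom δ)).comp (mapCoeff (AddMonoidHom.mulLeft v)) =
      (applyHom δ (monom 0 v)).comp (adjHom (derHom δ)) :=
    hom_ext_of_monom ((boundedDegree_adjHom _).comp (boundedDegree_mapCoeff _))
      ((boundedDegree_applyHom δ _).comp (boundedDegree_adjHom _)) fun n w => by
      rw [AddMonoidHom.comp_apply, AddMonoidHom.comp_apply, mapCoeff_monom, applyHom_apply,
        adjHom_monom, adjHom_monom, shiftApply_zsmul_left, ← shiftPow_shiftApply,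
        ← monom_mul_eq_shiftApply, AddMonoidHom.coe_mulLeft, mul_comm]
  exact DFunLike.congr_fun h A

/-- By additivity A may be taken to be v∂ⁿ. Then the adjoint moves v to the right end, and (λ + ∂)ⁿ
becomes (-λ)ⁿ, which is right composition with (-∂)ⁿ. -/
theorem adjHom_shiftApply (A B : LaurentSeries V) :
    adjHom (derHom δ) (shiftApply δ A B) =
      shiftApply δ (adjHom (derHom δ) B) (adjHom (derHom δ) A) := by
  have h : (adjHom (derHom δ)).comp (applyHom δ B) =
      (applyHom' δ (adjHom (derHom δ) B)).comp (adjHom (derHom δ)) :=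
    hom_ext_of_monom ((boundedDegree_adjHom _).comp (boundedDegree_applyHom δ _))
      ((boundedDegree_applyHom' δ _).comp (boundedDegree_adjHom _)) fun n v => by
      rw [AddMonoidHom.comp_apply, AddMonoidHom.comp_apply, applyHom_apply, applyHom'_apply,
        shiftApply_monom, adjHom_smul, adjHom_shiftPow, adjHom_monom, shiftApply_zsmul_left,
        shiftApply_zsmul_right, ← shiftApply_monom_one_right δ, shiftApply_assoc,
        shiftApply_monom, one_smul]
  exact DFunLike.congr_fun h A

/-- Functoriality for homomorphisms of differential rings. It serves for the passage to the fraction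
field, for the inclusion of the field into the dual numbers, and for the infinitesimal lift defined
by a bracket. -/
theorem mapCoeff_shiftApply {F' W : Type*} [CommRing F'] [CommRing W] [Algebra F' W]
    (δ' : Derivation F' W W) (φ : V →+* W) (h : ∀ v, φ (δ v) = δ' (φ v)) (A B : LaurentSeries V) :
    mapCoeff (φ : V →+ W) (shiftApply δ A B) =
      shiftApply δ' (mapCoeff (φ : V →+ W) A) (mapCoeff (φ : V →+ W) B) := by
  have h' : (mapCoeff (φ : V →+ W)).comp (applyHom δ B) =
      (applyHom δ' (mapCoeff (φ : V →+ W) B)).comp (mapCoeff (φ : V →+ W)) :=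
    hom_ext_of_monom ((boundedDegree_mapCoeff _).comp (boundedDegree_applyHom δ _))
      ((boundedDegree_applyHom δ' _).comp (boundedDegree_mapCoeff _)) fun n v => by
      rw [AddMonoidHom.comp_apply, AddMonoidHom.comp_apply, applyHom_apply, applyHom_apply,
        mapCoeff_monom, shiftApply_monom, shiftApply_monom,
        ← mapCoeff_shiftPow (θ := derHom δ) (θ' := derHom δ') (φ := (φ : V →+ W)) h]
      exact ext_lcoeff fun k => by simp
  exact DFunLike.congr_fun h' A

end Operators

/-! ### The Master Formula: bracket axioms and skewsymmetry -/

section MasterFormula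

variable {F V : Type*} [Field F] [CommRing V] [Algebra F V] {ℓ : ℕ} (S : DiffFunAlgebra F V ℓ)
  (H : Matrix (Fin ℓ) (Fin ℓ) (LaurentSeries V))

/-- The derivatives `∂f/∂uᵢ⁽ⁿ⁾` with `n ≥ M` vanish. -/
def DiffFunAlgebra.OrderLT (f : V) (M : ℕ) : Prop := ∀ i n, M ≤ n → S.pd i n f = 0

theorem DiffFunAlgebra.exists_orderLT (f : V) : ∃ M, S.OrderLT f M := by
  obtain ⟨M, hM⟩ := ((S.pd_finite f).image Prod.snd).bddAbove
  refine ⟨M + 1, fun i n hn => ?_⟩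
  by_contra h
  have := hM ⟨(i, n), h, rfl⟩
  simp only at this
  omega

variable {S} in
theorem DiffFunAlgebra.OrderLT.mono {f : V} {M N : ℕ} (h : S.OrderLT f M) (hMN : M ≤ N) :
    S.OrderLT f N := fun i n hn => h i n (hMN.trans hn)

variable {S} in
theorem DiffFunAlgebra.OrderLT.der {f : V} {M : ℕ} (h : S.OrderLT f M) :
    S.OrderLT (S.der f) (M + 1) := fun i n hn => by
  obtain ⟨n, rfl⟩ : ∃ k, n = k + 1 := ⟨n - 1, by omega⟩
  rw [S.pd_succ_der, h i _ (by omega), h i _ (by omega), map_zero, add_zero]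

theorem DiffFunAlgebra.orderLT_u (j : Fin ℓ) : S.OrderLT (S.u j 0) 1 := fun i n hn => by
  rw [S.pd_u, if_neg (by omega)]

/-- This recognizes the right end of the Master Formula as the adjoint of the differential operator
w∂ᵐ. -/
theorem adjHom_monom_natCast (m : ℕ) (w : V) :
    shiftApply S.der (monom m ((-1) ^ m)) (monom 0 w) = adjHom (derHom S.der) (monom m w) := by
  rw [shiftApply_monom, adjHom_monom, Int.coe_negOnePow_natCast, ← Int.cast_smul_eq_zsmul V]
  push_cast
  rfl

theorem masterTerm_eq (f g : V) (i j : Fin ℓ) (m n : ℕ) :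
    masterTerm S H f g ((i, m), (j, n)) = S.pd j n g • shiftPow (derHom S.der) n
      (shiftApply S.der (H j i) (adjHom (derHom S.der) (monom m (S.pd i m f)))) := by
  rw [masterTerm, adjHom_monom_natCast, shiftApply_monom, one_smul]

theorem masterTerm_eq_zero_left {f : V} (g : V) {q : (Fin ℓ × ℕ) × (Fin ℓ × ℕ)}
    (h : S.pd q.1.1 q.1.2 f = 0) : masterTerm S H f g q = 0 := by
  rw [masterTerm_eq, h, ← monomHom_apply, map_zero, map_zero, shiftApply_zero_right, map_zero,
    smul_zero]

theorem masterTerm_eq_zero_right (f : V) {g : V} {q : (Fin ℓ × ℕ) × (Fin ℓ × ℕ)}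
    (h : S.pd q.2.1 q.2.2 g = 0) : masterTerm S H f g q = 0 := by
  rw [masterTerm_eq, h, zero_smul]

theorem masterTerm_support_finite (f g : V) : (Function.support (masterTerm S H f g)).Finite :=
  ((S.pd_finite f).prod (S.pd_finite g)).subset fun _ hq =>
    ⟨fun h => hq (masterTerm_eq_zero_left S H g h), fun h => hq (masterTerm_eq_zero_right S H f h)⟩

theorem masterBracket_eq_sum {f g : V} {M N : ℕ} (hf : S.OrderLT f M) (hg : S.OrderLT g N) :
    masterBracket S H f g = ∑ q ∈ (Finset.univ ×ˢ Finset.range M) ×ˢ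
      (Finset.univ ×ˢ Finset.range N), masterTerm S H f g q := by
  refine finsum_eq_sum_of_support_subset _ fun q hq => ?_
  simp only [Finset.coe_product, Finset.coe_univ, Finset.coe_range, Set.mem_prod, Set.mem_univ,
    true_and, Set.mem_Iio]
  refine ⟨?_, ?_⟩ <;> by_contra h
  · exact hq (masterTerm_eq_zero_left S H g (hf _ _ (by omega)))
  · exact hq (masterTerm_eq_zero_right S H f (hg _ _ (by omega)))

/-- For g = u_j the Fréchet derivative of g is 1 in position j, and what remains is row j of H
composed with the adjoint of the Fréchet derivative of `f`. -/
theorem masterBracket_u {f : V} {M : ℕ} (hf : S.OrderLT f M) (j : Fin ℓ) :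
    masterBracket S H f (S.u j 0) = ∑ i, ∑ m ∈ Finset.range M,
      shiftApply S.der (H j i) (adjHom (derHom S.der) (monom m (S.pd i m f))) := by
  rw [masterBracket_eq_sum S H hf (S.orderLT_u j), Finset.sum_product, Finset.sum_product]
  refine Finset.sum_congr rfl fun i _ => Finset.sum_congr rfl fun m _ => ?_
  rw [Finset.sum_product, Finset.sum_eq_single j]
  · rw [Finset.sum_range_one, masterTerm_eq, S.pd_u, if_pos ⟨rfl, rfl⟩, one_smul, Nat.cast_zero,
      shiftPow_zero]
  · intro k _ hk
    rw [Finset.sum_range_one, masterTerm_eq, S.pd_u, if_neg (fun h => hk h.1), zero_smul]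
  · exact fun h => absurd (Finset.mem_univ _) h

/-- The dependences on `f` and on `g` are separated: `f` enters only through its brackets with
generators, `g` only through its derivatives. Axioms in the first argument therefore need only be
checked for g = u_j. -/
theorem masterBracket_eq (f : V) {g : V} {N : ℕ} (hg : S.OrderLT g N) :
    masterBracket S H f g = ∑ j, ∑ n ∈ Finset.range N,
      S.pd j n g • shiftPow (derHom S.der) n (masterBracket S H f (S.u j 0)) := by
  obtain ⟨M, hM⟩ := S.exists_orderLT f
  rw [masterBracket_eq_sum S H hM hg, Finset.sum_product_right, Finset.sum_product]
  refine Finset.sum_congr rfl fun j _ => Finset.sum_congr rfl fun n _ => ?_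
  rw [masterBracket_u S H hM, map_sum, Finset.smul_sum, Finset.sum_product]
  refine Finset.sum_congr rfl fun i _ => ?_
  rw [map_sum, Finset.smul_sum]
  exact Finset.sum_congr rfl fun m _ => masterTerm_eq S H f g i j m n

/-- Summation of the commutation relation `[∂/∂u⁽ⁿ⁾, ∂] = ∂/∂u⁽ⁿ⁻¹⁾` against a family of additive
maps. -/
theorem DiffFunAlgebra.sum_pd_der {A : Type*} [AddCommGroup A] {f : V} {M : ℕ}
    (hf : S.OrderLT f M) (i : Fin ℓ) (Φ : ℕ → V →+ A) :
    ∑ m ∈ Finset.range (M + 1), Φ m (S.pd i m (S.der f)) = ∑ m ∈ Finset.range M,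
      (Φ m (S.der (S.pd i m f)) + Φ (m + 1) (S.pd i m f)) := by
  -- The term at index 0 has no second summand; the remaining second summands, reindexed, run over
  -- `range M`, and the extra derivative of order `M` vanishes.
  rw [Finset.sum_range_succ', S.pd_zero_der, Finset.sum_congr rfl fun m _ => by
    rw [S.pd_succ_der, map_add], Finset.sum_add_distrib, add_right_comm,
    ← Finset.sum_range_succ' fun m => Φ m (S.der (S.pd i m f)), Finset.sum_range_succ,
    hf i M le_rfl, map_zero, map_zero, add_zero, Finset.sum_add_distrib]

theorem monom_der (m : ℤ) (w : V) : monom m (S.der w) =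
    shiftStep (derHom S.der) (monom m w) - monom (m + 1) w := by
  rw [shiftStep_apply, lamMul_monom, mapCoeff_monom, derHom_apply, add_comm 1 m, add_sub_cancel_left]

/-- The Fréchet derivative of ∂f is ∂ composed with that of f; its adjoint gains a factor -∂ on the
right, which multiplies the symbol by -λ. -/
theorem masterBracket_der_u (f : V) (j : Fin ℓ) :
    masterBracket S H (S.der f) (S.u j 0) = -lamMul 1 (masterBracket S H f (S.u j 0)) := by
  obtain ⟨M, hM⟩ := S.exists_orderLT f
  rw [masterBracket_u S H hM.der, masterBracket_u S H hM, map_sum, ← Finset.sum_neg_distrib]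
  refine Finset.sum_congr rfl fun i _ => ?_
  have h := S.sum_pd_der hM i fun m =>
    (applyHom' S.der (H j i)).comp ((adjHom (derHom S.der)).comp (monomHom (m : ℤ)))
  simp only [AddMonoidHom.comp_apply, applyHom'_apply, monomHom_apply] at h
  rw [h, map_sum, ← Finset.sum_neg_distrib]
  refine Finset.sum_congr rfl fun m _ => ?_
  rw [monom_der, map_sub, adjHom_shiftStep, sub_eq_add_neg, shiftApply_add_right,
    shiftApply_neg_right, shiftApply_neg_right, shiftApply_lamMul, Nat.cast_succ,
    neg_add_cancel_right]

/-- The Fréchet derivative obeys the Leibniz rule, and the adjoint turns left multiplication by a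
function into right multiplication. -/
theorem masterBracket_mul_u (f g : V) (j : Fin ℓ) :
    masterBracket S H (f * g) (S.u j 0) =
      shiftApply S.der (masterBracket S H f (S.u j 0)) (monom 0 g) +
      shiftApply S.der (masterBracket S H g (S.u j 0)) (monom 0 f) := by
  obtain ⟨M, hM⟩ := S.exists_orderLT f
  obtain ⟨N, hN⟩ := S.exists_orderLT g
  replace hM := hM.mono (le_max_left M N)
  replace hN := hN.mono (le_max_right M N)
  have hMN : S.OrderLT (f * g) (max M N) := fun i n hn => by
    rw [Derivation.leibniz, hM i n hn, hN i n hn, smul_zero, smul_zero, add_zero]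
  rw [masterBracket_u S H hM, masterBracket_u S H hN, masterBracket_u S H hMN,
    shiftApply_sum_left, shiftApply_sum_left, ← Finset.sum_add_distrib]
  refine Finset.sum_congr rfl fun i _ => ?_
  rw [shiftApply_sum_left, shiftApply_sum_left, ← Finset.sum_add_distrib]
  refine Finset.sum_congr rfl fun m _ => ?_
  rw [shiftApply_assoc, shiftApply_assoc, ← adjHom_smul, ← adjHom_smul, smul_monom, smul_monom,
    ← shiftApply_add_right, ← map_add, Derivation.leibniz, add_comm]
  congr 2
  exact map_add (monomHom (G := V) m) _ _

theorem masterBracket_add_left_u (f g : V) (j : Fin ℓ) :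
    masterBracket S H (f + g) (S.u j 0) =
      masterBracket S H f (S.u j 0) + masterBracket S H g (S.u j 0) := by
  obtain ⟨M, hM⟩ := S.exists_orderLT f
  obtain ⟨N, hN⟩ := S.exists_orderLT g
  replace hM := hM.mono (le_max_left M N)
  replace hN := hN.mono (le_max_right M N)
  have hMN : S.OrderLT (f + g) (max M N) := fun i n hn => by
    rw [map_add, hM i n hn, hN i n hn, add_zero]
  rw [masterBracket_u S H hM, masterBracket_u S H hN, masterBracket_u S H hMN,
    ← Finset.sum_add_distrib]
  refine Finset.sum_congr rfl fun i _ => ?_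
  rw [← Finset.sum_add_distrib]
  refine Finset.sum_congr rfl fun m _ => ?_
  rw [map_add, ← shiftApply_add_right, ← map_add (adjHom _)]
  congr 2
  exact map_add (monomHom (G := V) m) _ _

/-- A scalar is an element with zero derivatives that is killed by ∂, so homogeneity follows from
the product rule. -/
theorem masterBracket_smul_left_u (c : F) (f : V) (j : Fin ℓ) :
    masterBracket S H (c • f) (S.u j 0) = algebraMap F V c • masterBracket S H f (S.u j 0) := by
  have hc : S.OrderLT (algebraMap F V c) 0 := fun i n _ => Derivation.map_algebraMap _ c
  rw [Algebra.smul_def, masterBracket_mul_u, masterBracket_u S H hc,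
    shiftApply_monom_const S.der (Derivation.map_algebraMap _ c)]
  simp [shiftApply_zero_left]

theorem masterTerm_add_right (f g g' : V) (q : (Fin ℓ × ℕ) × (Fin ℓ × ℕ)) :
    masterTerm S H f (g + g') q = masterTerm S H f g q + masterTerm S H f g' q := by
  rw [masterTerm_eq, masterTerm_eq, masterTerm_eq, map_add, add_smul]

theorem DiffFunAlgebra.OrderLT.smul {f : V} {M : ℕ} (h : S.OrderLT f M) (c : F) :
    S.OrderLT (c • f) M := fun i n hn => by rw [Derivation.map_smul, h i n hn, smul_zero]

/-- The adjoint of a matrix pseudodifferential operator. -/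
noncomputable def adjMatrix : Matrix (Fin ℓ) (Fin ℓ) (LaurentSeries V) :=
  Matrix.of fun i j => adjHom (derHom S.der) (H j i)

theorem isNonlocalBracket_masterBracket :
    IsNonlocalBracket S.der (masterBracket S H) where
  linear_left g := by
    obtain ⟨N, hN⟩ := S.exists_orderLT g
    refine ⟨fun f f' => ?_, fun c f => ?_⟩
    · simp only [masterBracket_eq S H _ hN, masterBracket_add_left_u, map_add, smul_add,
        Finset.sum_add_distrib]
    · rw [masterBracket_eq S H _ hN, masterBracket_eq S H f hN, Finset.smul_sum]
      refine Finset.sum_congr rfl fun j _ => ?_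
      rw [Finset.smul_sum]
      refine Finset.sum_congr rfl fun n _ => ?_
      rw [masterBracket_smul_left_u, shiftPow_smul_const S.der (Derivation.map_algebraMap _ c),
        smul_comm, algebraMap_smul]
  linear_right f := by
    refine ⟨fun g g' => ?_, fun c g => ?_⟩
    · simp only [masterBracket, masterTerm_add_right]
      exact finsum_add_distrib (masterTerm_support_finite S H f g)
        (masterTerm_support_finite S H f g')
    · obtain ⟨N, hN⟩ := S.exists_orderLT g
      rw [masterBracket_eq S H f hN, masterBracket_eq S H f (hN.smul S c), Finset.smul_sum]
      refine Finset.sum_congr rfl fun j _ => ?_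
      rw [Finset.smul_sum]
      refine Finset.sum_congr rfl fun n _ => ?_
      rw [Derivation.map_smul, smul_assoc]
  sesq_left f g := by
    obtain ⟨N, hN⟩ := S.exists_orderLT g
    rw [monom_one_mul, masterBracket_eq S H _ hN, masterBracket_eq S H f hN, map_sum,
      ← Finset.sum_neg_distrib]
    refine Finset.sum_congr rfl fun j _ => ?_
    rw [map_sum, ← Finset.sum_neg_distrib]
    refine Finset.sum_congr rfl fun n _ => ?_
    rw [masterBracket_der_u, map_neg, shiftPow_lamMul, smul_neg, lamMul_smul]
  sesq_right f g := by
    obtain ⟨N, hN⟩ := S.exists_orderLT g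
    rw [monom_one_mul, coeffDer_eq_mapCoeff, ← shiftStep_apply, masterBracket_eq S H f hN.der,
      masterBracket_eq S H f hN, map_sum]
    refine Finset.sum_congr rfl fun j _ => ?_
    -- The two summands obtained from ∂g correspond to the two summands of the Leibniz rule (λ +
    -- ∂)(v X) = (∂v) X + v (λ + ∂) X.
    have h := S.sum_pd_der hN j fun n => ((AddMonoidHom.flip (smulAddHom V (LaurentSeries V))
      (shiftPow (derHom S.der) n (masterBracket S H f (S.u j 0)))))
    simp only [AddMonoidHom.flip_apply, smulAddHom_apply] at h
    rw [h, map_sum]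
    refine Finset.sum_congr rfl fun n _ => ?_
    rw [shiftStep_smul, Nat.cast_succ, shiftPow_add_one]
  leibniz_left f g g' := by
    obtain ⟨N, hN⟩ := S.exists_orderLT g
    obtain ⟨N', hN'⟩ := S.exists_orderLT g'
    replace hN := hN.mono (le_max_left N N')
    replace hN' := hN'.mono (le_max_right N N')
    have hNN : S.OrderLT (g * g') (max N N') := fun i n hn => by
      rw [Derivation.leibniz, hN i n hn, hN' i n hn, smul_zero, smul_zero, add_zero]
    rw [masterBracket_eq S H f hN, masterBracket_eq S H f hN', masterBracket_eq S H f hNN,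
      Finset.smul_sum, Finset.smul_sum, ← Finset.sum_add_distrib]
    refine Finset.sum_congr rfl fun j _ => ?_
    rw [Finset.smul_sum, Finset.smul_sum, ← Finset.sum_add_distrib]
    refine Finset.sum_congr rfl fun n _ => ?_
    rw [Derivation.leibniz, add_smul, smul_assoc, smul_assoc]
  leibniz_right f f' g := by
    obtain ⟨N, hN⟩ := S.exists_orderLT g
    simp only [masterBracket_eq S H _ hN, masterBracket_mul_u]
    rw [shiftApply_sum_left, shiftApply_sum_left, ← Finset.sum_add_distrib]
    refine Finset.sum_congr rfl fun j _ => ?_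
    rw [shiftApply_sum_left, shiftApply_sum_left, ← Finset.sum_add_distrib]
    refine Finset.sum_congr rfl fun n _ => ?_
    rw [map_add, shiftPow_shiftApply, shiftPow_shiftApply, smul_add, shiftApply_smul_left,
      shiftApply_smul_left]

/-- As an operator the term is (v∂ⁿ) ∘ H_{ji} ∘ (w∂ᵐ)* with v, w the derivatives of g, f. Reversing
the order under * exchanges the two outer factors, hence the roles of `f` and `g`. -/
theorem adjHom_masterTerm (f g : V) (i j : Fin ℓ) (m n : ℕ) :
    adjHom (derHom S.der) (masterTerm S H f g ((i, m), (j, n))) =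
      masterTerm S (adjMatrix S H) g f ((j, n), (i, m)) := by
  rw [masterTerm_eq, masterTerm_eq, adjHom_smul, adjHom_shiftPow, shiftApply_zsmul_left,
    ← shiftApply_monom_one_right S.der, shiftApply_assoc, shiftApply_monom S.der n 1, one_smul,
    ← shiftApply_zsmul_right, ← adjHom_monom, adjHom_shiftApply, adjHom_adjHom, shiftApply_assoc,
    shiftApply_monom]
  rfl

theorem adjHom_masterBracket (f g : V) :
    adjHom (derHom S.der) (masterBracket S H f g) =
      masterBracket S (adjMatrix S H) g f := by
  obtain ⟨M, hM⟩ := S.exists_orderLT f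
  obtain ⟨N, hN⟩ := S.exists_orderLT g
  rw [masterBracket_eq_sum S H hM hN, masterBracket_eq_sum S _ hN hM, map_sum]
  refine Finset.sum_equiv (Equiv.prodComm _ _) (fun q => ?_) fun q _ => ?_
  · simp only [Equiv.prodComm_apply, Finset.mem_product, Prod.fst_swap, Prod.snd_swap]
    exact and_comm
  · exact adjHom_masterTerm S H f g _ _ _ _

/-- The matrix is recovered from the bracket, with transposed indices; skewsymmetry on generators is
thus already skewadjointness of `H`. -/
theorem masterBracket_u_u (i j : Fin ℓ) :
    masterBracket S H (S.u i 0) (S.u j 0) = H j i := by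
  rw [masterBracket_u S H (S.orderLT_u i), Finset.sum_eq_single i]
  · rw [Finset.sum_range_one, S.pd_u, if_pos ⟨rfl, rfl⟩, Nat.cast_zero, adjHom_monom_zero,
      ← one_eq_monom, shiftApply_one]
  · intro k _ hk
    rw [Finset.sum_range_one, S.pd_u, if_neg (fun h => hk h.1), ← monomHom_apply, map_zero,
      map_zero, shiftApply_zero_right]
  · exact fun h => absurd (Finset.mem_univ _) h

theorem isSkewsymmetric_masterBracket_iff :
    IsSkewsymmetric S.der (masterBracket S H) ↔ IsSkewadjoint S.der H := by
  constructor
  · intro h i j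
    have := h (S.u i 0) (S.u j 0)
    rw [masterBracket_u_u, masterBracket_u_u] at this
    rw [this, neg_neg]
  · intro h f g
    have hH : adjMatrix S H = -H := by
      ext1 i j
      exact h i j
    rw [adjoint_eq_adjHom, adjHom_masterBracket, hH]
    simp only [masterBracket]
    rw [← finsum_neg_distrib]
    refine finsum_congr fun q => ?_
    rw [masterTerm_eq, masterTerm_eq, Matrix.neg_apply, shiftApply_neg_left, map_neg, smul_neg,
      neg_neg]

end MasterFormula

/-! ### Operators on series in three variables -/

section ToSeries

variable {V V' : Type*} [AddCommGroup V] [AddCommGroup V']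

open Classical in
/-- The Laurent series with the given coefficients, if these vanish for large indices. -/
noncomputable def toSeries (f : ℤ → V) : LaurentSeries V :=
  if hf : ∃ N : ℤ, ∀ n, N < n → f n = 0 then ofCoeff f hf else 0

theorem lcoeff_toSeries {f : ℤ → V} {N : ℤ} (hf : ∀ n, N < n → f n = 0) (n : ℤ) :
    lcoeff (toSeries f) n = f n := by
  rw [toSeries, dif_pos ⟨N, hf⟩, lcoeff_ofCoeff]

theorem vanishAbove_toSeries {f : ℤ → V} {N : ℤ} (hf : ∀ n, N < n → f n = 0) :
    VanishAbove N (toSeries f) := fun n hn => by rw [lcoeff_toSeries hf, hf n hn]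

theorem toSeries_lcoeff (A : LaurentSeries V) : toSeries (lcoeff A) = A := by
  obtain ⟨N, hN⟩ := exists_vanishAbove A
  exact ext_lcoeff fun n => lcoeff_toSeries hN n

theorem toSeries_zero : toSeries (fun _ => (0 : V)) = 0 :=
  toSeries_lcoeff (0 : LaurentSeries V)

theorem toSeries_add {f g : ℤ → V} {M N : ℤ} (hf : ∀ n, M < n → f n = 0)
    (hg : ∀ n, N < n → g n = 0) :
    toSeries (fun n => f n + g n) = toSeries f + toSeries g := by
  rw [← toSeries_lcoeff (toSeries f + toSeries g)]
  congr 1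
  funext n
  rw [lcoeff_add, lcoeff_toSeries hf, lcoeff_toSeries hg]

theorem toSeries_shift {f : ℤ → V} {N : ℤ} (hf : ∀ n, N < n → f n = 0) (t : ℤ) :
    toSeries (fun n => f (n - t)) = lamMul t (toSeries f) := by
  rw [← toSeries_lcoeff (lamMul t (toSeries f))]
  congr 1
  funext n
  rw [lcoeff_lamMul, lcoeff_toSeries hf]

theorem toSeries_map {f : ℤ → V} {N : ℤ} (hf : ∀ n, N < n → f n = 0) (φ : V →+ V') :
    toSeries (fun n => φ (f n)) = mapCoeff φ (toSeries f) := by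
  rw [← toSeries_lcoeff (mapCoeff φ (toSeries f))]
  congr 1
  funext n
  rw [lcoeff_mapCoeff, lcoeff_toSeries hf]

end ToSeries

/-! ### Series in λ, μ, ν: uniqueness principles and the three expansions -/

section ThreeVariables

variable {F V V' : Type*} [CommRing F] [AddCommGroup V] [Module F V]
  [AddCommGroup V'] [Module F V']

theorem Series3.bound_third {a : Series3 F V} {N : ℤ}
    (hN : ∀ m n p, (N < m ∨ N < n ∨ N < p) → a.1 m n p = 0) (m n p : ℤ) (hp : N < p) :
    a.1 m n p = 0 := hN m n p (Or.inr (Or.inr hp))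

/-- Multiplication by `λ ^ r`. -/
def mulL (r : ℤ) : Series3 F V →+ Series3 F V where
  toFun a := ⟨fun m n p => a.1 (m - r) n p, by
    obtain ⟨N, hN⟩ := a.2
    exact ⟨max N (N + r), fun m n p h => hN _ _ _ (by omega)⟩⟩
  map_zero' := rfl
  map_add' _ _ := rfl

/-- Multiplication by `μ ^ s`. -/
def mulM (s : ℤ) : Series3 F V →+ Series3 F V where
  toFun a := ⟨fun m n p => a.1 m (n - s) p, by
    obtain ⟨N, hN⟩ := a.2
    exact ⟨max N (N + s), fun m n p h => hN _ _ _ (by omega)⟩⟩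
  map_zero' := rfl
  map_add' _ _ := rfl

/-- Multiplication by `ν ^ t`. -/
def mulN (t : ℤ) : Series3 F V →+ Series3 F V where
  toFun a := ⟨fun m n p => a.1 m n (p - t), by
    obtain ⟨N, hN⟩ := a.2
    exact ⟨max N (N + t), fun m n p h => hN _ _ _ (by omega)⟩⟩
  map_zero' := rfl
  map_add' _ _ := rfl

theorem mulL_apply (r : ℤ) (a : Series3 F V) (m n p : ℤ) :
    (mulL r a).1 m n p = a.1 (m - r) n p := rfl

theorem mulM_apply (r : ℤ) (a : Series3 F V) (m n p : ℤ) :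
    (mulM r a).1 m n p = a.1 m (n - r) p := rfl

theorem mulN_apply (r : ℤ) (a : Series3 F V) (m n p : ℤ) :
    (mulN r a).1 m n p = a.1 m n (p - r) := rfl

theorem Series3.ext {a b : Series3 F V} (h : ∀ m n p, a.1 m n p = b.1 m n p) : a = b :=
  Subtype.ext (funext fun m => funext fun n => funext fun p => h m n p)

theorem mulRel_eq (a : Series3 F V) : mulRel F V a = mulN 1 a - mulL 1 a - mulM 1 a := rfl

open Classical in
/-- The monomial `v λ ^ m μ ^ n ν ^ p`. -/
noncomputable def mon3 (m n p : ℤ) (v : V) : Series3 F V :=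
  ⟨fun m' n' p' => if m' = m ∧ n' = n ∧ p' = p then v else 0, by
    refine ⟨max m (max n p), fun m' n' p' h => if_neg ?_⟩
    omega⟩

theorem mon3_apply (m n p : ℤ) (v : V) (m' n' p' : ℤ) :
    (mon3 m n p v : Series3 F V).1 m' n' p' = if m' = m ∧ n' = n ∧ p' = p then v else 0 := by
  simp only [mon3]

theorem mon3_eq (m n p : ℤ) (v : V) :
    (mon3 m n p v : Series3 F V) = mulL m (mulM n (mulN p (mon3 0 0 0 v))) :=
  Series3.ext fun m' n' p' => by
    rw [mulL_apply, mulM_apply, mulN_apply, mon3_apply, mon3_apply]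
    exact if_congr (by omega) rfl rfl

/-- An additive map applied to the coefficients. -/
def map3 (φ : V →+ V') : Series3 F V →+ Series3 F V' where
  toFun a := ⟨fun m n p => φ (a.1 m n p), by
    obtain ⟨N, hN⟩ := a.2
    exact ⟨N, fun m n p h => (congrArg φ (hN m n p h)).trans (map_zero φ)⟩⟩
  map_zero' := Series3.ext fun _ _ _ => map_zero φ
  map_add' _ _ := Series3.ext fun _ _ _ => map_add φ _ _

theorem map3_apply (φ : V →+ V') (a : Series3 F V) (m n p : ℤ) :
    (map3 φ a : Series3 F V').1 m n p = φ (a.1 m n p) := rfl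

/-- The exchange of `λ` and `μ`. -/
def swap12 : Series3 F V →+ Series3 F V where
  toFun a := ⟨fun m n p => a.1 n m p, by
    obtain ⟨N, hN⟩ := a.2
    exact ⟨N, fun m n p h => hN _ _ _ (by tauto)⟩⟩
  map_zero' := rfl
  map_add' _ _ := rfl

/-- The exchange of `μ` and `ν`. -/
def swap23 : Series3 F V →+ Series3 F V where
  toFun a := ⟨fun m n p => a.1 m p n, by
    obtain ⟨N, hN⟩ := a.2
    exact ⟨N, fun m n p h => hN _ _ _ (by tauto)⟩⟩
  map_zero' := rfl
  map_add' _ _ := rfl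

/-- An operator on Laurent series applied in the third variable. -/
noncomputable def mapThird (Φ : LaurentSeries V →+ LaurentSeries V') (hΦ : BoundedDegree Φ) :
    Series3 F V →+ Series3 F V' :=
  AddMonoidHom.mk' (fun a => ⟨fun m n p => lcoeff (Φ (toSeries (a.1 m n))) p, by
    obtain ⟨N, hN⟩ := a.2
    obtain ⟨c, hc⟩ := hΦ
    refine ⟨max N (N + c), fun m n p h => ?_⟩
    by_cases hmn : N < m ∨ N < n
    · have : a.1 m n = fun _ => 0 := funext fun p => hN m n p (by tauto)
      beta_reduce
      rw [this, toSeries_zero, map_zero, lcoeff_zero]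
    · exact hc _ N (vanishAbove_toSeries fun p hp => hN m n p (by tauto)) p (by omega)⟩) (by
    intro a b
    obtain ⟨M, hM⟩ := a.2
    obtain ⟨N, hN⟩ := b.2
    refine Series3.ext fun m n p => ?_
    have h := toSeries_add (Series3.bound_third hM m n) (Series3.bound_third hN m n)
    change lcoeff (Φ (toSeries fun p => a.1 m n p + b.1 m n p)) p = _
    rw [h, map_add]
    rfl)

theorem mapThird_apply (Φ : LaurentSeries V →+ LaurentSeries V') (hΦ : BoundedDegree Φ)
    (a : Series3 F V) (m n p : ℤ) :
    (mapThird Φ hΦ a : Series3 F V').1 m n p = lcoeff (Φ (toSeries (a.1 m n))) p := rfl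

theorem toSeries_mapThird (Φ : LaurentSeries V →+ LaurentSeries V') (hΦ : BoundedDegree Φ)
    (a : Series3 F V) (m n : ℤ) :
    toSeries ((mapThird Φ hΦ a : Series3 F V').1 m n) = Φ (toSeries (a.1 m n)) :=
  toSeries_lcoeff _

theorem toSeries_mulN (t : ℤ) (a : Series3 F V) (m n : ℤ) :
    toSeries ((mulN t a).1 m n) = lamMul t (toSeries (a.1 m n)) := by
  obtain ⟨N, hN⟩ := a.2
  exact toSeries_shift (Series3.bound_third hN m n) t

theorem toSeries_map3 (φ : V →+ V') (a : Series3 F V) (m n : ℤ) :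
    toSeries ((map3 φ a : Series3 F V').1 m n) = mapCoeff φ (toSeries (a.1 m n)) := by
  obtain ⟨N, hN⟩ := a.2
  exact toSeries_map (Series3.bound_third hN m n) φ

/-- Additive maps which only depend on the components of large total degree and which agree on
monomials are equal. -/
theorem Series3.hom_ext_of_mon3 {A : Type*} [AddCommGroup A] {Φ Ψ : Series3 F V →+ A} (d : ℤ)
    (hΦ : ∀ a : Series3 F V, (∀ m n p, d ≤ m + n + p → a.1 m n p = 0) → Φ a = 0)
    (hΨ : ∀ a : Series3 F V, (∀ m n p, d ≤ m + n + p → a.1 m n p = 0) → Ψ a = 0)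
    (h : ∀ m n p v, Φ (mon3 m n p v) = Ψ (mon3 m n p v)) : Φ = Ψ := by
  ext1 a
  obtain ⟨N, hN⟩ := a.2
  -- If all exponents are at most `N` and the total degree is at least `d`, then each exponent is at
  -- least `d - 2 * N`. So the cube contains every nonzero term of total degree at least `d`.
  set s : Finset (ℤ × ℤ × ℤ) := Finset.Icc (d - 2 * N) N ×ˢ
    Finset.Icc (d - 2 * N) N ×ˢ Finset.Icc (d - 2 * N) N with hs
  set b : Series3 F V := ∑ q ∈ s, mon3 q.1 q.2.1 q.2.2 (a.1 q.1 q.2.1 q.2.2) with hb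
  have hbc : ∀ m n p, b.1 m n p = if (m, n, p) ∈ s then a.1 m n p else 0 := by
    intro m n p
    have h1 : b.1 m n p = ∑ q ∈ s, (mon3 q.1 q.2.1 q.2.2 (a.1 q.1 q.2.1 q.2.2) :
        Series3 F V).1 m n p := by
      rw [hb]
      simp only [Submodule.coe_sum, Finset.sum_apply]
    rw [h1, ← Finset.sum_ite_eq s (m, n, p) fun q => a.1 q.1 q.2.1 q.2.2]
    refine Finset.sum_congr rfl fun q _ => ?_
    rw [mon3_apply]
    exact if_congr (by simp [Prod.ext_iff]) rfl rfl
  have hlow : ∀ m n p, d ≤ m + n + p → (a - b).1 m n p = 0 := by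
    intro m n p hd
    change a.1 m n p - b.1 m n p = 0
    rw [hbc]
    split_ifs with hm
    · exact sub_self _
    · rw [hN m n p, sub_zero]
      simp only [hs, Finset.mem_product, Finset.mem_Icc] at hm
      omega
  have h1 := hΦ _ hlow
  have h2 := hΨ _ hlow
  rw [map_sub, sub_eq_zero] at h1 h2
  rw [h1, h2, hb, map_sum, map_sum]
  exact Finset.sum_congr rfl fun q _ => h _ _ _ _

theorem mulL_add (r s : ℤ) (a : Series3 F V) : mulL (r + s) a = mulL r (mulL s a) :=
  Series3.ext fun m n p => by simp only [mulL_apply, sub_sub]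

theorem mulM_add (r s : ℤ) (a : Series3 F V) : mulM (r + s) a = mulM r (mulM s a) :=
  Series3.ext fun m n p => by simp only [mulM_apply, sub_sub]

theorem mulN_add (r s : ℤ) (a : Series3 F V) : mulN (r + s) a = mulN r (mulN s a) :=
  Series3.ext fun m n p => by simp only [mulN_apply, sub_sub]

theorem mulL_zero (a : Series3 F V) : mulL 0 a = a :=
  Series3.ext fun m n p => by rw [mulL_apply, sub_zero]

theorem mulM_zero (a : Series3 F V) : mulM 0 a = a :=
  Series3.ext fun m n p => by rw [mulM_apply, sub_zero]

theorem mulN_zero (a : Series3 F V) : mulN 0 a = a :=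
  Series3.ext fun m n p => by rw [mulN_apply, sub_zero]

/-- A property invariant under a one-parameter group of shifts. -/
theorem shift_invariant {X : Type*} {T : ℤ → X → X} (h0 : ∀ a, T 0 a = a)
    (hadd : ∀ r s a, T (r + s) a = T r (T s a)) {P : X → Prop} (hP : ∀ a, P (T 1 a) ↔ P a)
    (r : ℤ) (a : X) : P (T r a) ↔ P a := by
  induction r using Int.induction_on with
  | zero => rw [h0]
  | succ n ih => rw [add_comm, hadd, hP, ih]
  | pred n ih => rw [← hP, ← hadd, add_sub_cancel, ih]

/-- Additive maps from three-variable to two-variable series which have the same intertwining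
properties with the variables and agree on constants are equal. -/
theorem Series3.hom_ext_of_intertwine {Φ Ψ : Series3 F V →+ (ℤ → ℤ → V')}
    (C : (ℤ → ℤ → V') → Prop) {e₁ e₂ e₃ : (ℤ → ℤ → V') → (ℤ → ℤ → V')}
    (hΦC : ∀ a, C (Φ a)) (hΨC : ∀ a, C (Ψ a))
    (he₁ : ∀ x y, C x → C y → e₁ x = e₁ y → x = y)
    (he₂ : ∀ x y, C x → C y → e₂ x = e₂ y → x = y)
    (he₃ : ∀ x y, C x → C y → e₃ x = e₃ y → x = y)
    (hΦ₁ : ∀ a, Φ (mulL 1 a) = e₁ (Φ a)) (hΨ₁ : ∀ a, Ψ (mulL 1 a) = e₁ (Ψ a))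
    (hΦ₂ : ∀ a, Φ (mulM 1 a) = e₂ (Φ a)) (hΨ₂ : ∀ a, Ψ (mulM 1 a) = e₂ (Ψ a))
    (hΦ₃ : ∀ a, Φ (mulN 1 a) = e₃ (Φ a)) (hΨ₃ : ∀ a, Ψ (mulN 1 a) = e₃ (Ψ a))
    (hΦd : ∀ (a : Series3 F V) i j,
      (∀ m n p, i + j ≤ m + n + p → a.1 m n p = 0) → Φ a i j = 0)
    (hΨd : ∀ (a : Series3 F V) i j,
      (∀ m n p, i + j ≤ m + n + p → a.1 m n p = 0) → Ψ a i j = 0)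
    (h0 : ∀ v, Φ (mon3 0 0 0 v) = Ψ (mon3 0 0 0 v)) (a : Series3 F V) : Φ a = Ψ a := by
  -- Every monomial is reached from a constant by shifts in the three variables, and agreement
  -- propagates along shifts in both directions because `e₁`, `e₂`, `e₃` are injective on `C`.
  have hmon : ∀ m n p v, Φ (mon3 m n p v) = Ψ (mon3 m n p v) := by
    intro m n p v
    rw [mon3_eq]
    rw [shift_invariant (T := fun r => mulL r) (P := fun a => Φ a = Ψ a) mulL_zero mulL_add
        (fun a => by
          rw [hΦ₁, hΨ₁]
          exact ⟨he₁ _ _ (hΦC a) (hΨC a), fun h => by rw [h]⟩) m _,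
      shift_invariant (T := fun r => mulM r) (P := fun a => Φ a = Ψ a) mulM_zero mulM_add
        (fun a => by
          rw [hΦ₂, hΨ₂]
          exact ⟨he₂ _ _ (hΦC a) (hΨC a), fun h => by rw [h]⟩) n _,
      shift_invariant (T := fun r => mulN r) (P := fun a => Φ a = Ψ a) mulN_zero mulN_add
        (fun a => by
          rw [hΦ₃, hΨ₃]
          exact ⟨he₃ _ _ (hΦC a) (hΨC a), fun h => by rw [h]⟩) p _]
    exact h0 v
  funext i j
  let ev : (ℤ → ℤ → V') →+ V' :=
    (Pi.evalAddMonoidHom (fun _ => V') j).comp (Pi.evalAddMonoidHom (fun _ => ℤ → V') i)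
  have h : ev.comp Φ = ev.comp Ψ :=
    Series3.hom_ext_of_mon3 (i + j) (fun a ha => hΦd a i j ha) (fun a ha => hΨd a i j ha)
      fun m n p v => congrArg ev (hmon m n p v)
  exact DFunLike.congr_fun h a

/-- The indices `(i, j)` with `i` or `i + j` large have coefficient zero. -/
def BoundedFst (x : ℤ → ℤ → V) : Prop := ∃ N : ℤ, ∀ i j, (N < i ∨ N < i + j) → x i j = 0

/-- The indices `(i, j)` with `j` or `i + j` large have coefficient zero. -/
def BoundedSnd (x : ℤ → ℤ → V) : Prop := ∃ N : ℤ, ∀ i j, (N < j ∨ N < i + j) → x i j = 0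

theorem expandMuLambdaAux_apply (a : Series3 F V) (i j : ℤ) : expandMuLambdaAux a i j =
    ∑ᶠ q : ℤ × ℕ, (Ring.choose q.1 q.2 : ℤ) • a.1 (i - q.2) (j - q.1 + q.2) q.1 := rfl

theorem expandLambdaMuAux_apply (a : Series3 F V) (i j : ℤ) : expandLambdaMuAux a i j =
    ∑ᶠ q : ℤ × ℕ, (Ring.choose q.1 q.2 : ℤ) • a.1 (i - q.1 + q.2) (j - q.2) q.1 := rfl

theorem expandLambdaNuAux_apply (a : Series3 F V) (i j : ℤ) : expandLambdaNuAux a i j =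
    ∑ᶠ q : ℤ × ℕ, ((Ring.choose q.1 q.2 : ℤ) * ((q.1 - q.2).negOnePow : ℤ)) •
      a.1 (i - q.1 + q.2) q.1 (j - q.2) := rfl

/-- The first two expansions are mirror images, so properties of one transfer to the other by this
definitional identity. -/
theorem expandLambdaMuAux_swap12 (a : Series3 F V) (i j : ℤ) :
    expandLambdaMuAux (swap12 a) i j = expandMuLambdaAux a j i := rfl

theorem expandMuLambdaAux_swap12 (a : Series3 F V) (i j : ℤ) :
    expandMuLambdaAux (swap12 a) i j = expandLambdaMuAux a j i := rfl

theorem boundedSnd_expandMuLambdaAux (a : Series3 F V) : BoundedSnd (expandMuLambdaAux a) := by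
  obtain ⟨N, hN⟩ := a.2
  refine ⟨max (2 * N) (3 * N), fun i j h => ?_⟩
  rw [expandMuLambdaAux_apply]
  exact finsum_eq_zero_of_forall_eq_zero fun q => by rw [hN _ _ _ (by omega), smul_zero]

theorem boundedFst_expandLambdaMuAux (a : Series3 F V) : BoundedFst (expandLambdaMuAux a) := by
  obtain ⟨N, hN⟩ := a.2
  refine ⟨max (2 * N) (3 * N), fun i j h => ?_⟩
  rw [expandLambdaMuAux_apply]
  exact finsum_eq_zero_of_forall_eq_zero fun q => by rw [hN _ _ _ (by omega), smul_zero]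

theorem boundedFst_expandLambdaNuAux (a : Series3 F V) : BoundedFst (expandLambdaNuAux a) := by
  obtain ⟨N, hN⟩ := a.2
  refine ⟨max (2 * N) (3 * N), fun i j h => ?_⟩
  rw [expandLambdaNuAux_apply]
  exact finsum_eq_zero_of_forall_eq_zero fun q => by rw [hN _ _ _ (by omega), smul_zero]

theorem expandMuLambdaAux_eq_zero {a : Series3 F V} {i j : ℤ}
    (h : ∀ m n p, i + j ≤ m + n + p → a.1 m n p = 0) : expandMuLambdaAux a i j = 0 :=
  finsum_eq_zero_of_forall_eq_zero fun q => by rw [h _ _ _ (by omega), smul_zero]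

theorem expandLambdaMuAux_eq_zero {a : Series3 F V} {i j : ℤ}
    (h : ∀ m n p, i + j ≤ m + n + p → a.1 m n p = 0) : expandLambdaMuAux a i j = 0 :=
  finsum_eq_zero_of_forall_eq_zero fun q => by rw [h _ _ _ (by omega), smul_zero]

theorem expandLambdaNuAux_eq_zero {a : Series3 F V} {i j : ℤ}
    (h : ∀ m n p, i + j ≤ m + n + p → a.1 m n p = 0) : expandLambdaNuAux a i j = 0 :=
  finsum_eq_zero_of_forall_eq_zero fun q => by rw [h _ _ _ (by omega), smul_zero]

/-! The intertwining properties of the three expansions. -/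

theorem expandMuLambdaAux_mulL (r : ℤ) (a : Series3 F V) (i j : ℤ) :
    expandMuLambdaAux (mulL r a) i j = expandMuLambdaAux a (i - r) j := by
  rw [expandMuLambdaAux_apply, expandMuLambdaAux_apply]
  exact finsum_congr fun q => by rw [mulL_apply, sub_right_comm]

theorem expandMuLambdaAux_mulM (r : ℤ) (a : Series3 F V) (i j : ℤ) :
    expandMuLambdaAux (mulM r a) i j = expandMuLambdaAux a i (j - r) := by
  rw [expandMuLambdaAux_apply, expandMuLambdaAux_apply]
  exact finsum_congr fun q => by
    rw [mulM_apply, show j - q.1 + q.2 - r = j - r - q.1 + q.2 by ring]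

theorem mulN_one_eq (a : Series3 F V) : mulN 1 a = mulL 1 a + mulM 1 a + mulRel F V a := by
  rw [mulRel_eq]
  abel

/-- The expansion kills multiples of ν - λ - μ, so ν acts on its values as λ + μ. -/
theorem expandMuLambdaAux_mulN_one (a : Series3 F V) (i j : ℤ) :
    expandMuLambdaAux (mulN 1 a) i j =
      expandMuLambdaAux a (i - 1) j + expandMuLambdaAux a i (j - 1) := by
  rw [mulN_one_eq, map_add, map_add, expandMuLambdaAux_mulRel, add_zero, Pi.add_apply,
    Pi.add_apply, expandMuLambdaAux_mulL, expandMuLambdaAux_mulM]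

theorem expandLambdaMuAux_mulL (r : ℤ) (a : Series3 F V) (i j : ℤ) :
    expandLambdaMuAux (mulL r a) i j = expandLambdaMuAux a (i - r) j :=
  expandMuLambdaAux_mulM r (swap12 a) j i

theorem expandLambdaMuAux_mulM (r : ℤ) (a : Series3 F V) (i j : ℤ) :
    expandLambdaMuAux (mulM r a) i j = expandLambdaMuAux a i (j - r) :=
  expandMuLambdaAux_mulL r (swap12 a) j i

theorem expandLambdaMuAux_mulN_one (a : Series3 F V) (i j : ℤ) :
    expandLambdaMuAux (mulN 1 a) i j =
      expandLambdaMuAux a (i - 1) j + expandLambdaMuAux a i (j - 1) :=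
  (expandMuLambdaAux_mulN_one (swap12 a) j i).trans (add_comm _ _)

theorem expandLambdaNuAux_mulL (r : ℤ) (a : Series3 F V) (i j : ℤ) :
    expandLambdaNuAux (mulL r a) i j = expandLambdaNuAux a (i - r) j := by
  rw [expandLambdaNuAux_apply, expandLambdaNuAux_apply]
  exact finsum_congr fun q => by
    rw [mulL_apply, show i - q.1 + q.2 - r = i - r - q.1 + q.2 by ring]

theorem expandLambdaNuAux_mulN (r : ℤ) (a : Series3 F V) (i j : ℤ) :
    expandLambdaNuAux (mulN r a) i j = expandLambdaNuAux a i (j - r) := by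
  rw [expandLambdaNuAux_apply, expandLambdaNuAux_apply]
  exact finsum_congr fun q => by rw [mulN_apply, sub_right_comm]

theorem expandLambdaNuAux_mulM_one (a : Series3 F V) (i j : ℤ) :
    expandLambdaNuAux (mulM 1 a) i j =
      expandLambdaNuAux a i (j - 1) - expandLambdaNuAux a (i - 1) j := by
  have h : mulM 1 a = mulN 1 a - mulL 1 a - mulRel F V a := by
    rw [mulRel_eq]
    abel
  rw [h, map_sub, map_sub, expandLambdaNuAux_mulRel, sub_zero, Pi.sub_apply,
    Pi.sub_apply, expandLambdaNuAux_mulL, expandLambdaNuAux_mulN]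

theorem expandMuLambdaAux_map3 (φ : V →+ V') (a : Series3 F V) (i j : ℤ) :
    expandMuLambdaAux (map3 φ a : Series3 F V') i j = φ (expandMuLambdaAux a i j) := by
  obtain ⟨N, hN⟩ := a.2
  rw [expandMuLambdaAux_apply, expandMuLambdaAux_apply, AddMonoidHom.map_finsum]
  · exact finsum_congr fun q => by rw [map3_apply, map_zsmul]
  · exact support_finite (G := fun p k => a.1 (i - k) (j - p + k) p) (N := N) (c := j)
      (fun p k h => hN _ _ _ (by tauto)) fun p k => Ring.choose p k

theorem expandLambdaMuAux_map3 (φ : V →+ V') (a : Series3 F V) (i j : ℤ) :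
    expandLambdaMuAux (map3 φ a : Series3 F V') i j = φ (expandLambdaMuAux a i j) :=
  expandMuLambdaAux_map3 φ (swap12 a) j i

theorem expandLambdaNuAux_map3 (φ : V →+ V') (a : Series3 F V) (i j : ℤ) :
    expandLambdaNuAux (map3 φ a : Series3 F V') i j = φ (expandLambdaNuAux a i j) := by
  obtain ⟨N, hN⟩ := a.2
  rw [expandLambdaNuAux_apply, expandLambdaNuAux_apply, AddMonoidHom.map_finsum]
  · exact finsum_congr fun q => by rw [map3_apply, map_zsmul]
  · exact support_finite (G := fun p k => a.1 (i - p + k) p (j - k)) (N := N) (c := i)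
      (fun p k h => hN _ _ _ (by tauto)) fun p k => Ring.choose p k * ((p - k).negOnePow : ℤ)

/-- The expansion of a series not involving `ν`. -/
theorem expandMuLambdaAux_of_third {a : Series3 F V} (h : ∀ m n p, p ≠ 0 → a.1 m n p = 0)
    (i j : ℤ) : expandMuLambdaAux a i j = a.1 i j 0 := by
  rw [expandMuLambdaAux_apply, finsum_eq_single _ ((0, 0) : ℤ × ℕ)]
  · simp
  · rintro ⟨p, k⟩ hpk
    by_cases hp : p = 0
    · subst hp
      have hk : 0 < k := Nat.pos_of_ne_zero fun hk => hpk (by rw [hk])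
      rw [Ring.choose_zero_pos ℤ hk, zero_smul]
    · rw [h _ _ _ hp, smul_zero]

theorem expandLambdaMuAux_of_third {a : Series3 F V} (h : ∀ m n p, p ≠ 0 → a.1 m n p = 0)
    (i j : ℤ) : expandLambdaMuAux a i j = a.1 i j 0 :=
  expandMuLambdaAux_of_third (a := swap12 a) (fun m n p hp => h n m p hp) j i

theorem expandLambdaNuAux_of_second {a : Series3 F V} (h : ∀ m n p, n ≠ 0 → a.1 m n p = 0)
    (i j : ℤ) : expandLambdaNuAux a i j = a.1 i 0 j := by
  rw [expandLambdaNuAux_apply, finsum_eq_single _ ((0, 0) : ℤ × ℕ)]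
  · simp
  · rintro ⟨p, k⟩ hpk
    by_cases hp : p = 0
    · subst hp
      have hk : 0 < k := Nat.pos_of_ne_zero fun hk => hpk (by rw [hk])
      rw [Ring.choose_zero_pos ℤ hk, zero_mul, zero_smul]
    · rw [h _ _ _ hp, smul_zero]

end ThreeVariables

/-! ### Substitutions in three-variable series -/

section Substitution

variable {F V : Type*} [CommRing F] [AddCommGroup V] [Module F V] (θ : V →+ V)

/-- The substitution `ν ↦ -ν - θ`, with `θ` acting on the coefficients. -/
noncomputable def adjThird : Series3 F V →+ Series3 F V :=
  mapThird (adjHom θ) (boundedDegree_adjHom θ)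

theorem adjThird_mulN_one (a : Series3 F V) :
    adjThird θ (mulN 1 a) = -(mulN 1 (adjThird θ a) + map3 θ (adjThird θ a)) :=
  Series3.ext fun m n p => by
    rw [adjThird, mapThird_apply, toSeries_mulN, adjHom_lamMul_one, lcoeff_neg, lcoeff_shiftStep]
    rfl

theorem adjThird_map3 (a : Series3 F V) :
    adjThird θ (map3 θ a) = (map3 θ (adjThird θ a) : Series3 F V) :=
  Series3.ext fun m n p => by
    rw [adjThird, mapThird_apply, toSeries_map3, ← mapCoeff_adjHom fun _ => rfl]
    rfl

/-- The substitution `μ ↦ -ν - θ`, `ν ↦ -μ - θ`, with `θ` acting on the coefficients. -/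
noncomputable def reflect (a : Series3 F V) : Series3 F V :=
  adjThird θ (swap23 (adjThird θ a))

theorem reflect_add (a b : Series3 F V) : reflect θ (a + b) = reflect θ a + reflect θ b := by
  simp only [reflect, map_add]

theorem reflect_sub (a b : Series3 F V) : reflect θ (a - b) = reflect θ a - reflect θ b := by
  simp only [reflect, map_sub]

theorem reflect_mulL (a : Series3 F V) : reflect θ (mulL 1 a) = mulL 1 (reflect θ a) := rfl

theorem reflect_mulM (a : Series3 F V) :
    reflect θ (mulM 1 a) = -(mulN 1 (reflect θ a) + map3 θ (reflect θ a)) :=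
  adjThird_mulN_one θ (swap23 (adjThird θ a))

theorem reflect_mulN (a : Series3 F V) :
    reflect θ (mulN 1 a) = -(mulM 1 (reflect θ a) + map3 θ (reflect θ a)) := by
  rw [reflect, adjThird_mulN_one, map_neg, map_neg, map_add, map_add]
  congr 2
  exact adjThird_map3 θ (swap23 (adjThird θ a))

/-- The substitution fixes λ and sends ν - μ to (-μ - θ) - (-ν - θ) = ν - μ. It therefore respects
the relation defining `Vlm`. -/
theorem reflect_mulRel (a : Series3 F V) :
    reflect θ (mulRel F V a) = mulRel F V (reflect θ a) := by
  rw [mulRel_eq, reflect_sub, reflect_sub, reflect_mulL, reflect_mulM, reflect_mulN, mulRel_eq]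
  abel

theorem adjThird_const (v : V) :
    adjThird θ (mon3 0 0 0 v : Series3 F V) = mon3 0 0 0 v :=
  Series3.ext fun m n p => by
    have h : ((mon3 0 0 0 v : Series3 F V).1 m n) =
        lcoeff (monom 0 (if m = 0 ∧ n = 0 then v else 0)) := by
      funext p
      rw [mon3_apply, lcoeff_monom]
      split_ifs <;> tauto
    rw [adjThird, mapThird_apply, h, toSeries_lcoeff, adjHom_monom_zero, ← h]

theorem reflect_const (v : V) :
    reflect θ (mon3 0 0 0 v : Series3 F V) = mon3 0 0 0 v := by
  have h : swap23 (mon3 0 0 0 v : Series3 F V) = mon3 0 0 0 v :=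
    Series3.ext fun m n p => by
      change (mon3 0 0 0 v : Series3 F V).1 m p n = _
      rw [mon3_apply, mon3_apply]
      exact if_congr (by tauto) rfl rfl
  rw [reflect, adjThird_const, h, adjThird_const]

theorem adjThird_eq_zero {a : Series3 F V} {d : ℤ}
    (h : ∀ m n p, d ≤ m + n + p → a.1 m n p = 0) (m n p : ℤ) (hd : d ≤ m + n + p) :
    (adjThird θ a).1 m n p = 0 :=
  vanishAbove_adjHom θ (vanishAbove_toSeries (N := d - m - n - 1)
    fun p hp => h m n p (by omega)) p (by omega)

theorem reflect_eq_zero {a : Series3 F V} {d : ℤ}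
    (h : ∀ m n p, d ≤ m + n + p → a.1 m n p = 0) (m n p : ℤ) (hd : d ≤ m + n + p) :
    (reflect θ a).1 m n p = 0 :=
  adjThird_eq_zero θ (a := swap23 (adjThird θ a))
    (fun m n p hd => adjThird_eq_zero θ h m p n (by omega)) m n p hd

/-- Descending induction on the first exponent, starting where both families vanish. -/
theorem BoundedFst.eq_of_step {x y : ℤ → ℤ → V} (hx : BoundedFst x) (hy : BoundedFst y)
    (h : ∀ i, (∀ j, x i j = y i j) → ∀ j, x (i - 1) j = y (i - 1) j) : x = y := by
  obtain ⟨M, hM⟩ := hx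
  obtain ⟨N, hN⟩ := hy
  have key : ∀ n : ℕ, ∀ i, max M N - n < i → ∀ j, x i j = y i j := by
    intro n
    induction n with
    | zero => exact fun i hi j => by rw [hM _ _ (by omega), hN _ _ (by omega)]
    | succ n ih =>
      intro i hi j
      have := h (i + 1) (ih (i + 1) (by push_cast at hi; omega)) j
      rwa [add_sub_cancel_right] at this
  funext i j
  exact key (max M N - i + 1).toNat i (by omega) j

theorem BoundedSnd.swap {x : ℤ → ℤ → V} (hx : BoundedSnd x) : BoundedFst fun i j => x j i := by
  obtain ⟨N, hN⟩ := hx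
  exact ⟨N, fun i j h => hN j i (by omega)⟩

theorem BoundedSnd.eq_of_step {x y : ℤ → ℤ → V} (hx : BoundedSnd x) (hy : BoundedSnd y)
    (h : ∀ j, (∀ i, x i j = y i j) → ∀ i, x i (j - 1) = y i (j - 1)) : x = y := by
  have := hx.swap.eq_of_step hy.swap h
  funext i j
  exact congrFun (congrFun this j) i

theorem BoundedFst.row {x : ℤ → ℤ → V} (hx : BoundedFst x) (i : ℤ) :
    ∃ N : ℤ, ∀ j, N < j → x i j = 0 := by
  obtain ⟨N, hN⟩ := hx
  exact ⟨N - i, fun j hj => hN i j (by omega)⟩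

theorem BoundedFst.eq_of_shiftStep {x y : ℤ → ℤ → V} (hx : BoundedFst x) (hy : BoundedFst y)
    (h : ∀ i j, x i (j - 1) + θ (x i j) = y i (j - 1) + θ (y i j)) : x = y := by
  funext i
  obtain ⟨M, hM⟩ := hx.row i
  obtain ⟨N, hN⟩ := hy.row i
  have : toSeries (x i) = toSeries (y i) := shiftStep_injective θ (ext_lcoeff fun j => by
    simp only [lcoeff_shiftStep, lcoeff_toSeries hM, lcoeff_toSeries hN, h])
  funext j
  rw [← lcoeff_toSeries hM, this, lcoeff_toSeries hN]

/-- The substitution `μ ↦ -μ - θ` in the second variable. -/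
noncomputable def adjSecond (x : ℤ → ℤ → V) (i j : ℤ) : V :=
  lcoeff (adjHom θ (toSeries (x i))) j

theorem adjSecond_add {x y : ℤ → ℤ → V} (hx : BoundedFst x) (hy : BoundedFst y) :
    adjSecond θ (x + y) = adjSecond θ x + adjSecond θ y := by
  funext i j
  obtain ⟨M, hM⟩ := hx.row i
  obtain ⟨N, hN⟩ := hy.row i
  have h := toSeries_add hM hN
  change lcoeff (adjHom θ (toSeries fun j => x i j + y i j)) j = _
  rw [h, map_add]
  rfl

theorem adjSecond_neg {x : ℤ → ℤ → V} (hx : BoundedFst x) :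
    adjSecond θ (-x) = -adjSecond θ x := by
  funext i j
  obtain ⟨M, hM⟩ := hx.row i
  have h := toSeries_map hM (negAddMonoidHom : V →+ V)
  change lcoeff (adjHom θ (toSeries fun j => -(x i j))) j = _
  have h' : toSeries (fun j => -(x i j)) = -toSeries (x i) := h.trans (ext_lcoeff fun _ => rfl)
  rw [h', map_neg]
  rfl

theorem adjSecond_shift {x : ℤ → ℤ → V} (hx : BoundedFst x) (i j : ℤ) :
    adjSecond θ (fun i j => x i (j - 1)) i j =
      -(adjSecond θ x i (j - 1) + θ (adjSecond θ x i j)) := by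
  obtain ⟨M, hM⟩ := hx.row i
  rw [adjSecond, toSeries_shift hM, adjHom_lamMul_one, lcoeff_neg, lcoeff_shiftStep]
  rfl

theorem boundedFst_adjSecond {x : ℤ → ℤ → V} (hx : BoundedFst x) :
    BoundedFst (adjSecond θ x) := by
  obtain ⟨N, hN⟩ := hx
  refine ⟨N, fun i j h => ?_⟩
  by_cases hi : N < i
  · have : x i = fun _ => 0 := funext fun j => hN i j (Or.inl hi)
    rw [adjSecond, this, toSeries_zero, map_zero, lcoeff_zero]
  · exact vanishAbove_adjHom θ (vanishAbove_toSeries (N := N - i)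
      fun j hj => hN i j (by omega)) j (by omega)

theorem adjSecond_eq_zero {x : ℤ → ℤ → V} {d : ℤ} (h : ∀ i j, d ≤ i + j → x i j = 0)
    (i j : ℤ) (hd : d ≤ i + j) : adjSecond θ x i j = 0 :=
  vanishAbove_adjHom θ (vanishAbove_toSeries (N := d - i - 1) fun j hj => h i j (by omega)) j
    (by omega)

theorem adjSecond_adjSecond {x : ℤ → ℤ → V} (hx : BoundedFst x) :
    adjSecond θ (adjSecond θ x) = x := by
  funext i j
  obtain ⟨M, hM⟩ := hx.row i
  change lcoeff (adjHom θ (toSeries (lcoeff (adjHom θ (toSeries (x i)))))) j = x i j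
  rw [toSeries_lcoeff, adjHom_adjHom, lcoeff_toSeries hM]

theorem adjSecond_const (x : ℤ → ℤ → V) (v : V)
    (hx : ∀ i j, x i j = if i = 0 ∧ j = 0 then v else 0) : adjSecond θ x = x := by
  funext i j
  have h : x i = lcoeff (monom 0 (if i = 0 then v else 0)) := by
    funext j
    rw [hx, lcoeff_monom]
    split_ifs <;> tauto
  rw [adjSecond, h, toSeries_lcoeff, adjHom_monom_zero]

theorem expandMuLambdaAux_const (v : V) (i j : ℤ) :
    expandMuLambdaAux (mon3 0 0 0 v : Series3 F V) i j = if i = 0 ∧ j = 0 then v else 0 := by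
  rw [expandMuLambdaAux_of_third fun m n p hp => by rw [mon3_apply, if_neg (by tauto)],
    mon3_apply]
  exact if_congr (by tauto) rfl rfl

theorem expandLambdaMuAux_const (v : V) (i j : ℤ) :
    expandLambdaMuAux (mon3 0 0 0 v : Series3 F V) i j = if i = 0 ∧ j = 0 then v else 0 := by
  rw [expandLambdaMuAux_of_third fun m n p hp => by rw [mon3_apply, if_neg (by tauto)],
    mon3_apply]
  exact if_congr (by tauto) rfl rfl

theorem expandLambdaNuAux_const (v : V) (i j : ℤ) :
    expandLambdaNuAux (mon3 0 0 0 v : Series3 F V) i j = if i = 0 ∧ j = 0 then v else 0 := by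
  rw [expandLambdaNuAux_of_second fun m n p hp => by rw [mon3_apply, if_neg (by tauto)],
    mon3_apply]
  exact if_congr (by tauto) rfl rfl

/-- The substitution exchanges μ and ν up to sign and θ, hence it turns the region where ν is small
compared with λ into the one where μ is small. The proof compares the effect of multiplication by
each variable on both sides and the values on constants. -/
theorem expandLambdaMuAux_reflect (a : Series3 F V) :
    expandLambdaMuAux (reflect θ a) = adjSecond θ (expandLambdaNuAux a) := by
  refine Series3.hom_ext_of_intertwine (V' := V)
    (Φ := AddMonoidHom.mk' (fun a => expandLambdaMuAux (reflect θ a)) fun a b => by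
      rw [reflect_add, map_add])
    (Ψ := AddMonoidHom.mk' (fun a => adjSecond θ (expandLambdaNuAux a)) fun a b => by
      rw [map_add, adjSecond_add θ (boundedFst_expandLambdaNuAux a)
        (boundedFst_expandLambdaNuAux b)])
    BoundedFst
    (e₁ := fun x i j => x (i - 1) j)
    -- Under reflection μ becomes -(ν + θ), that is -(λ + μ + θ) in the target; on the other side μ
    -- = ν - λ becomes -(μ + θ) - λ.
    (e₂ := fun x i j => -(x (i - 1) j + (x i (j - 1) + θ (x i j))))
    (e₃ := fun x i j => -(x i (j - 1) + θ (x i j)))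
    (fun a => boundedFst_expandLambdaMuAux _)
    (fun a => boundedFst_adjSecond θ (boundedFst_expandLambdaNuAux a))
    ?_ ?_ ?_ ?_ ?_ ?_ ?_ ?_ ?_ ?_ ?_ ?_ a
  · intro x y hx hy h
    exact hx.eq_of_step hy fun i _ j => congrFun (congrFun h i) j
  · intro x y hx hy h
    refine hx.eq_of_step hy fun i hi j => ?_
    have := congrFun (congrFun h i) j
    simpa [hi] using this
  · intro x y hx hy h
    exact hx.eq_of_shiftStep θ hy fun i j => neg_injective (congrFun (congrFun h i) j)
  · intro a
    funext i j
    simp only [AddMonoidHom.mk'_apply, reflect_mulL, expandLambdaMuAux_mulL]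
  · intro a
    funext i j
    simp only [AddMonoidHom.mk'_apply]
    rw [adjSecond, adjSecond]
    congr 3
    funext j
    rw [expandLambdaNuAux_mulL]
  · intro a
    funext i j
    simp only [AddMonoidHom.mk'_apply, reflect_mulM, map_neg, map_add, Pi.neg_apply, Pi.add_apply,
      expandLambdaMuAux_mulN_one, expandLambdaMuAux_map3, add_assoc]
  · intro a
    funext i j
    simp only [AddMonoidHom.mk'_apply]
    have hb := boundedFst_expandLambdaNuAux a
    have h1 : BoundedFst fun i j => expandLambdaNuAux a i (j - 1) := by
      obtain ⟨N, hN⟩ := hb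
      exact ⟨N + 1, fun i j h => hN _ _ (by omega)⟩
    have h2 : BoundedFst fun i j => expandLambdaNuAux a (i - 1) j := by
      obtain ⟨N, hN⟩ := hb
      exact ⟨N + 1, fun i j h => hN _ _ (by omega)⟩
    have h2' : BoundedFst (-fun i j => expandLambdaNuAux a (i - 1) j) := by
      obtain ⟨N, hN⟩ := h2
      exact ⟨N, fun i j h => neg_eq_zero.2 (hN _ _ (by omega))⟩
    have h3 : expandLambdaNuAux (mulM 1 a) = (fun i j => expandLambdaNuAux a i (j - 1)) +
        -(fun i j => expandLambdaNuAux a (i - 1) j) := by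
      funext i j
      rw [expandLambdaNuAux_mulM_one, sub_eq_add_neg]
      rfl
    rw [h3, adjSecond_add θ h1 h2', adjSecond_neg θ h2, Pi.add_apply, Pi.add_apply,
      adjSecond_shift θ hb, add_comm, neg_add (adjSecond θ (expandLambdaNuAux a) (i - 1) j)]
    rfl
  · intro a
    funext i j
    simp only [AddMonoidHom.mk'_apply, reflect_mulN, map_neg, map_add, Pi.neg_apply, Pi.add_apply,
      expandLambdaMuAux_mulM, expandLambdaMuAux_map3]
  · intro a
    funext i j
    simp only [AddMonoidHom.mk'_apply]
    have h3 : expandLambdaNuAux (mulN 1 a) = (fun i j => expandLambdaNuAux a i (j - 1)) := by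
      funext i j
      rw [expandLambdaNuAux_mulN]
    rw [h3, adjSecond_shift θ (boundedFst_expandLambdaNuAux a)]
  · intro a i j h
    exact expandLambdaMuAux_eq_zero (reflect_eq_zero θ h)
  · intro a i j h
    exact adjSecond_eq_zero θ (x := expandLambdaNuAux a) (d := i + j)
      (fun i' j' h' => expandLambdaNuAux_eq_zero fun m n p h'' => h m n p (by omega)) i j le_rfl
  · intro v
    simp only [AddMonoidHom.mk'_apply]
    rw [reflect_const, adjSecond_const θ _ v (expandLambdaNuAux_const v)]
    funext i j
    rw [expandLambdaMuAux_const, expandLambdaNuAux_const]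

theorem swap23_swap23 (a : Series3 F V) : swap23 (swap23 a) = a := rfl

theorem adjThird_adjThird (a : Series3 F V) : adjThird θ (adjThird θ a) = a :=
  Series3.ext fun m n p => by
    obtain ⟨N, hN⟩ := a.2
    rw [adjThird, mapThird_apply, toSeries_mapThird, adjHom_adjHom,
      lcoeff_toSeries (Series3.bound_third hN m n)]

theorem reflect_reflect (a : Series3 F V) : reflect θ (reflect θ a) = a := by
  rw [reflect, reflect, adjThird_adjThird, swap23_swap23, adjThird_adjThird]

/-- Both the reflection and the substitution in the second variable are involutions, so this is the
previous comparison read backwards. -/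
theorem expandLambdaNuAux_reflect (a : Series3 F V) :
    expandLambdaNuAux (reflect θ a) = adjSecond θ (expandLambdaMuAux a) := by
  rw [← reflect_reflect θ a, expandLambdaMuAux_reflect,
    adjSecond_adjSecond θ (boundedFst_expandLambdaNuAux _), reflect_reflect]

/-- The operator `λ + θ` on sequences of coefficients of powers of `λ`. -/
def twist : (ℤ → V) →+ (ℤ → V) where
  toFun w i := w (i - 1) + θ (w i)
  map_zero' := funext fun i => by simp
  map_add' v w := funext fun i => by
    simp only [Pi.add_apply, map_add]
    abel

theorem twist_apply (w : ℤ → V) (i : ℤ) : twist θ w i = w (i - 1) + θ (w i) := rfl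

theorem twist_iterate_eq_zero {w : ℤ → V} {N : ℤ} (hw : ∀ i, N < i → w i = 0) (k : ℕ) :
    ∀ i, N + k < i → (twist θ)^[k] w i = 0 := by
  induction k with
  | zero => simpa using hw
  | succ k ih =>
    intro i hi
    push_cast at hi
    rw [Function.iterate_succ_apply', twist_apply, ih _ (by omega), ih _ (by omega), map_zero,
      add_zero]

/-- The substitution `μ ↦ -λ - μ - θ` in the second variable. -/
noncomputable def adjTwist (x : ℤ → ℤ → V) (i j : ℤ) : V :=
  lcoeff (adjHom (twist θ) (toSeries fun j i => x i j)) j i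

theorem BoundedSnd.col {x : ℤ → ℤ → V} (hx : BoundedSnd x) :
    ∃ N : ℤ, ∀ j, N < j → (fun i => x i j) = 0 := by
  obtain ⟨N, hN⟩ := hx
  exact ⟨N, fun j hj => funext fun i => hN i j (Or.inl hj)⟩

theorem adjTwist_add {x y : ℤ → ℤ → V} (hx : BoundedSnd x) (hy : BoundedSnd y) :
    adjTwist θ (x + y) = adjTwist θ x + adjTwist θ y := by
  funext i j
  obtain ⟨M, hM⟩ := hx.col
  obtain ⟨N, hN⟩ := hy.col
  have h := toSeries_add hM hN
  change lcoeff (adjHom (twist θ) (toSeries fun j => (fun i => x i j) + fun i => y i j)) j i = _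
  rw [h, map_add]
  rfl

theorem adjTwist_shift_snd {x : ℤ → ℤ → V} (hx : BoundedSnd x) (i j : ℤ) :
    adjTwist θ (fun i j => x i (j - 1)) i j =
      -(adjTwist θ x i (j - 1) + (adjTwist θ x (i - 1) j + θ (adjTwist θ x i j))) := by
  obtain ⟨M, hM⟩ := hx.col
  have h := toSeries_shift hM 1
  change lcoeff (adjHom (twist θ) (toSeries fun j => (fun j i => x i j) (j - 1))) j i = _
  rw [h, adjHom_lamMul_one, lcoeff_neg, lcoeff_shiftStep]
  rfl

/-- Multiplication by the variable on sequences of coefficients. -/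
def shiftSeq : (ℤ → V) →+ (ℤ → V) where
  toFun w i := w (i - 1)
  map_zero' := rfl
  map_add' _ _ := rfl

theorem adjTwist_shift_fst {x : ℤ → ℤ → V} (hx : BoundedSnd x) (i j : ℤ) :
    adjTwist θ (fun i j => x (i - 1) j) i j = adjTwist θ x (i - 1) j := by
  obtain ⟨M, hM⟩ := hx.col
  have h := toSeries_map hM shiftSeq
  change lcoeff (adjHom (twist θ) (toSeries fun j => shiftSeq fun i => x i j)) j i = _
  rw [h, ← mapCoeff_adjHom (θ := twist θ) (θ' := twist θ) (φ := shiftSeq) fun _ => rfl]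
  rfl

/-- The substitution does not raise the total degree: each application of λ + θ raises the degree in
λ by at most one and is paid for by one power of μ. -/
theorem adjTwist_eq_zero {x : ℤ → ℤ → V} {N d : ℤ} (hN : ∀ i j, N < j → x i j = 0)
    (h : ∀ i j, d ≤ i + j → x i j = 0) (i j : ℤ) (hd : N < j ∨ d ≤ i + j) :
    adjTwist θ x i j = 0 := by
  have hN' : ∀ j, N < j → (fun i => x i j) = 0 := fun j hj => funext fun i => hN i j hj
  have hK : N < j + (N - j + 1).toNat := by omega
  rw [adjTwist, lcoeff_adjHom_eq_sum _ (vanishAbove_toSeries hN') j hK, Finset.sum_apply]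
  refine Finset.sum_eq_zero fun k hk => ?_
  rw [lcoeff_toSeries hN', Pi.smul_apply]
  rcases hd with hd | hd
  · rw [hN' _ (by omega), iterate_map_zero, Pi.zero_apply, smul_zero]
  · rw [twist_iterate_eq_zero θ (N := d - 1 - (j + k)) (fun i hi => h i _ (by omega)) k i (by omega),
      smul_zero]

theorem boundedSnd_adjTwist {x : ℤ → ℤ → V} (hx : BoundedSnd x) : BoundedSnd (adjTwist θ x) := by
  obtain ⟨N, hN⟩ := hx
  exact ⟨N, fun i j h => adjTwist_eq_zero θ (N := N) (d := N + 1) (fun i j h => hN i j (by omega))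
    (fun i j h => hN i j (by omega)) i j (by omega)⟩

theorem adjTwist_const (x : ℤ → ℤ → V) (v : V)
    (hx : ∀ i j, x i j = if i = 0 ∧ j = 0 then v else 0) : adjTwist θ x = x := by
  have h : (fun j i => x i j) = lcoeff (monom 0 fun i => if i = 0 then v else 0) := by
    funext j i
    rw [hx, lcoeff_monom]
    by_cases hj : j = 0 <;> simp [hj]
  funext i j
  rw [adjTwist, h, toSeries_lcoeff, adjHom_monom_zero, ← h]

/-- Here μ ↦ -ν - θ is expanded with ν = λ + μ, which keeps the region where λ is small compared
with μ. -/
theorem expandMuLambdaAux_reflect (a : Series3 F V) :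
    expandMuLambdaAux (reflect θ a) = adjTwist θ (expandMuLambdaAux a) := by
  refine Series3.hom_ext_of_intertwine (V' := V)
    (Φ := AddMonoidHom.mk' (fun a => expandMuLambdaAux (reflect θ a)) fun a b => by
      rw [reflect_add, map_add])
    (Ψ := AddMonoidHom.mk' (fun a => adjTwist θ (expandMuLambdaAux a)) fun a b => by
      rw [map_add, adjTwist_add θ (boundedSnd_expandMuLambdaAux a)
        (boundedSnd_expandMuLambdaAux b)])
    BoundedSnd
    (e₁ := fun x i j => x (i - 1) j)
    (e₂ := fun x i j => -(x i (j - 1) + (x (i - 1) j + θ (x i j))))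
    (e₃ := fun x i j => -(x i (j - 1) + θ (x i j)))
    (fun a => boundedSnd_expandMuLambdaAux _)
    (fun a => boundedSnd_adjTwist θ (boundedSnd_expandMuLambdaAux a))
    ?_ ?_ ?_ ?_ ?_ ?_ ?_ ?_ ?_ ?_ ?_ ?_ a
  · intro x y _ _ h
    funext i j
    have := congrFun (congrFun h (i + 1)) j
    simpa using this
  · intro x y hx hy h
    refine hx.eq_of_step hy fun j hj i => ?_
    have := congrFun (congrFun h i) j
    simpa [hj] using this
  · intro x y hx hy h
    refine hx.eq_of_step hy fun j hj i => ?_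
    have := congrFun (congrFun h i) j
    simpa [hj] using this
  · intro a
    funext i j
    simp only [AddMonoidHom.mk'_apply, reflect_mulL, expandMuLambdaAux_mulL]
  · intro a
    funext i j
    simp only [AddMonoidHom.mk'_apply]
    have h3 : expandMuLambdaAux (mulL 1 a) = fun i j => expandMuLambdaAux a (i - 1) j := by
      funext i j
      rw [expandMuLambdaAux_mulL]
    rw [h3, adjTwist_shift_fst θ (boundedSnd_expandMuLambdaAux a)]
  · intro a
    funext i j
    simp only [AddMonoidHom.mk'_apply, reflect_mulM, map_neg, map_add, Pi.neg_apply, Pi.add_apply,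
      expandMuLambdaAux_mulN_one, expandMuLambdaAux_map3]
    abel
  · intro a
    funext i j
    simp only [AddMonoidHom.mk'_apply]
    have h3 : expandMuLambdaAux (mulM 1 a) = fun i j => expandMuLambdaAux a i (j - 1) := by
      funext i j
      rw [expandMuLambdaAux_mulM]
    rw [h3, adjTwist_shift_snd θ (boundedSnd_expandMuLambdaAux a)]
  · intro a
    funext i j
    simp only [AddMonoidHom.mk'_apply, reflect_mulN, map_neg, map_add, Pi.neg_apply, Pi.add_apply,
      expandMuLambdaAux_mulM, expandMuLambdaAux_map3]
  · intro a
    funext i j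
    simp only [AddMonoidHom.mk'_apply]
    have hb := boundedSnd_expandMuLambdaAux a
    have h1 : BoundedSnd fun i j => expandMuLambdaAux a (i - 1) j := by
      obtain ⟨N, hN⟩ := hb
      exact ⟨N + 1, fun i j h => hN _ _ (by omega)⟩
    have h2 : BoundedSnd fun i j => expandMuLambdaAux a i (j - 1) := by
      obtain ⟨N, hN⟩ := hb
      exact ⟨N + 1, fun i j h => hN _ _ (by omega)⟩
    have h3 : expandMuLambdaAux (mulN 1 a) = (fun i j => expandMuLambdaAux a (i - 1) j) +
        fun i j => expandMuLambdaAux a i (j - 1) := by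
      funext i j
      rw [expandMuLambdaAux_mulN_one]
      rfl
    rw [h3, adjTwist_add θ h1 h2, Pi.add_apply, Pi.add_apply, adjTwist_shift_snd θ hb,
      adjTwist_shift_fst θ hb]
    abel
  · intro a i j h
    exact expandMuLambdaAux_eq_zero (reflect_eq_zero θ h)
  · intro a i j h
    obtain ⟨N, hN⟩ := boundedSnd_expandMuLambdaAux a
    exact adjTwist_eq_zero θ (x := expandMuLambdaAux a) (N := N) (d := i + j)
      (fun i' j' h' => hN i' j' (Or.inl h'))
      (fun i' j' h' => expandMuLambdaAux_eq_zero fun m n p h'' => h m n p (by omega)) i j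
      (Or.inr le_rfl)
  · intro v
    simp only [AddMonoidHom.mk'_apply]
    rw [reflect_const, adjTwist_const θ _ v (expandMuLambdaAux_const v)]

end Substitution

/-! ### The exchange of λ and μ in the expansion in λ and ν -/

section Exchange

variable {F V : Type*} [CommRing F] [AddCommGroup V] [Module F V]

/-- The substitution `λ ↦ ν - λ` in series in `λ` and `ν`. -/
noncomputable def subFst (x : ℤ → ℤ → V) (i j : ℤ) : V :=
  lcoeff (adjHom (-shiftSeq) (toSeries x)) i j

theorem BoundedFst.eventually {x : ℤ → ℤ → V} (hx : BoundedFst x) :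
    ∃ N : ℤ, ∀ i, N < i → x i = 0 := by
  obtain ⟨N, hN⟩ := hx
  exact ⟨N, fun i hi => funext fun j => hN i j (Or.inl hi)⟩

theorem subFst_add {x y : ℤ → ℤ → V} (hx : BoundedFst x) (hy : BoundedFst y) :
    subFst (x + y) = subFst x + subFst y := by
  funext i j
  obtain ⟨M, hM⟩ := hx.eventually
  obtain ⟨N, hN⟩ := hy.eventually
  have h := toSeries_add hM hN
  change lcoeff (adjHom (-shiftSeq) (toSeries fun i => x i + y i)) i j = _
  rw [h, map_add]
  rfl

theorem subFst_neg {x : ℤ → ℤ → V} (hx : BoundedFst x) : subFst (-x) = -subFst x := by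
  funext i j
  obtain ⟨M, hM⟩ := hx.eventually
  have h : toSeries (-x) = -toSeries x :=
    (toSeries_map hM (negAddMonoidHom : (ℤ → V) →+ (ℤ → V))).trans (ext_lcoeff fun _ => rfl)
  rw [subFst, h, map_neg]
  rfl

theorem subFst_shift_fst {x : ℤ → ℤ → V} (hx : BoundedFst x) (i j : ℤ) :
    subFst (fun i j => x (i - 1) j) i j = subFst x i (j - 1) - subFst x (i - 1) j := by
  obtain ⟨M, hM⟩ := hx.eventually
  have h := toSeries_shift hM 1
  change lcoeff (adjHom (-shiftSeq) (toSeries fun i => x (i - 1))) i j = _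
  rw [h, adjHom_lamMul_one, lcoeff_neg, lcoeff_shiftStep, Pi.neg_apply, Pi.add_apply, neg_add,
    add_comm]
  exact congrArg₂ (· + ·) (neg_neg (subFst x i (j - 1))) rfl |>.trans (sub_eq_add_neg _ _).symm

theorem subFst_shift_snd {x : ℤ → ℤ → V} (hx : BoundedFst x) (i j : ℤ) :
    subFst (fun i j => x i (j - 1)) i j = subFst x i (j - 1) := by
  obtain ⟨M, hM⟩ := hx.eventually
  have h := toSeries_map hM shiftSeq
  change lcoeff (adjHom (-shiftSeq) (toSeries fun i => shiftSeq (x i))) i j = _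
  rw [h, ← mapCoeff_adjHom (θ := -shiftSeq) (θ' := -shiftSeq) (φ := shiftSeq (V := V))
    fun w => map_neg shiftSeq (shiftSeq w)]
  rfl

theorem neg_shiftSeq_iterate (w : ℤ → V) (k : ℕ) (j : ℤ) :
    ((-shiftSeq : (ℤ → V) →+ (ℤ → V)) : (ℤ → V) → (ℤ → V))^[k] w j =
      ((k : ℤ).negOnePow : ℤ) • w (j - k) := by
  induction k generalizing j with
  | zero => simp
  | succ k ih =>
    rw [Function.iterate_succ_apply']
    change -(_ : ℤ → V) (j - 1) = _
    rw [ih, Nat.cast_succ, Int.negOnePow_succ, Units.val_neg, neg_smul, sub_sub, add_comm (1 : ℤ)]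

theorem subFst_eq_sum {x : ℤ → ℤ → V} {N : ℤ} (hN : ∀ i, N < i → x i = 0) (i j : ℤ) {K : ℕ}
    (hK : N < i + K) : subFst x i j = ∑ k ∈ Finset.range K,
      ((Ring.choose (i + k) k : ℤ) * (i.negOnePow : ℤ)) • x (i + k) (j - k) := by
  rw [subFst, lcoeff_adjHom_eq_sum _ (vanishAbove_toSeries hN) i hK, Finset.sum_apply]
  refine Finset.sum_congr rfl fun k _ => ?_
  -- The sign (-1)^(i+k) of the adjoint and the sign (-1)^k of the iterates combine to (-1)^i.
  rw [lcoeff_toSeries hN, Pi.smul_apply, neg_shiftSeq_iterate, smul_smul, mul_assoc,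
    ← Units.val_mul, Int.negOnePow_add, mul_assoc, Int.units_mul_self, mul_one]

theorem subFst_eq_zero {x : ℤ → ℤ → V} {N d : ℤ} (hN : ∀ i, N < i → x i = 0)
    (h : ∀ i j, d ≤ i + j → x i j = 0) (i j : ℤ) (hd : N < i ∨ d ≤ i + j) :
    subFst x i j = 0 := by
  have hK : N < i + (N - i + 1).toNat := by omega
  rw [subFst_eq_sum hN i j hK]
  refine Finset.sum_eq_zero fun k _ => ?_
  rcases hd with hd | hd
  · rw [hN _ (by omega), Pi.zero_apply, smul_zero]
  · rw [h _ _ (by omega), smul_zero]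

theorem boundedFst_subFst {x : ℤ → ℤ → V} (hx : BoundedFst x) : BoundedFst (subFst x) := by
  obtain ⟨N, hN⟩ := hx
  exact ⟨N, fun i j h => subFst_eq_zero (N := N) (d := N + 1)
    (fun i h => funext fun j => hN i j (Or.inl h)) (fun i j h => hN i j (by omega)) i j (by omega)⟩

theorem subFst_const (x : ℤ → ℤ → V) (v : V)
    (hx : ∀ i j, x i j = if i = 0 ∧ j = 0 then v else 0) : subFst x = x := by
  have h : x = lcoeff (monom 0 fun j => if j = 0 then v else 0) := by
    funext i j
    rw [hx, lcoeff_monom]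
    by_cases hi : i = 0 <;> simp [hi]
  funext i j
  rw [subFst]
  nth_rw 1 [h]
  rw [toSeries_lcoeff, adjHom_monom_zero, ← h]

/-- The exchange fixes ν and sends λ to μ = ν - λ. The latter is the adjoint substitution -λ - θ for
θ = multiplication by -ν. -/
theorem expandLambdaNuAux_swap12 (a : Series3 F V) :
    expandLambdaNuAux (swap12 a) = subFst (expandLambdaNuAux a) := by
  refine Series3.hom_ext_of_intertwine (V' := V)
    (Φ := AddMonoidHom.mk' (fun a => expandLambdaNuAux (swap12 a)) fun a b => by
      rw [map_add, map_add])
    (Ψ := AddMonoidHom.mk' (fun a => subFst (expandLambdaNuAux a)) fun a b => by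
      rw [map_add, subFst_add (boundedFst_expandLambdaNuAux a)
        (boundedFst_expandLambdaNuAux b)])
    BoundedFst
    (e₁ := fun x i j => x i (j - 1) - x (i - 1) j)
    (e₂ := fun x i j => x (i - 1) j)
    (e₃ := fun x i j => x i (j - 1))
    (fun a => boundedFst_expandLambdaNuAux _)
    (fun a => boundedFst_subFst (boundedFst_expandLambdaNuAux a))
    ?_ ?_ ?_ ?_ ?_ ?_ ?_ ?_ ?_ ?_ ?_ ?_ a
  · intro x y hx hy h
    refine hx.eq_of_step hy fun i hi j => ?_
    have := congrFun (congrFun h i) j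
    simpa [hi] using this
  · intro x y hx hy h
    exact hx.eq_of_step hy fun i _ j => congrFun (congrFun h i) j
  · intro x y _ _ h
    funext i j
    have := congrFun (congrFun h i) (j + 1)
    simpa using this
  · intro a
    funext i j
    exact expandLambdaNuAux_mulM_one (swap12 a) i j
  · intro a
    funext i j
    simp only [AddMonoidHom.mk'_apply]
    have h3 : expandLambdaNuAux (mulL 1 a) = fun i j => expandLambdaNuAux a (i - 1) j := by
      funext i j
      rw [expandLambdaNuAux_mulL]
    rw [h3, subFst_shift_fst (boundedFst_expandLambdaNuAux a)]
  · intro a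
    funext i j
    exact expandLambdaNuAux_mulL 1 (swap12 a) i j
  · intro a
    funext i j
    simp only [AddMonoidHom.mk'_apply]
    have hb := boundedFst_expandLambdaNuAux a
    have h1 : BoundedFst fun i j => expandLambdaNuAux a i (j - 1) := by
      obtain ⟨N, hN⟩ := hb
      exact ⟨N + 1, fun i j h => hN _ _ (by omega)⟩
    have h2 : BoundedFst fun i j => expandLambdaNuAux a (i - 1) j := by
      obtain ⟨N, hN⟩ := hb
      exact ⟨N + 1, fun i j h => hN _ _ (by omega)⟩
    have h2' : BoundedFst (-fun i j => expandLambdaNuAux a (i - 1) j) := by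
      obtain ⟨N, hN⟩ := h2
      exact ⟨N, fun i j h => neg_eq_zero.2 (hN _ _ (by omega))⟩
    have h3 : expandLambdaNuAux (mulM 1 a) = (fun i j => expandLambdaNuAux a i (j - 1)) +
        -(fun i j => expandLambdaNuAux a (i - 1) j) := by
      funext i j
      rw [expandLambdaNuAux_mulM_one, sub_eq_add_neg]
      rfl
    rw [h3, subFst_add h1 h2', subFst_neg h2, Pi.add_apply, Pi.add_apply, Pi.neg_apply,
      Pi.neg_apply, subFst_shift_fst hb, subFst_shift_snd hb]
    abel
  · intro a
    funext i j
    exact expandLambdaNuAux_mulN 1 (swap12 a) i j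
  · intro a
    funext i j
    simp only [AddMonoidHom.mk'_apply]
    have h3 : expandLambdaNuAux (mulN 1 a) = fun i j => expandLambdaNuAux a i (j - 1) := by
      funext i j
      rw [expandLambdaNuAux_mulN]
    rw [h3, subFst_shift_snd (boundedFst_expandLambdaNuAux a)]
  · intro a i j h
    exact expandLambdaNuAux_eq_zero fun m n p hd => h n m p (by omega)
  · intro a i j h
    obtain ⟨N, hN⟩ := (boundedFst_expandLambdaNuAux a).eventually
    exact subFst_eq_zero (x := expandLambdaNuAux a) (N := N) (d := i + j) hN
      (fun i' j' h' => expandLambdaNuAux_eq_zero fun m n p h'' => h m n p (by omega)) i j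
      (Or.inr le_rfl)
  · intro v
    simp only [AddMonoidHom.mk'_apply]
    rw [subFst_const _ v (expandLambdaNuAux_const v)]
    congr 1
    refine Series3.ext fun m n p => ?_
    change (mon3 0 0 0 v : Series3 F V).1 n m p = _
    rw [mon3_apply, mon3_apply]
    exact if_congr (by tauto) rfl rfl

end Exchange

/-! ### Differentiation of pseudodifferential operators along a non-local derivation -/

section DualNumbers

variable {F K : Type*} [CommRing F] [CommRing K] [Algebra F K] (δ : Derivation F K K)

/-- The dual numbers over `K` with infinitesimal part the sequences of coefficients of powers
of `λ`. -/
abbrev LambdaDual (K : Type*) [CommRing K] : Type _ := TrivSqZeroExt K (ℤ → K)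

/-- λ + ∂ is a derivation of the module of sequences over ∂, which is what makes `dualDer` a
derivation. -/
theorem twist_smul (v : K) (w : ℤ → K) :
    twist (derHom δ) (v • w) = v • twist (derHom δ) w + δ v • w := by
  funext i
  simp only [twist_apply, Pi.smul_apply, Pi.add_apply, smul_eq_mul, derHom_apply,
    Derivation.leibniz]
  ring

/-- The derivation of the dual numbers which is `∂` on `K` and `λ + ∂` on the infinitesimal
part. -/
noncomputable def dualDer : Derivation ℤ (LambdaDual K) (LambdaDual K) :=
  Derivation.mk' (AddMonoidHom.toIntLinearMap (AddMonoidHom.mk'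
    (fun r : LambdaDual K => (TrivSqZeroExt.inl (δ r.fst) +
      TrivSqZeroExt.inr (twist (derHom δ) r.snd) : LambdaDual K)) fun r s => by
    refine TrivSqZeroExt.ext ?_ ?_ <;> simp)) fun r s => by
    refine TrivSqZeroExt.ext ?_ ?_
    · simp [Derivation.leibniz]
    · simp only [AddMonoidHom.coe_toIntLinearMap, AddMonoidHom.mk'_apply, TrivSqZeroExt.snd_add,
        TrivSqZeroExt.snd_inl, TrivSqZeroExt.snd_inr, zero_add, TrivSqZeroExt.snd_mul, map_add,
        smul_eq_mul, TrivSqZeroExt.fst_add, TrivSqZeroExt.fst_inl, TrivSqZeroExt.fst_inr, add_zero,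
        op_smul_eq_smul, twist_smul]
      abel

theorem dualDer_apply (r : LambdaDual K) : dualDer δ r = TrivSqZeroExt.inl (δ r.fst) +
    TrivSqZeroExt.inr (twist (derHom δ) r.snd) := rfl

theorem dualDer_inl (v : K) : dualDer δ (TrivSqZeroExt.inl v) = TrivSqZeroExt.inl (δ v) := by
  simp [dualDer_apply]

theorem dualDer_inr (w : ℤ → K) :
    dualDer δ (TrivSqZeroExt.inr w) = TrivSqZeroExt.inr (twist (derHom δ) w) := by
  simp [dualDer_apply]

/-- The inclusion of the infinitesimal part. -/
def inrAddHom : (ℤ → K) →+ LambdaDual K where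
  toFun := TrivSqZeroExt.inr
  map_zero' := TrivSqZeroExt.inr_zero _
  map_add' := TrivSqZeroExt.inr_add _

/-- The inclusion of operators over `K` into those over the dual numbers. -/
noncomputable def inlSeries : LaurentSeries K →+ LaurentSeries (LambdaDual K) :=
  mapCoeff ((TrivSqZeroExt.inlHom K (ℤ → K) : K →+* LambdaDual K) : K →+ LambdaDual K)

theorem inlSeries_shiftApply (A B : LaurentSeries K) :
    inlSeries (shiftApply δ A B) = shiftApply (dualDer δ) (inlSeries A) (inlSeries B) :=
  mapCoeff_shiftApply δ (dualDer δ) (TrivSqZeroExt.inlHom K (ℤ → K))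
    (fun v => (dualDer_inl δ v).symm) A B

theorem inlSeries_one : inlSeries (1 : LaurentSeries K) = 1 := by
  rw [one_eq_monom, one_eq_monom, inlSeries, mapCoeff_monom]
  rfl

/-- The infinitesimal operator with a given expansion in `V((λ⁻¹))((μ⁻¹))`. -/
noncomputable def epsSeries : Series3 F K →+ LaurentSeries (LambdaDual K) where
  toFun a := mapCoeff inrAddHom (toSeries fun j i => expandMuLambdaAux a i j)
  map_zero' := by
    rw [map_zero]
    exact (congrArg _ toSeries_zero).trans (map_zero _)
  map_add' a b := by
    obtain ⟨M, hM⟩ := (boundedSnd_expandMuLambdaAux a).col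
    obtain ⟨N, hN⟩ := (boundedSnd_expandMuLambdaAux b).col
    rw [map_add, ← map_add (mapCoeff _), ← toSeries_add hM hN]
    rfl

theorem lcoeff_epsSeries (a : Series3 F K) (j : ℤ) :
    lcoeff (epsSeries a) j = TrivSqZeroExt.inr fun i => expandMuLambdaAux a i j := by
  obtain ⟨N, hN⟩ := (boundedSnd_expandMuLambdaAux a).col
  change inrAddHom (lcoeff (toSeries fun j i => expandMuLambdaAux a i j) j) = _
  rw [lcoeff_toSeries hN]
  rfl

/-- On the infinitesimal part the derivation is λ + ∂, so the adjoint is the substitution μ ↦ -λ - μ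
- ∂, realized on three-variable series by `reflect`. -/
theorem adjHom_epsSeries (a : Series3 F K) :
    adjHom (derHom (dualDer δ)) (epsSeries a) = epsSeries (reflect (derHom δ) a) := by
  refine ext_lcoeff fun j => ?_
  rw [lcoeff_epsSeries, expandMuLambdaAux_reflect]
  change lcoeff (adjHom _ (mapCoeff _ _)) j = _
  rw [← mapCoeff_adjHom (θ := twist (derHom δ)) fun w => (dualDer_inr δ w).symm]
  rfl

/-- The operator is μ + (λ + ∂) = ν + ∂. This is the reason for the third variable: negative powers
of this operator act within series in λ, μ, ν. -/
theorem shiftStep_epsSeries (a : Series3 F K) :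
    shiftStep (derHom (dualDer δ)) (epsSeries a) =
      epsSeries (mulN 1 a + map3 (derHom δ) a) := by
  refine ext_lcoeff fun j => ?_
  rw [lcoeff_shiftStep, lcoeff_epsSeries, lcoeff_epsSeries, lcoeff_epsSeries, derHom_apply,
    dualDer_inr, ← TrivSqZeroExt.inr_add]
  congr 1
  funext i
  rw [map_add, Pi.add_apply, twist_apply, Pi.add_apply, Pi.add_apply, expandMuLambdaAux_mulN_one,
    expandMuLambdaAux_map3]
  ring

theorem shiftPow_epsSeries (q : ℤ) (a : Series3 F K) :
    shiftPow (derHom (dualDer δ)) q (epsSeries a) = epsSeries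
      (mapThird (shiftPow (derHom δ) q) (boundedDegree_shiftPow _ q) a) := by
  refine eq_of_shiftStep (derHom (dualDer δ))
    (f := fun q => shiftPow (derHom (dualDer δ)) q (epsSeries a))
    (g := fun q => epsSeries (mapThird (shiftPow (derHom δ) q) (boundedDegree_shiftPow _ q) a))
    (fun q => shiftPow_add_one _ q _) (fun q => ?_) ?_ q
  · rw [shiftStep_epsSeries]
    congr 1
    refine Series3.ext fun m n p => ?_
    rw [mapThird_apply, shiftPow_add_one, lcoeff_shiftStep]
    rfl
  · rw [shiftPow_zero]
    congr 1
    refine Series3.ext fun m n p => ?_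
    obtain ⟨N, hN⟩ := a.2
    rw [mapThird_apply, shiftPow_zero, lcoeff_toSeries (Series3.bound_third hN m n)]

theorem smul_epsSeries (r : LambdaDual K) (a : Series3 F K) :
    r • epsSeries a = epsSeries (map3 (AddMonoidHom.mulLeft r.fst) a) := by
  refine ext_lcoeff fun j => ?_
  rw [lcoeff_smul, lcoeff_epsSeries, lcoeff_epsSeries, smul_eq_mul]
  refine TrivSqZeroExt.ext (by simp) ?_
  funext i
  simp [expandMuLambdaAux_map3]

/-- The coefficientwise projection of operators over the dual numbers to operators over `K`. -/
noncomputable def fstSeries : LaurentSeries (LambdaDual K) →+ LaurentSeries K :=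
  mapCoeff ((TrivSqZeroExt.fstHom K K (ℤ → K)).toRingHom : LambdaDual K →+ K)

/-- Because ε² = 0, only the finite part of `A` matters, and each of its powers of the derivation
acts as a power of ν + ∂ in the third variable alone. -/
theorem shiftApply_epsSeries (A : LaurentSeries (LambdaDual K)) (a : Series3 F K) :
    shiftApply (dualDer δ) A (epsSeries a) = epsSeries
      (mapThird (applyHom' δ (fstSeries A)) (boundedDegree_applyHom' δ _) a) := by
  let Ψ : LaurentSeries (LambdaDual K) →+ LaurentSeries (LambdaDual K) :=
    AddMonoidHom.mk' (fun A => epsSeries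
      (mapThird (applyHom' δ (fstSeries A)) (boundedDegree_applyHom' δ _) a)) fun A B => by
      rw [← map_add]
      congr 1
      refine Series3.ext fun m n p => ?_
      rw [mapThird_apply, applyHom'_apply, map_add, shiftApply_add_left]
      rfl
  have h : applyHom (dualDer δ) (epsSeries a) = Ψ := by
    refine hom_ext_of_monom (boundedDegree_applyHom _ _) ?_ fun q r => ?_
    · obtain ⟨N, hN⟩ := a.2
      -- A contribution to μ^j comes from μⁿ νᵖ with j ≤ n + p, where n ≤ N and p ≤ M + N.
      refine ⟨2 * N, fun A M hA j hj => ?_⟩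
      have hA' : VanishAbove M (fstSeries A) := fun k hk => by
        rw [fstSeries, lcoeff_mapCoeff, hA k hk, map_zero]
      change lcoeff (epsSeries _) j = 0
      rw [lcoeff_epsSeries, ← TrivSqZeroExt.inr_zero K]
      congr 1
      funext i
      refine finsum_eq_zero_of_forall_eq_zero fun s => ?_
      rw [mapThird_apply]
      by_cases hs : N < j - s.1 + s.2
      · have : a.1 (i - s.2) (j - s.1 + s.2) = fun _ => 0 :=
          funext fun p => hN _ _ _ (Or.inr (Or.inl hs))
        rw [this, toSeries_zero, map_zero, lcoeff_zero, smul_zero]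
      · have := vanishAbove_shiftApply δ hA' (vanishAbove_toSeries
          (Series3.bound_third hN (i - s.2) (j - s.1 + s.2))) s.1 (by omega)
        rw [applyHom'_apply, this, smul_zero]
    · rw [applyHom_apply, shiftApply_monom, shiftPow_epsSeries, smul_epsSeries]
      change _ = epsSeries _
      congr 1
      refine Series3.ext fun m n p => ?_
      rw [mapThird_apply, applyHom'_apply, fstSeries, mapCoeff_monom, shiftApply_monom]
      rfl
  exact DFunLike.congr_fun h A

/-- Right multiplication is the adjoint of left multiplication, and adjoints of infinitesimal
operators of this kind are again of this kind. -/
theorem exists_epsSeries_shiftApply (a : Series3 F K) (A : LaurentSeries (LambdaDual K)) :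
    ∃ b : Series3 F K, shiftApply (dualDer δ) (epsSeries a) A = epsSeries b := by
  rw [← adjHom_adjHom (derHom (dualDer δ)) (shiftApply (dualDer δ) (epsSeries a) A),
    adjHom_shiftApply, adjHom_epsSeries, shiftApply_epsSeries, adjHom_epsSeries]
  exact ⟨_, rfl⟩

end DualNumbers

/-! ### Rational operators under the infinitesimal lift -/

section NonlocalDerivation

variable {F V : Type*} [Field F] [CommRing V] [IsDomain V] [Algebra F V] (δ : Derivation F V V)

theorem toFrac_eq_mapCoeff (A : LaurentSeries V) :
    toFrac A = mapCoeff ((algebraMap V (FractionRing V) : V →+* _) : V →+ FractionRing V) A := rfl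

theorem toFrac_shiftApply (A B : LaurentSeries V) :
    toFrac (shiftApply δ A B) = shiftApply (fracDer δ) (toFrac A) (toFrac B) :=
  mapCoeff_shiftApply δ (fracDer δ) (algebraMap V (FractionRing V))
    (fun v => (fracDer_algebraMap δ v).symm) A B

/-- Derivations of the field of fractions are determined on the ring. -/
theorem fractionRing_derivation_ext {D D' : Derivation F (FractionRing V) (FractionRing V)}
    (h : ∀ v : V, D (algebraMap V _ v) = D' (algebraMap V _ v)) : D = D' := by
  ext x
  obtain ⟨p, q, hq, rfl⟩ := IsFractionRing.div_surjective (A := V) x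
  have hq0 : algebraMap V (FractionRing V) q ≠ 0 :=
    IsFractionRing.to_map_ne_zero_of_mem_nonZeroDivisors hq
  set y := algebraMap V (FractionRing V) p / algebraMap V (FractionRing V) q with hy
  have hp : y * algebraMap V (FractionRing V) q = algebraMap V (FractionRing V) p :=
    div_mul_cancel₀ _ hq0
  have h1 := congrArg D hp
  have h2 := congrArg D' hp
  rw [Derivation.leibniz, smul_eq_mul, smul_eq_mul] at h1 h2
  rw [h, h] at h1
  rw [← h2] at h1
  exact mul_left_cancel₀ hq0 (add_left_cancel h1)

variable {X : ℤ → Derivation F (FractionRing V) (FractionRing V)}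

variable (X) in
/-- The homomorphism `v ↦ v + ε ∑ Xₙ(v) λⁿ`. -/
noncomputable def dualLift : FractionRing V →+* LambdaDual (FractionRing V) where
  toFun v := TrivSqZeroExt.inl v + TrivSqZeroExt.inr fun n => X n v
  map_one' := by
    refine TrivSqZeroExt.ext (by simp) (funext fun n => by simp)
  map_zero' := by
    refine TrivSqZeroExt.ext (by simp) (funext fun n => by simp)
  map_add' v w := by
    refine TrivSqZeroExt.ext (by simp) (funext fun n => by simp)
  map_mul' v w := by
    refine TrivSqZeroExt.ext (by simp) (funext fun n => ?_)
    simp [add_comm]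

theorem dualLift_apply (v : FractionRing V) :
    dualLift X v = TrivSqZeroExt.inl v + TrivSqZeroExt.inr fun n => X n v := rfl

/-- The relation [Xₙ, ∂] = Xₙ₋₁ says exactly that ∑ Xₙ λⁿ intertwines ∂ with λ + ∂. -/
theorem dualLift_fracDer
    (hX : ∀ n v, X n (fracDer δ v) = X (n - 1) v + fracDer δ (X n v)) (v : FractionRing V) :
    dualLift X (fracDer δ v) = dualDer (fracDer δ) (dualLift X v) := by
  rw [dualLift_apply, dualLift_apply, map_add, dualDer_inl, dualDer_inr]
  congr 2
  funext n
  exact hX n v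

/-- The operators with this property contain the differential operators and are closed under sums,
negatives, products and inverses. -/
theorem exists_epsSeries_of_isRationalOverFrac
    (hX : ∀ n v, X n (fracDer δ v) = X (n - 1) v + fracDer δ (X n v))
    (hb : ∀ v : V, ∃ N, ∀ n, N < n → X n (algebraMap V _ v) = 0)
    {A : LaurentSeries (FractionRing V)} (hA : IsRationalOverFrac δ A) :
    ∃ a : Series3 F (FractionRing V),
      mapCoeff (dualLift X : FractionRing V →+ LambdaDual (FractionRing V)) A =
        inlSeries A + epsSeries a := by
  have hmul := mapCoeff_shiftApply (fracDer δ) (dualDer (fracDer δ)) (dualLift X)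
    (dualLift_fracDer δ hX)
  induction hA with
  | diffOp A hA =>
    obtain ⟨N, hN⟩ := exists_vanishAbove A
    choose b hb using hb
    -- A differential operator has finitely many coefficients, so one bound serves for the powers of
    -- λ in all of the series ∑ Xₘ(aₙ) λᵐ and for the powers of μ.
    have hbd : ∀ m n : ℤ, N.natAbs + ∑ k ∈ Finset.Icc 0 N, |b (lcoeff A k)| < m ∨
        (N.natAbs + ∑ k ∈ Finset.Icc 0 N, |b (lcoeff A k)| < n) →
        X m (algebraMap V _ (lcoeff A n)) = 0 := by
      intro m n h
      have hs : 0 ≤ ∑ k ∈ Finset.Icc 0 N, |b (lcoeff A k)| :=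
        Finset.sum_nonneg fun _ _ => abs_nonneg _
      by_cases hn : n ∈ Finset.Icc 0 N
      · have h1 := Finset.single_le_sum (f := fun k => |b (lcoeff A k)|)
          (fun _ _ => abs_nonneg _) hn
        have h2 := le_abs_self (b (lcoeff A n))
        rw [Finset.mem_Icc] at hn
        rcases h with h | h
        · exact hb _ m (by omega)
        · omega
      · rw [Finset.mem_Icc] at hn
        have : lcoeff A n = 0 := by
          by_cases h0 : n < 0
          · exact hA n h0
          · exact hN n (by omega)
        rw [this, map_zero, map_zero]
    -- For a differential operator the series is ∑ Xₘ(aₙ) λᵐ μⁿ, without ν.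
    refine ⟨⟨fun m n p => if p = 0 then X m (algebraMap V _ (lcoeff A n)) else 0,
      N.natAbs + ∑ k ∈ Finset.Icc 0 N, |b (lcoeff A k)|, fun m n p h => ?_⟩, ?_⟩
    · have hs : 0 ≤ ∑ k ∈ Finset.Icc 0 N, |b (lcoeff A k)| :=
        Finset.sum_nonneg fun _ _ => abs_nonneg _
      beta_reduce
      split_ifs with hp
      · exact hbd m n (by omega)
      · rfl
    · refine ext_lcoeff fun j => ?_
      rw [lcoeff_add, lcoeff_epsSeries]
      change dualLift X _ = TrivSqZeroExt.inl _ + _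
      rw [dualLift_apply]
      congr 2
      funext i
      rw [expandMuLambdaAux_of_third]
      · rfl
      · exact fun m n p hp => if_neg hp
  | add _ _ ihA ihB =>
    obtain ⟨a, ha⟩ := ihA
    obtain ⟨b, hb⟩ := ihB
    exact ⟨a + b, by rw [map_add, map_add, map_add, ha, hb, add_add_add_comm]⟩
  | neg _ ih =>
    obtain ⟨a, ha⟩ := ih
    exact ⟨-a, by rw [map_neg, map_neg, map_neg, ha, neg_add]⟩
  | @mul A B _ _ ihA ihB =>
    obtain ⟨a, ha⟩ := ihA
    obtain ⟨b, hb⟩ := ihB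
    -- (A + εa)(B + εb) = AB + A(εb) + (εa)(B + εb), and the last two products are infinitesimal
    -- operators of the required form.
    obtain ⟨c, hc⟩ := exists_epsSeries_shiftApply (fracDer δ) a (inlSeries B + epsSeries b)
    refine ⟨mapThird (applyHom' (fracDer δ) (fstSeries (inlSeries A)))
      (boundedDegree_applyHom' _ _) b + c, ?_⟩
    rw [hmul, ha, hb, shiftApply_add_left, hc, shiftApply_add_right, ← inlSeries_shiftApply,
      shiftApply_epsSeries, map_add, add_assoc]
  | @inv A B _ hAB hBA ih =>
    obtain ⟨a, ha⟩ := ih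
    set φB := mapCoeff (dualLift X : FractionRing V →+ LambdaDual (FractionRing V)) B with hφB
    obtain ⟨c, hc⟩ := exists_epsSeries_shiftApply (fracDer δ) a φB
    have h1 : shiftApply (dualDer (fracDer δ)) (inlSeries A + epsSeries a) φB = 1 := by
      rw [← ha, hφB, ← hmul, hAB, one_eq_monom, mapCoeff_monom, one_eq_monom]
      exact congrArg _ (map_one (dualLift X))
    rw [shiftApply_add_left, hc] at h1
    -- From A φ(B) + εc = 1, with εc = (εa) φ(B), left multiplication by B gives φ(B) = B - B(εc).
    have h2 := congrArg (shiftApply (dualDer (fracDer δ)) (inlSeries B)) h1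
    rw [shiftApply_add_right, ← shiftApply_assoc, ← inlSeries_shiftApply, hBA, inlSeries_one,
      one_shiftApply, shiftApply_one, shiftApply_epsSeries] at h2
    exact ⟨-_, by rw [map_neg, ← h2, add_neg_cancel_right]⟩

end NonlocalDerivation

/-! ### Admissibility -/

section Admissibility

variable {F V : Type*} [Field F] [CommRing V] [Algebra F V] {δ : Derivation F V V}
  {B : V → V → LaurentSeries V}

/-- The coefficients of `{a_λ ·}` are derivations. -/
def IsNonlocalBracket.rightDer (hB : IsNonlocalBracket δ B) (a : V) (n : ℤ) :
    Derivation F V V :=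
  Derivation.mk'
    { toFun := fun v => lcoeff (B a v) n
      map_add' := fun v w => by rw [(hB.linear_right a).map_add, lcoeff_add]
      map_smul' := fun c v => by
        rw [(hB.linear_right a).map_smul]
        rfl }
    fun v w => by
      change lcoeff (B a (v * w)) n = _
      rw [hB.leibniz_left]
      rfl

theorem IsNonlocalBracket.rightDer_apply (hB : IsNonlocalBracket δ B) (a : V) (n : ℤ) (v : V) :
    hB.rightDer a n v = lcoeff (B a v) n := rfl

theorem IsNonlocalBracket.lcoeff_der_right (hB : IsNonlocalBracket δ B) (a v : V) (n : ℤ) :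
    lcoeff (B a (δ v)) n = lcoeff (B a v) (n - 1) + δ (lcoeff (B a v) n) := by
  rw [hB.sesq_right, monom_one_mul, coeffDer_eq_mapCoeff, ← shiftStep_apply, lcoeff_shiftStep,
    derHom_apply]

variable [IsDomain V]

/-- Sesquilinearity in the second argument reads [Xₙ, ∂] = Xₙ₋₁ on `V`. Both sides are derivations,
so the relation extends to fractions. -/
theorem IsNonlocalBracket.fracDer_rightDer (hB : IsNonlocalBracket δ B) (a : V) (n : ℤ)
    (v : FractionRing V) : fracDer (hB.rightDer a n) (fracDer δ v) =
      fracDer (hB.rightDer a (n - 1)) v + fracDer δ (fracDer (hB.rightDer a n) v) := by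
  have h : ⁅fracDer (hB.rightDer a n), fracDer δ⁆ = fracDer (hB.rightDer a (n - 1)) :=
    fractionRing_derivation_ext fun w => by
      rw [Derivation.commutator_apply, fracDer_algebraMap, fracDer_algebraMap, fracDer_algebraMap,
        fracDer_algebraMap, fracDer_algebraMap, ← map_sub, hB.rightDer_apply, hB.rightDer_apply,
        hB.rightDer_apply, hB.lcoeff_der_right, add_sub_cancel_right]
  rw [← h, Derivation.commutator_apply, sub_add_cancel]

/-- A bracket applied to the coefficients of a rational operator gives an element of
`V_{λ,μ}`. -/
theorem IsNonlocalBracket.exists_expand_eq (hB : IsNonlocalBracket δ B) (a : V)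
    {P : LaurentSeries V} (hP : IsRationalOverFrac δ (toFrac P)) :
    ∃ x : Series3 F V, ∀ i j, expandMuLambdaAux x i j = lcoeff (B a (lcoeff P j)) i := by
  obtain ⟨y, hy⟩ := exists_epsSeries_of_isRationalOverFrac δ
    (X := fun n => fracDer (hB.rightDer a n)) (fun n v => hB.fracDer_rightDer a n v)
    (fun v => by
      obtain ⟨N, hN⟩ := exists_vanishAbove (B a v)
      exact ⟨N, fun n hn => by rw [fracDer_algebraMap, hB.rightDer_apply, hN n hn, map_zero]⟩) hP
  let ι : V →ₗ[F] FractionRing V := (IsScalarTower.toAlgHom F V (FractionRing V)).toLinearMap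
  -- The series found has coefficients in the fraction field. An F-linear retraction onto `V`,
  -- applied to its coefficients, commutes with the expansion and does not change the values, which
  -- already lie in `V`.
  obtain ⟨π, hπ⟩ := ι.exists_leftInverse_of_injective
    (LinearMap.ker_eq_bot.2 (IsFractionRing.injective V (FractionRing V)))
  refine ⟨map3 π.toAddMonoidHom y, fun i j => ?_⟩
  have h := congrArg (fun A => (lcoeff A j).snd i) hy
  simp only [lcoeff_add, lcoeff_epsSeries, TrivSqZeroExt.snd_add, TrivSqZeroExt.snd_inr] at h
  have h1 : (lcoeff (mapCoeff (dualLift (fun n => fracDer (hB.rightDer a n)) :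
      FractionRing V →+ LambdaDual (FractionRing V)) (toFrac P)) j).snd i =
      ι (lcoeff (B a (lcoeff P j)) i) := by
    change (dualLift _ (algebraMap V _ (lcoeff P j))).snd i = _
    rw [dualLift_apply, TrivSqZeroExt.snd_add, TrivSqZeroExt.snd_inl, TrivSqZeroExt.snd_inr,
      zero_add, fracDer_algebraMap]
    rfl
  have h2 : (lcoeff (inlSeries (toFrac P)) j).snd = 0 := rfl
  rw [h1, h2, zero_add] at h
  rw [expandMuLambdaAux_map3, ← h]
  exact DFunLike.congr_fun hπ _

variable {ℓ : ℕ} (S : DiffFunAlgebra F V ℓ) (H : Matrix (Fin ℓ) (Fin ℓ) (LaurentSeries V))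

theorem isRationalOverFrac_monom (n : ℕ) (v : V) :
    IsRationalOverFrac δ (toFrac (monom n v)) :=
  .diffOp _ fun k hk => by rw [lcoeff_monom, if_neg (by omega)]

theorem isRationalOverFrac_sum {ι : Type*} (s : Finset ι) (A : ι → LaurentSeries V)
    (h : ∀ i ∈ s, IsRationalOverFrac δ (toFrac (A i))) :
    IsRationalOverFrac δ (toFrac (∑ i ∈ s, A i)) := by
  classical
  induction s using Finset.induction_on with
  | empty => exact .diffOp _ fun _ _ => rfl
  | insert i s hi ih =>
    rw [Finset.sum_insert hi, toFrac_eq_mapCoeff, map_add]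
    exact (h i (Finset.mem_insert_self _ _)).add
      (ih fun j hj => h j (Finset.mem_insert_of_mem hj))

/-- The bracket is a finite sum of products of differential operators and entries of `H`, so {b_μ c}
is a rational operator in μ to which {a_λ ·} may be applied coefficientwise. -/
theorem isRationalOverFrac_masterBracket (hH : IsRationalMatrix S.der H) (f g : V) :
    IsRationalOverFrac S.der (toFrac (masterBracket S H f g)) := by
  obtain ⟨M, hM⟩ := S.exists_orderLT f
  obtain ⟨N, hN⟩ := S.exists_orderLT g
  rw [masterBracket_eq_sum S H hM hN]
  refine isRationalOverFrac_sum _ _ fun q _ => ?_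
  have h : masterTerm S H f g q = shiftApply S.der (monom (0 : ℕ) (S.pd q.2.1 q.2.2 g))
      (shiftApply S.der (monom q.2.2 1) (shiftApply S.der (H q.2.1 q.1.1)
        (shiftApply S.der (monom q.1.2 ((-1) ^ q.1.2))
          (monom (0 : ℕ) (S.pd q.1.1 q.1.2 f))))) := by
    rw [Nat.cast_zero, shiftApply_monom S.der 0, shiftPow_zero]
    rfl
  rw [h, toFrac_shiftApply, toFrac_shiftApply, toFrac_shiftApply, toFrac_shiftApply]
  exact (isRationalOverFrac_monom _ _).mul ((isRationalOverFrac_monom _ _).mul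
    ((hH _ _).mul ((isRationalOverFrac_monom _ _).mul (isRationalOverFrac_monom _ _))))

theorem isAdmissible_masterBracket (hH : IsRationalMatrix S.der H) :
    IsAdmissible F (masterBracket S H) := by
  intro a b c
  obtain ⟨x, hx⟩ := (isNonlocalBracket_masterBracket S H).exists_expand_eq a
    (isRationalOverFrac_masterBracket S H hH b c)
  refine ⟨Submodule.Quotient.mk x, ?_⟩
  funext i j
  exact hx i j

end Admissibility

/-! ### The Jacobi identity -/

section Jacobi

variable {F V : Type*} [Field F] [CommRing V] [Algebra F V] {δ : Derivation F V V}
  {B : V → V → LaurentSeries V}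

/-- With representatives and an explicit multiple of ν - λ - μ, operators on series can be applied
before passing to the quotient. -/
theorem jacobiAt_iff {a b c : V} : JacobiAt F B a b c ↔ ∃ x y z r : Series3 F V,
    expandMuLambdaAux x = nestedRight B a b c ∧
    expandLambdaMuAux y = (fun m n => nestedRight B b a c n m) ∧
    expandLambdaNuAux z = nestedLeft B a b c ∧
    x - y = z + mulRel F V r := by
  constructor
  · rintro ⟨X, Y, Z, hX, hY, hZ, h⟩
    obtain ⟨x, rfl⟩ := Submodule.Quotient.mk_surjective _ X
    obtain ⟨y, rfl⟩ := Submodule.Quotient.mk_surjective _ Y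
    obtain ⟨z, rfl⟩ := Submodule.Quotient.mk_surjective _ Z
    rw [← Submodule.Quotient.mk_sub, Submodule.Quotient.eq] at h
    obtain ⟨r, hr⟩ := h
    exact ⟨x, y, z, r, hX, hY, hZ, by rw [hr, add_sub_cancel]⟩
  · rintro ⟨x, y, z, r, hx, hy, hz, h⟩
    refine ⟨Submodule.Quotient.mk x, Submodule.Quotient.mk y, Submodule.Quotient.mk z,
      hx, hy, hz, ?_⟩
    rw [← Submodule.Quotient.mk_sub, Submodule.Quotient.eq]
    exact ⟨r, by rw [h, add_sub_cancel_left]⟩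

/-- The map `v ↦ {a_λ v}`, through its coefficients. -/
def IsNonlocalBracket.rightHom (hB : IsNonlocalBracket δ B) (a : V) : V →+ (ℤ → V) where
  toFun v := lcoeff (B a v)
  map_zero' := by rw [(hB.linear_right a).map_zero]; rfl
  map_add' v w := by rw [(hB.linear_right a).map_add]; rfl

/-- The map `v ↦ {v_λ c}`, through its coefficients. -/
def IsNonlocalBracket.leftHom (hB : IsNonlocalBracket δ B) (c : V) : V →+ (ℤ → V) where
  toFun v := lcoeff (B v c)
  map_zero' := by rw [(hB.linear_left c).map_zero]; rfl
  map_add' v w := by rw [(hB.linear_left c).map_add]; rfl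

/-- Inside the first argument of the outer bracket ∂ acts as -ν, so the substitution λ ↦ -λ - ∂ of
skewsymmetry becomes λ ↦ ν - λ. -/
theorem nestedLeft_swap (hB : IsNonlocalBracket δ B) (hS : IsSkewsymmetric δ B) (a b c : V) :
    nestedLeft B b a c = -subFst (nestedLeft B a b c) := by
  have hθ : ∀ v, hB.leftHom c (derHom δ v) = (-shiftSeq : (ℤ → V) →+ (ℤ → V)) (hB.leftHom c v) :=
    fun v => funext fun j => by
      change lcoeff (B (δ v) c) j = -(lcoeff (B v c) (j - 1))
      rw [hB.sesq_left, monom_one_mul, lcoeff_neg, lcoeff_lamMul]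
  have h1 : toSeries (nestedLeft B a b c) = mapCoeff (hB.leftHom c) (B a b) :=
    toSeries_lcoeff (mapCoeff (hB.leftHom c) (B a b))
  funext i j
  change hB.leftHom c (lcoeff (B b a) i) j =
    -(lcoeff (adjHom (-shiftSeq : (ℤ → V) →+ (ℤ → V)) (toSeries (nestedLeft B a b c))) i j)
  rw [h1, ← mapCoeff_adjHom hθ, hS a b, lcoeff_neg, map_neg]
  rfl

/-- Inside {a_λ ·} the derivation becomes λ + ∂, so μ ↦ -μ - ∂ turns into μ ↦ -λ - μ - ∂. -/
theorem nestedRight_swap (hB : IsNonlocalBracket δ B) (hS : IsSkewsymmetric δ B) (a b c : V) :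
    nestedRight B a c b = -adjTwist (derHom δ) (nestedRight B a b c) := by
  have hθ : ∀ v, hB.rightHom a (derHom δ v) = twist (derHom δ) (hB.rightHom a v) :=
    fun v => funext fun j => hB.lcoeff_der_right a v j
  have h1 : toSeries (fun j i => nestedRight B a b c i j) = mapCoeff (hB.rightHom a) (B b c) :=
    toSeries_lcoeff (mapCoeff (hB.rightHom a) (B b c))
  funext i j
  change hB.rightHom a (lcoeff (B c b) j) i =
    -(lcoeff (adjHom (twist (derHom δ)) (toSeries fun j i => nestedRight B a b c i j)) j i)
  rw [h1, ← mapCoeff_adjHom hθ, hS b c, lcoeff_neg, map_neg]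
  rfl

/-- Skewsymmetry is applied to the outer bracket, for each fixed power of λ in the inner one. -/
theorem nestedRight_eq_adjSecond (hS : IsSkewsymmetric δ B) (a b c : V) :
    (fun m n => nestedRight B c a b n m) = -adjSecond (derHom δ) (nestedLeft B a b c) := by
  funext i j
  change lcoeff (B c (lcoeff (B a b) i)) j =
    -(lcoeff (adjHom _ (toSeries (lcoeff (B (lcoeff (B a b) i) c)))) j)
  rw [toSeries_lcoeff, hS _ c]
  rfl

theorem nestedLeft_eq_adjSecond (hS : IsSkewsymmetric δ B) (a b c : V) :
    nestedLeft B a c b = -adjSecond (derHom δ) (fun m n => nestedRight B b a c n m) := by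
  funext i j
  change lcoeff (B (lcoeff (B a c) i) b) j =
    -(lcoeff (adjHom _ (toSeries (lcoeff (B b (lcoeff (B a c) i))))) j)
  rw [toSeries_lcoeff, hS b _]
  rfl

/-- Exchanging λ and μ interchanges the two terms on the left, and skewsymmetry of {a_λ b} gives the
sign on the right. -/
theorem JacobiAt.swap_fst (hB : IsNonlocalBracket δ B) (hS : IsSkewsymmetric δ B) {a b c : V}
    (h : JacobiAt F B a b c) : JacobiAt F B b a c := by
  obtain ⟨x, y, z, r, hx, hy, hz, h⟩ := jacobiAt_iff.1 h
  refine jacobiAt_iff.2 ⟨swap12 y, swap12 x, -swap12 z, -swap12 r, ?_, ?_, ?_, ?_⟩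
  · funext i j
    rw [expandMuLambdaAux_swap12, hy]
  · funext i j
    rw [expandLambdaMuAux_swap12, hx]
  · rw [map_neg, expandLambdaNuAux_swap12, hz, nestedLeft_swap hB hS a b c]
  · have h1 : swap12 (mulRel F V r) = mulRel F V (swap12 r) := by
      rw [mulRel_eq, mulRel_eq, map_sub, map_sub, sub_right_comm]
      rfl
    rw [← map_sub, ← neg_sub, map_neg, h, map_add, h1, map_neg, neg_add]

/-- Reflection, with a sign, maps the first term to the first term and interchanges the second and
the third; x - y = z and x - z = y are the same relation. -/
theorem JacobiAt.swap_snd (hB : IsNonlocalBracket δ B) (hS : IsSkewsymmetric δ B) {a b c : V}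
    (h : JacobiAt F B a b c) : JacobiAt F B a c b := by
  obtain ⟨x, y, z, r, hx, hy, hz, h⟩ := jacobiAt_iff.1 h
  refine jacobiAt_iff.2 ⟨-reflect (derHom δ) x, -reflect (derHom δ) z, -reflect (derHom δ) y,
    -reflect (derHom δ) r, ?_, ?_, ?_, ?_⟩
  · rw [map_neg, expandMuLambdaAux_reflect, hx, nestedRight_swap hB hS a b c]
  · rw [map_neg, expandLambdaMuAux_reflect, hz, nestedRight_eq_adjSecond hS a b c]
  · rw [map_neg, expandLambdaNuAux_reflect, hy, nestedLeft_eq_adjSecond hS a b c]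
  · have h1 := congrArg (reflect (derHom δ)) h
    rw [reflect_sub, reflect_add, reflect_mulRel] at h1
    rw [sub_eq_iff_eq_add] at h1
    rw [map_neg, h1]
    abel

/-- Multiplication by `ν + ∂` to the power `p`. -/
def nuPow (δ : Derivation F V V) : ℕ → Series3 F V →+ Series3 F V
  | 0 => AddMonoidHom.id _
  | p + 1 => (mulN 1 + map3 (derHom δ)).comp (nuPow δ p)

theorem nuPow_succ (p : ℕ) (a : Series3 F V) :
    nuPow δ (p + 1) a = mulN 1 (nuPow δ p a) + map3 (derHom δ) (nuPow δ p a) := rfl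

theorem map3_mulRel (φ : V →+ V) (a : Series3 F V) :
    map3 φ (mulRel F V a) = mulRel F V (map3 φ a) := by
  rw [mulRel_eq, mulRel_eq, map_sub, map_sub]
  rfl

theorem nuPow_mulRel (p : ℕ) (a : Series3 F V) :
    nuPow δ p (mulRel F V a) = mulRel F V (nuPow δ p a) := by
  induction p with
  | zero => rfl
  | succ p ih =>
    rw [nuPow_succ, nuPow_succ, ih, map3_mulRel, map_add]
    rfl

/-- By sesquilinearity, applying μ + ∂ to the inner bracket amounts to applying λ + μ + ∂ to the
nested one, and λ + μ is the expansion of ν. -/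
theorem expandMuLambdaAux_nuPow (hB : IsNonlocalBracket δ B) (a : V) {x : Series3 F V}
    {A : LaurentSeries V} (h : ∀ i j, expandMuLambdaAux x i j = lcoeff (B a (lcoeff A j)) i)
    (p : ℕ) (i j : ℤ) : expandMuLambdaAux (nuPow δ p x) i j =
      lcoeff (B a (lcoeff (shiftPow (derHom δ) p A) j)) i := by
  induction p generalizing i j with
  | zero => rw [Nat.cast_zero, shiftPow_zero, ← h]; rfl
  | succ p ih =>
    rw [nuPow_succ, map_add, Pi.add_apply, Pi.add_apply, expandMuLambdaAux_mulN_one,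
      expandMuLambdaAux_map3, ih, ih, ih, Nat.cast_succ, shiftPow_add_one, lcoeff_shiftStep,
      (hB.linear_right a).map_add, lcoeff_add, derHom_apply, derHom_apply, hB.lcoeff_der_right]
    ring

theorem expandLambdaMuAux_nuPow (hB : IsNonlocalBracket δ B) (b : V) {x : Series3 F V}
    {A : LaurentSeries V} (h : ∀ i j, expandLambdaMuAux x i j = lcoeff (B b (lcoeff A i)) j)
    (p : ℕ) (i j : ℤ) : expandLambdaMuAux (nuPow δ p x) i j =
      lcoeff (B b (lcoeff (shiftPow (derHom δ) p A) i)) j := by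
  induction p generalizing i j with
  | zero => rw [Nat.cast_zero, shiftPow_zero, ← h]; rfl
  | succ p ih =>
    rw [nuPow_succ, map_add, Pi.add_apply, Pi.add_apply, expandLambdaMuAux_mulN_one,
      expandLambdaMuAux_map3, ih, ih, ih, Nat.cast_succ, shiftPow_add_one, lcoeff_shiftStep,
      (hB.linear_right b).map_add, lcoeff_add, derHom_apply, derHom_apply, hB.lcoeff_der_right]
    ring

theorem expandLambdaNuAux_nuPow {z : Series3 F V} {A : ℤ → LaurentSeries V}
    (h : ∀ i j, expandLambdaNuAux z i j = lcoeff (A i) j) (p : ℕ) (i j : ℤ) :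
    expandLambdaNuAux (nuPow δ p z) i j = lcoeff (shiftPow (derHom δ) p (A i)) j := by
  induction p generalizing i j with
  | zero => rw [Nat.cast_zero, shiftPow_zero, ← h]; rfl
  | succ p ih =>
    rw [nuPow_succ, map_add, Pi.add_apply, Pi.add_apply, expandLambdaNuAux_mulN,
      expandLambdaNuAux_map3, ih, ih, Nat.cast_succ, shiftPow_add_one, lcoeff_shiftStep]

/-- The product of a series in `λ` and a series in `μ`. -/
def prod3 (A A' : LaurentSeries V) : Series3 F V :=
  ⟨fun m n p => if p = 0 then lcoeff A m * lcoeff A' n else 0, by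
    obtain ⟨M, hM⟩ := exists_vanishAbove A
    obtain ⟨N, hN⟩ := exists_vanishAbove A'
    refine ⟨max 0 (max M N), fun m n p h => ?_⟩
    beta_reduce
    split_ifs with hp
    · by_cases hm : M < m
      · rw [hM m hm, zero_mul]
      · rw [hN n (by omega), mul_zero]
    · rfl⟩

theorem expandMuLambdaAux_prod3 (A A' : LaurentSeries V) (i j : ℤ) :
    expandMuLambdaAux (prod3 A A' : Series3 F V) i j = lcoeff A i * lcoeff A' j :=
  expandMuLambdaAux_of_third (fun _ _ _ hp => if_neg hp) i j

theorem expandLambdaMuAux_prod3 (A A' : LaurentSeries V) (i j : ℤ) :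
    expandLambdaMuAux (prod3 A A' : Series3 F V) i j = lcoeff A i * lcoeff A' j :=
  expandLambdaMuAux_of_third (fun _ _ _ hp => if_neg hp) i j

variable {ℓ : ℕ} (S : DiffFunAlgebra F V ℓ) (H : Matrix (Fin ℓ) (Fin ℓ) (LaurentSeries V))

theorem DiffFunAlgebra.OrderLT.pd {S : DiffFunAlgebra F V ℓ} {f : V} {N : ℕ}
    (h : S.OrderLT f N) (k : Fin ℓ) (p : ℕ) : S.OrderLT (S.pd k p f) N := fun i n hn => by
  rw [S.pd_comm, h i n hn, map_zero]

theorem Series3.coe_sum_apply {ι : Type*} (s : Finset ι) (a : ι → Series3 F V) (m n p : ℤ) :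
    (∑ i ∈ s, a i).1 m n p = ∑ i ∈ s, (a i).1 m n p := by
  simp only [Submodule.coe_sum, Finset.sum_apply]

/-- The symmetry of second derivatives. -/
theorem sum_prod3_comm (a b : V) {h : V} {N : ℕ} (hN : S.OrderLT h N) :
    ∑ q ∈ Finset.univ ×ˢ Finset.range N,
      (prod3 (masterBracket S H a (S.pd q.1 q.2 h))
        (shiftPow (derHom S.der) q.2 (masterBracket S H b (S.u q.1 0))) : Series3 F V) =
    ∑ q ∈ Finset.univ ×ˢ Finset.range N,
      prod3 (shiftPow (derHom S.der) q.2 (masterBracket S H a (S.u q.1 0)))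
        (masterBracket S H b (S.pd q.1 q.2 h)) := by
  refine Series3.ext fun m n p => ?_
  rw [Series3.coe_sum_apply, Series3.coe_sum_apply]
  by_cases hp : p = 0
  · subst hp
    have hB : ∀ (c : V) (q : Fin ℓ × ℕ) (k : ℤ), lcoeff (masterBracket S H c (S.pd q.1 q.2 h)) k =
        ∑ r ∈ Finset.univ ×ˢ Finset.range N, S.pd r.1 r.2 (S.pd q.1 q.2 h) *
          lcoeff (shiftPow (derHom S.der) r.2 (masterBracket S H c (S.u r.1 0))) k := by
      intro c q k
      rw [masterBracket_eq S H c (hN.pd q.1 q.2), Finset.sum_product, lcoeff_sum]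
      refine Finset.sum_congr rfl fun j _ => ?_
      rw [lcoeff_sum]
      exact Finset.sum_congr rfl fun n _ => rfl
    simp only [prod3, if_true, hB, Finset.sum_mul, Finset.mul_sum]
    -- After expanding the brackets of first derivatives, both sides are double sums over second
    -- derivatives of `h`, with the two indices exchanged.
    rw [Finset.sum_comm]
    refine Finset.sum_congr rfl fun q _ => Finset.sum_congr rfl fun r _ => ?_
    rw [S.pd_comm]
    ring
  · simp only [prod3, if_neg hp]

/-- Each coefficient of {a_λ ·} is a derivation, so it either hits ∂h/∂u, giving a product of series
in λ and in μ, or it hits the bracket of `b` with a generator. -/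
theorem nestedRight_masterBracket (a b : V) {h : V} {N : ℕ} (hN : S.OrderLT h N) (i j : ℤ) :
    nestedRight (masterBracket S H) a b h i j = ∑ q ∈ Finset.univ ×ˢ Finset.range N,
      (lcoeff (masterBracket S H a (S.pd q.1 q.2 h)) i *
        lcoeff (shiftPow (derHom S.der) q.2 (masterBracket S H b (S.u q.1 0))) j +
      S.pd q.1 q.2 h * lcoeff (masterBracket S H a
        (lcoeff (shiftPow (derHom S.der) q.2 (masterBracket S H b (S.u q.1 0))) j)) i) := by
  have hB := isNonlocalBracket_masterBracket S H
  have h1 : lcoeff (masterBracket S H b h) j = ∑ q ∈ Finset.univ ×ˢ Finset.range N,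
      S.pd q.1 q.2 h *
        lcoeff (shiftPow (derHom S.der) q.2 (masterBracket S H b (S.u q.1 0))) j := by
    rw [masterBracket_eq S H b hN, Finset.sum_product, lcoeff_sum]
    refine Finset.sum_congr rfl fun j _ => ?_
    rw [lcoeff_sum]
    exact Finset.sum_congr rfl fun n _ => rfl
  change hB.rightDer a i _ = _
  rw [h1, map_sum]
  refine Finset.sum_congr rfl fun q _ => ?_
  rw [Derivation.leibniz, smul_eq_mul, smul_eq_mul, hB.rightDer_apply, hB.rightDer_apply]
  ring

/-- Each nested bracket with `h` contains ∑ ∂h/∂u_k⁽ᵖ⁾ (ν + ∂)ᵖ applied to the one with u_k. The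
product terms, present only in the two brackets on the left, agree by `sum_prod3_comm`. The
operators `T` preserve multiples of ν - λ - μ. -/
theorem jacobiAt_of_generators {a b : V}
    (hJ : ∀ k, JacobiAt F (masterBracket S H) a b (S.u k 0)) (h : V) :
    JacobiAt F (masterBracket S H) a b h := by
  have hB := isNonlocalBracket_masterBracket S H
  obtain ⟨N, hN⟩ := S.exists_orderLT h
  choose x y z r hx hy hz hr using fun k => jacobiAt_iff.1 (hJ k)
  let T : Fin ℓ × ℕ → Series3 F V →+ Series3 F V := fun q =>
    (map3 (AddMonoidHom.mulLeft (S.pd q.1 q.2 h))).comp (nuPow S.der q.2)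
  have hT : ∀ q a, T q a = map3 (AddMonoidHom.mulLeft (S.pd q.1 q.2 h)) (nuPow S.der q.2 a) :=
    fun _ _ => rfl
  refine jacobiAt_iff.2 ⟨∑ q ∈ Finset.univ ×ˢ Finset.range N,
      (prod3 (masterBracket S H a (S.pd q.1 q.2 h))
        (shiftPow (derHom S.der) q.2 (masterBracket S H b (S.u q.1 0))) + T q (x q.1)),
    ∑ q ∈ Finset.univ ×ˢ Finset.range N,
      (prod3 (shiftPow (derHom S.der) q.2 (masterBracket S H a (S.u q.1 0)))
        (masterBracket S H b (S.pd q.1 q.2 h)) + T q (y q.1)),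
    ∑ q ∈ Finset.univ ×ˢ Finset.range N, T q (z q.1),
    ∑ q ∈ Finset.univ ×ˢ Finset.range N, T q (r q.1), ?_, ?_, ?_, ?_⟩
  · funext i j
    rw [nestedRight_masterBracket S H a b hN, map_sum, Finset.sum_apply, Finset.sum_apply]
    refine Finset.sum_congr rfl fun q _ => ?_
    rw [map_add, Pi.add_apply, Pi.add_apply, expandMuLambdaAux_prod3, hT, expandMuLambdaAux_map3,
      expandMuLambdaAux_nuPow hB a fun i j => congrFun (congrFun (hx q.1) i) j]
    rfl
  · funext i j
    rw [nestedRight_masterBracket S H b a hN, map_sum, Finset.sum_apply, Finset.sum_apply]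
    refine Finset.sum_congr rfl fun q _ => ?_
    rw [map_add, Pi.add_apply, Pi.add_apply, expandLambdaMuAux_prod3, hT, expandLambdaMuAux_map3,
      expandLambdaMuAux_nuPow hB b fun i j => congrFun (congrFun (hy q.1) i) j, mul_comm]
    rfl
  · funext i j
    rw [map_sum, Finset.sum_apply, Finset.sum_apply]
    rw [nestedLeft, masterBracket_eq S H _ hN, Finset.sum_product, lcoeff_sum]
    refine Finset.sum_congr rfl fun k _ => ?_
    rw [lcoeff_sum]
    refine Finset.sum_congr rfl fun p _ => ?_
    rw [hT, expandLambdaNuAux_map3,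
      expandLambdaNuAux_nuPow (A := fun i => masterBracket S H (lcoeff (masterBracket S H a b) i)
        (S.u k 0)) fun i j => congrFun (congrFun (hz k) i) j]
    rfl
  · rw [Finset.sum_add_distrib, Finset.sum_add_distrib, sum_prod3_comm S H a b hN,
      add_sub_add_left_eq_sub, ← Finset.sum_sub_distrib, map_sum, ← Finset.sum_add_distrib]
    refine Finset.sum_congr rfl fun q _ => ?_
    rw [← map_sub, hr, map_add, hT q (mulRel F V _), nuPow_mulRel, map3_mulRel, ← hT]

theorem jacobiAt_of_generators_triple (hS : IsSkewsymmetric S.der (masterBracket S H))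
    (hJ : ∀ i j k, JacobiAt F (masterBracket S H) (S.u i 0) (S.u j 0) (S.u k 0)) (a b c : V) :
    JacobiAt F (masterBracket S H) a b c := by
  have hB := isNonlocalBracket_masterBracket S H
  -- From (u_i, u_k, u_m) for all m one gets (u_i, u_k, b), hence (u_i, b, u_k) for all k, and then
  -- (u_i, b, c).
  have h1 : ∀ i b c, JacobiAt F (masterBracket S H) (S.u i 0) b c := fun i b =>
    jacobiAt_of_generators S H fun k =>
      (jacobiAt_of_generators S H (hJ i k) b).swap_snd hB hS
  -- The triple (u_k, a, b) becomes (a, u_k, b) and then (a, b, u_k), so the last generator can be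
  -- replaced by `c`.
  exact jacobiAt_of_generators S H (fun k => ((h1 k a b).swap_fst hB hS).swap_snd hB hS) c

end Jacobi

end NonlocalPVA

/-! ### The theorem: assembly of the four statements -/

theorem theorem4p3 {F V : Type*} [Field F] [CharZero F] [CommRing V] [IsDomain V] [Algebra F V]
    {ℓ : ℕ} (S : NonlocalPVA.DiffFunAlgebra F V ℓ)
    (H : Matrix (Fin ℓ) (Fin ℓ) (LaurentSeries V)) :
    -- (a) the sums are finite, and the Master Formula gives a non-local bracket
    ((∀ f g, (Function.support (NonlocalPVA.masterTerm S H f g)).Finite) ∧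
      NonlocalPVA.IsNonlocalBracket S.der (NonlocalPVA.masterBracket S H)) ∧
    -- (b) skewsymmetry
    (NonlocalPVA.IsSkewsymmetric S.der (NonlocalPVA.masterBracket S H) ↔
      NonlocalPVA.IsSkewadjoint S.der H) ∧
    -- (c) admissibility
    (NonlocalPVA.IsRationalMatrix S.der H →
      NonlocalPVA.IsAdmissible F (NonlocalPVA.masterBracket S H)) ∧
    -- (d) the Poisson property, that is the Jacobi identity, can be checked on generators
    (NonlocalPVA.IsRationalMatrix S.der H → NonlocalPVA.IsSkewadjoint S.der H →
      (NonlocalPVA.IsNonlocalPoisson S.der (NonlocalPVA.masterBracket S H) ↔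
        ∀ a b c, NonlocalPVA.JacobiAt F (NonlocalPVA.masterBracket S H) a b c) ∧
      ((∀ a b c, NonlocalPVA.JacobiAt F (NonlocalPVA.masterBracket S H) a b c) ↔
        ∀ i j k, NonlocalPVA.JacobiAt F (NonlocalPVA.masterBracket S H)
          (S.u i 0) (S.u j 0) (S.u k 0))) := by
  have hB := NonlocalPVA.isNonlocalBracket_masterBracket S H
  have hS := NonlocalPVA.isSkewsymmetric_masterBracket_iff S H
  have hA := NonlocalPVA.isAdmissible_masterBracket S H
  refine ⟨⟨NonlocalPVA.masterTerm_support_finite S H, hB⟩, hS, hA, fun hr hs => ⟨?_, ?_⟩⟩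
  · exact ⟨fun h => h.jacobi, fun h => ⟨hB, hS.2 hs, hA hr, h⟩⟩
  · exact ⟨fun h i j k => h _ _ _,
      NonlocalPVA.jacobiAt_of_generators_triple S H (hS.2 hs)⟩
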